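/- Let $m\ge 1$ and $n\ge 2m$ be integers, let $\mathcal L=(\ell_0,\dots,\ell_n)$ be an $(n+1)$-tuple of linear forms on $\mathbb C^m$, each identified with its coefficient vector in $\mathbb C^m\cong\mathbb R^{2m}$, and let $\mathcal E$ be a family of subsets of $\{0,\dots,n\}$ of cardinality $2m+1$. For $E\in\mathcal E$ let $P_E\subset\mathbb R^{2m}$ be the convex hull of $\{\ell_i : i\in E\}$. Assume that $(\mathcal L,\mathcal E,m,n)$ is an LVMB datum, that is: (sep) $\mathring P_E\cap\mathring P_{E'}\neq\varnothing$ for all $E,E'\in\mathcal E$; (comp) for every $E\in\mathcal E$ and every $i\in\{0,\dots,n\}$ there is $j\in E$ with $(E\setminus\{j\})\cup\{i\}\in\mathcal E$. Let $U(\mathcal E)\subset\mathbb P^n$ be the open set of all $[x_0:\dots:x_n]$ for which there is $E\in\mathcal E$ with $x_i\ne0$ for all $i\in E$, and let $\mathbb C^m$ act on it by $z\cdot[x_0:\dots:x_n]=[e^{\ell_0(z)}x_0:\dots:e^{\ell_n(z)}x_n]$. Then the quotient $N=N(\mathcal L,\mathcal E,m,n)=U(\mathcal E)/\mathbb C^m$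 exists as a complex manifold of dimension $n-m$ (with $U(\mathcal E)\to N$ a holomorphic submersion whose fibres are the orbits), $N$ is compact, and the following hold. (1) Suppose that $(\mathcal L,\mathcal E,m,n)$ satisfies condition (K): some real affine automorphism of $\mathbb R^{2m}$ sends every $\ell_i$ to a vector with integer coordinates. Then $N$ is an intermediate GIT-quotient: there are - an effective linear action of $T=(\mathbb C^*)^{2m}$ on $\mathbb P^n$, $t\cdot[x_0:\dots:x_n]=[t^{\lambda_0}x_0:\dots:t^{\lambda_n}x_n]$ with $\lambda_0,\dots,\lambda_n\in\mathbb Z^{2m}$, - an open subset $U\subset\mathbb P^n$ that is good for this action (it is $T$-stable, $T$ acts properly on $U$, and $U/T$ is compact), - a closed cocompact complex Lie subgroup $G\subset T$ isomorphic to $\mathbb C^m$, such that $N$ is biholomorphic to the quotient manifold $U/G$. (2) Without assuming (K), $N$ is a small deformation of intermediate GIT-quotients (for the same $m$ and $n$): there are a proper holomorphic submersion $\pi:\mathcal X\to B$ of complex manifolds, with $B$ a connected open subset of some $\mathbb C^k$, and a point $b_0\in B$ such that $\pi^{-1}(b_0)$ is biholomorphic to $N$ and there are points $b\in B$ arbitrarily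 close to $b_0$ (possibly $b_0$ itself) for which $\pi^{-1}(b)$ is biholomorphic to an intermediate GIT-quotient as in (1). -/

import Mathlib

open Topology TopologicalSpace
open scoped LinearAlgebra.Projectivization Manifold ContDiff

/-! ### Projective space and diagonal actions -/

/-- Complex projective space `ℙⁿ`, with homogeneous coordinates `[x₀ : … : xₙ]`. -/
abbrev CPn (n : ℕ) : Type := ℙ ℂ (Fin (n + 1) → ℂ)

/-- The usual topology of `ℙⁿ`: the quotient topology from `ℂⁿ⁺¹ ∖ {0}`. -/
noncomputable instance CPn.instTopologicalSpace (n : ℕ) : TopologicalSpace (CPn n) :=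
  TopologicalSpace.coinduced
    (fun v : {v : Fin (n + 1) → ℂ // v ≠ 0} => Projectivization.mk ℂ v.1 v.2) inferInstance

/-- The torus `(ℂ*)ᵏ`. -/
abbrev CTorus (k : ℕ) : Type := Fin k → ℂˣ

instance CTorus.instSMulCommClass (k : ℕ) : SMulCommClass (CTorus k) ℂ (Fin k → ℂ) where
  smul_comm c a x := by
    funext i
    exact smul_comm (c i) a (x i)

/-- Every linear action in this file is given by a homomorphism from the acting group to the
torus `(ℂ*)ⁿ⁺¹`, which acts on `ℙⁿ` by
`(c₀, …, cₙ) • [x₀ : … : xₙ] = [c₀ x₀ : … : cₙ xₙ]`. -/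
theorem CPn.torus_smul_mk {n : ℕ} (c : CTorus (n + 1)) (x : Fin (n + 1) → ℂ) (hx : x ≠ 0)
    (hcx : (fun i => (c i : ℂ) * x i) ≠ 0) :
    c • Projectivization.mk ℂ x hx = Projectivization.mk ℂ (fun i => (c i : ℂ) * x i) hcx :=
  rfl

/-- The action of the additive group `ℂᵐ` given by linear forms `ℓ₀, …, ℓₙ`:
`z • [x₀ : … : xₙ] = [exp (ℓ₀ z) x₀ : … : exp (ℓₙ z) xₙ]`. -/
noncomputable def holAction {m n : ℕ} (ℓ : Fin (n + 1) → Fin m → ℂ) :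
    Multiplicative (Fin m → ℂ) →* CTorus (n + 1) where
  toFun z := fun i =>
    Units.mk0 (Complex.exp (∑ j, ℓ i j * z.toAdd j)) (Complex.exp_ne_zero _)
  map_one' := by
    funext i
    ext
    simp
  map_mul' z w := by
    funext i
    ext
    simp [mul_add, Finset.sum_add_distrib, Complex.exp_add]

/-- The action of the torus `(ℂ*)ᵏ` given by weights `lam₀, …, lamₙ ∈ ℤᵏ`:
`t • [x₀ : … : xₙ] = [t ^ lam₀ x₀ : … : t ^ lamₙ xₙ]`, with `t ^ a = t₁ ^ a₁ ⋯ tₖ ^ aₖ`. -/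
noncomputable def algAction {k n : ℕ} (lam : Fin (n + 1) → Fin k → ℤ) :
    CTorus k →* CTorus (n + 1) where
  toFun t := fun i => ∏ j, t j ^ lam i j
  map_one' := by
    funext i
    simp
  map_mul' s t := by
    funext i
    simp [mul_zpow, Finset.prod_mul_distrib]

section Orbits

variable {n : ℕ} {G : Type} [Group G]

/-- Two points of `U ⊆ ℙⁿ` are equivalent when some element of `G` moves one to the other. -/
def orbitSetoid (ρ : G →* CTorus (n + 1)) (U : Opens (CPn n)) : Setoid U where
  r x y := ∃ g : G, ρ g • (x : CPn n) = y
  iseqv :=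
    { refl := fun x => ⟨1, by simp⟩
      symm := by
        rintro x y ⟨g, hg⟩
        exact ⟨g⁻¹, by rw [← hg, map_inv, inv_smul_smul]⟩
      trans := by
        rintro x y z ⟨g, hg⟩ ⟨h, hh⟩
        exact ⟨h * g, by rw [map_mul, mul_smul, hg, hh]⟩ }

/-- The topological quotient `U / G` (with the quotient topology). -/
abbrev OrbitSpace (ρ : G →* CTorus (n + 1)) (U : Opens (CPn n)) : Type :=
  Quotient (orbitSetoid ρ U)

/-- The open subset `U` of `ℙⁿ` is good with respect to the action of `G` on `ℙⁿ` through `ρ`: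
the action on `ℙⁿ` is effective, `U` is stable, the action on `U` is proper and `U / G` is
compact. -/
structure IsGood [TopologicalSpace G] (ρ : G →* CTorus (n + 1)) (U : Opens (CPn n)) : Prop where
  effective : ∀ g : G, (∀ x : CPn n, ρ g • x = x) → g = 1
  stable : ∀ (g : G) (x : CPn n), x ∈ U → ρ g • x ∈ U
  proper : IsProperMap
    (fun q : G × U => ((⟨ρ q.1 • (q.2 : CPn n), stable q.1 q.2 q.2.2⟩ : U), q.2))
  compact : CompactSpace (OrbitSpace ρ U)

end Orbits

/-! ### Complex manifolds and holomorphic quotients -/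

/-- A (Hausdorff, second countable) complex manifold of dimension `d`. -/
structure ComplexManifold (d : ℕ) where
  carrier : Type
  [topology : TopologicalSpace carrier]
  [charted : ChartedSpace (Fin d → ℂ) carrier]
  [isManifold : IsManifold 𝓘(ℂ, Fin d → ℂ) ω carrier]
  [t2 : T2Space carrier]
  [secondCountable : SecondCountableTopology carrier]

instance (d : ℕ) : CoeSort (ComplexManifold d) Type := ⟨ComplexManifold.carrier⟩

attribute [instance] ComplexManifold.topology ComplexManifold.charted
  ComplexManifold.isManifold ComplexManifold.t2 ComplexManifold.secondCountable

/-- The cone in `ℂⁿ⁺¹ ∖ {0}` over an open subset of `ℙⁿ`. -/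
def coneOver {n : ℕ} (U : Opens (CPn n)) : Opens (Fin (n + 1) → ℂ) where
  carrier := {x | ∃ h : x ≠ 0, Projectivization.mk ℂ x h ∈ U}
  is_open' := by
    have h1 : IsOpen {v : {v : Fin (n + 1) → ℂ // v ≠ 0} |
        Projectivization.mk ℂ v.1 v.2 ∈ U} := isOpen_coinduced.1 U.2
    have h2 := (isOpen_ne (x := (0 : Fin (n + 1) → ℂ))).isOpenMap_subtype_val _ h1
    convert h2 using 1
    ext x
    constructor
    · rintro ⟨h, hx⟩
      exact ⟨⟨x, h⟩, hx, rfl⟩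
    · rintro ⟨v, hv, rfl⟩
      exact ⟨v.2, hv⟩

/-- The projection `x ↦ [x]` from the cone over `U` to `U`. -/
noncomputable def coneProj {n : ℕ} (U : Opens (CPn n)) (x : coneOver U) : U :=
  ⟨Projectivization.mk ℂ x.1 x.2.1, x.2.2⟩

/-- `p : U → N` exhibits the complex manifold `N` as the quotient `U / G`: it is a surjective
holomorphic submersion whose fibres are exactly the `G`-orbits. (The complex structure of `ℙⁿ` is
the one that makes `ℂⁿ⁺¹ ∖ {0} → ℙⁿ` a holomorphic submersion, so `p` is a holomorphic submersion
if and only if its composition with this projection is one.) These properties determine `N`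
together with `p` up to a unique biholomorphism. -/
structure IsQuotientMap {n d : ℕ} {G : Type} [Group G] (ρ : G →* CTorus (n + 1))
    (U : Opens (CPn n)) (N : ComplexManifold d) (p : U → N) : Prop where
  surjective : Function.Surjective p
  fibres : ∀ x y : U, p x = p y ↔ ∃ g : G, ρ g • (x : CPn n) = y
  submersion : Manifold.IsSubmersion 𝓘(ℂ, Fin (n + 1) → ℂ) 𝓘(ℂ, Fin d → ℂ) ω
    (fun x : coneOver U => p (coneProj U x))

/-- The complex manifold `N` is the quotient `U / G`. -/
def IsQuotient {n d : ℕ} {G : Type} [Group G] (ρ : G →* CTorus (n + 1))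
    (U : Opens (CPn n)) (N : ComplexManifold d) : Prop :=
  ∃ p : U → N, IsQuotientMap ρ U N p

/-! ### LVMB-manifolds -/

/-- Data `(𝓛, 𝓔, m, n)`: an `(n+1)`-tuple `𝓛` of linear forms on `ℂᵐ` and a family `𝓔` of
subsets of `{0, …, n}` of cardinality `2m+1`. -/
structure LVMData (m n : ℕ) where
  form : Fin (n + 1) → Fin m → ℂ
  family : Set (Finset (Fin (n + 1)))
  card_eq : ∀ s ∈ family, s.card = 2 * m + 1

namespace LVMData

variable {m n : ℕ} (D : LVMData m n)

/-- The convex hull of the `ℓᵢ`, `i ∈ s`, in `ℂᵐ = ℝ²ᵐ`. -/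
def polytope (s : Finset (Fin (n + 1))) : Set (Fin m → ℂ) :=
  convexHull ℝ (D.form '' s)

/-- The two conditions (sep) and (comp) that define LVMB-data. -/
structure IsLVMB : Prop where
  sep : ∀ s ∈ D.family, ∀ t ∈ D.family,
    (interior (D.polytope s) ∩ interior (D.polytope t)).Nonempty
  comp : ∀ s ∈ D.family, ∀ i : Fin (n + 1), ∃ j ∈ s, insert i (s.erase j) ∈ D.family

/-- Condition (K): a real affine automorphism of `ℂᵐ = ℝ²ᵐ` sends every `ℓᵢ` to a vector with
integer coordinates (real and imaginary parts). -/
def ConditionK : Prop :=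
  ∃ φ : (Fin m → ℂ) ≃ᵃ[ℝ] (Fin m → ℂ), ∀ (i : Fin (n + 1)) (j : Fin m),
    (∃ a : ℤ, (φ (D.form i) j).re = a) ∧ (∃ b : ℤ, (φ (D.form i) j).im = b)

/-- The open set `U(𝓔)` of the points `[x]` of `ℙⁿ` such that, for some member of `𝓔`, all `xᵢ`
with `i` in this member are nonzero. -/
noncomputable def U : Opens (CPn n) where
  carrier := {x | ∃ s ∈ D.family, ∀ i ∈ s, x.rep i ≠ 0}
  is_open' := by
    refine isOpen_coinduced.2 ?_
    have h : (fun v : {v : Fin (n + 1) → ℂ // v ≠ 0} => Projectivization.mk ℂ v.1 v.2) ⁻¹'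
        {x | ∃ s ∈ D.family, ∀ i ∈ s, x.rep i ≠ 0} =
        ⋃ s ∈ D.family, ⋂ i ∈ s, {v : {v : Fin (n + 1) → ℂ // v ≠ 0} | v.1 i ≠ 0} := by
      ext v
      obtain ⟨a, ha⟩ := Projectivization.exists_smul_eq_mk_rep ℂ v.1 v.2
      simp only [Set.mem_preimage, Set.mem_ofPred_eq, Set.mem_iUnion, Set.mem_iInter, ← ha,
        Pi.smul_apply, ne_eq, smul_eq_zero_iff_eq, exists_prop]
    rw [h]
    refine isOpen_biUnion fun s _ => isOpen_biInter_finset fun i _ => ?_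
    exact isOpen_ne_fun ((continuous_apply i).comp continuous_subtype_val) continuous_const

/-- The complex manifold `N` is the quotient `N(𝓛, 𝓔, m, n) = U(𝓔) / ℂᵐ`. -/
def IsQuotientManifold {d : ℕ} (N : ComplexManifold d) : Prop :=
  IsQuotient (holAction D.form) D.U N

end LVMData

/-! ### Intermediate GIT-quotients -/

/-- An effective linear action of `T = (ℂ*)²ᵐ` on `ℙⁿ`, an open subset `U` which is good with
respect to it, and a closed cocompact complex Lie subgroup `G` of `T` isomorphic to `ℂᵐ`. -/
structure IntermediateGITDatum (m n : ℕ) where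
  weight : Fin (n + 1) → Fin (2 * m) → ℤ
  U : Opens (CPn n)
  good : IsGood (algAction weight) U
  G : Subgroup (CTorus (2 * m))
  isClosed : IsClosed (G : Set (CTorus (2 * m)))
  cocompact : CompactSpace (CTorus (2 * m) ⧸ G)
  /-- There is an isomorphism of topological groups `ℂᵐ ≃ G` which is holomorphic as a map to
  `(ℂ*)²ᵐ` (being injective, such a homomorphism is an immersion, so it is a biholomorphism onto
  the complex submanifold `G`). -/
  iso : ∃ e : Multiplicative (Fin m → ℂ) ≃ₜ* G, ∀ i : Fin (2 * m),
    Differentiable ℂ (fun z : Fin m → ℂ => (((e (Multiplicative.ofAdd z)).1 i : ℂˣ) : ℂ))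

/-- `N` is an intermediate GIT-quotient `U / G`, for a good open subset `U` of `ℙⁿ` with respect
to an effective linear action of `(ℂ*)²ᵐ`. -/
def IsIntermediateGITQuotient (m n : ℕ) {d : ℕ} (N : ComplexManifold d) : Prop :=
  ∃ Q : IntermediateGITDatum m n, IsQuotient ((algAction Q.weight).comp Q.G.subtype) Q.U N

/-! ### Small deformations -/

/-- A holomorphic family of compact complex manifolds of dimension `d` over a connected open
subset of `ℂᵏ`: a proper holomorphic submersion. -/
structure HolomorphicFamily (d k : ℕ) where
  base : Opens (Fin k → ℂ)
  connected : IsConnected (base : Set (Fin k → ℂ))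
  total : ComplexManifold (d + k)
  proj : total → base
  proper : IsProperMap proj
  submersion : Manifold.IsSubmersion 𝓘(ℂ, Fin (d + k) → ℂ) 𝓘(ℂ, Fin k → ℂ) ω proj

/-- The fibre over `b` is biholomorphic to `M`: there is a holomorphic embedding of `M` into the
total space whose image is this fibre. -/
def HolomorphicFamily.HasFibre {d k : ℕ} (F : HolomorphicFamily d k) (b : F.base)
    (M : ComplexManifold d) : Prop :=
  ∃ j : M → F.total,
    Manifold.IsSmoothEmbedding 𝓘(ℂ, Fin d → ℂ) 𝓘(ℂ, Fin (d + k) → ℂ) ω j ∧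
      Set.range j = F.proj ⁻¹' {b}

/-- `N` is a small deformation of manifolds with the property `P`: it is the fibre over a point `b₀`
of a holomorphic family in which there are points `b` arbitrarily close to `b₀` whose fibre has the
property `P`. -/
def IsSmallDeformationOf {d : ℕ} (P : ComplexManifold d → Prop) (N : ComplexManifold d) : Prop :=
  ∃ (k : ℕ) (F : HolomorphicFamily d k) (b₀ : F.base), F.HasFibre b₀ N ∧
    b₀ ∈ closure {b : F.base | ∃ M : ComplexManifold d, P M ∧ F.HasFibre b M}

/-! The quotient of `U(𝓔)` by `ℂᵐ` is the quotient of the cone over `U(𝓔)` by `ℂᵐ × ℂ`, where `(z,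
w)` multiplies the `i`-th coordinate by `exp (ℓᵢ(z) + w)`. This replaces a quotient of projective
space by the orbit space of a holomorphic action on an open subset of `ℂⁿ⁺¹`. After taking absolute
values, only the real forms `Re ℓᵢ(z) + Re w` on a space of dimension `2m+1` matter.

Condition (sep) says that none of these affine functions, unless zero, is nonpositive on one member
of `𝓔` and nonnegative on another. Its quantitative form `SepBound` bounds `(z, Re w)` linearly by
the size of the forms. Hence elements moving one compact region of the cone to another are bounded
modulo `2πi` in `w`, and stabilizers act trivially. The action is thus proper, and slices transverse
to the orbits (`exists_flowBox`) give holomorphic charts on a Hausdorff orbit space, with the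
projection a submersion.

Compactness comes from (comp) through `exists_supporting_interpolation`: for every height function
on the indices, some member of `𝓔` carries an affine function that equals the heights there and
stays below them everywhere. With heights `-log |xᵢ|`, this moves any point of the cone into a
compact set of normalized points that does not depend on the forms.

Since `SepBound` survives small changes of the forms, the same construction works with the
coefficients as parameters and gives a proper holomorphic submersion over a ball. Forms with
rational coordinates are dense and satisfy (K), which reduces (2) to (1).

Under (K) the differences `ℓᵢ - ℓ₀` generate a lattice of rank `2m`. In a basis `α` of it, `ℓᵢ = ℓ₀
+ ∑ νᵢₖ αₖ` with integers `νᵢₖ`, so modulo the common scalar `exp ℓ₀(z)` the action of `z` is that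
of the torus element `(exp αₖ(z))ₖ` with weights `ν`. The real map `z ↦ (Re αₖ(z))ₖ` is an
isomorphism, so `ℂᵐ` becomes a closed cocompact subgroup of the torus, and the previous bounds show
that `U(𝓔)` is good. -/

/-! ### A covering lemma for exchangeable families of bases -/

section Covering

variable {ι V : Type*} [Fintype ι] [DecidableEq ι] [AddCommGroup V] [Module ℝ V]

/-- `𝓕` has the separation property with respect to the functionals `p i`: no nonzero vector is
nonpositive on one member and nonnegative on another one. -/
def Separates (p : ι → V →ₗ[ℝ] ℝ) (𝓕 : Set (Finset ι)) : Prop :=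
  ∀ s ∈ 𝓕, ∀ t ∈ 𝓕, ∀ v : V, (∀ i ∈ s, p i v ≤ 0) → (∀ i ∈ t, 0 ≤ p i v) → v = 0

/-- The exchange property of a family of finite sets. -/
def Exchangeable (𝓕 : Set (Finset ι)) : Prop :=
  ∀ s ∈ 𝓕, ∀ i : ι, ∃ j ∈ s, insert i (s.erase j) ∈ 𝓕

-- Separation of `s` from itself makes evaluation on `s` injective; since `s` has as many elements
-- as the dimension, the functionals indexed by `s` form a basis of the dual space.
omit [Fintype ι] [DecidableEq ι] in
theorem Separates.exists_interpolation {p : ι → V →ₗ[ℝ] ℝ} {𝓕 : Set (Finset ι)}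
    (hsep : Separates p 𝓕) {s : Finset ι} (hs : s ∈ 𝓕) (hcard : s.card = Module.finrank ℝ V) :
    ∃ f : (ι → ℝ) →ₗ[ℝ] V, ∀ h, ∀ i ∈ s, p i (f h) = h i := by
  let ev : V →ₗ[ℝ] (s → ℝ) := LinearMap.pi fun i => p i
  have hinj : Function.Injective ev := by
    refine (injective_iff_map_eq_zero ev).2 fun v hv => hsep s hs s hs v ?_ ?_ <;>
    · intro i hi
      have := congrFun hv ⟨i, hi⟩
      simp [ev] at this
      simp [this]
  let e := LinearEquiv.ofInjectiveOfFinrankEq ev hinj (by simp [hcard])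
  refine ⟨e.symm.toLinearMap ∘ₗ LinearMap.funLeft ℝ ℝ (Subtype.val : s → ι), fun h i hi => ?_⟩
  have := congrFun (e.apply_symm_apply (LinearMap.funLeft ℝ ℝ (Subtype.val : s → ι) h)) ⟨i, hi⟩
  have he : ∀ v, e v = ev v := fun v =>
    LinearMap.congr_fun (LinearEquiv.coe_ofInjectiveOfFinrankEq ev hinj _) v
  rwa [he] at this

omit [DecidableEq ι] in
/-- Finitely many nonzero functionals are simultaneously nonzero on a dense set. -/
theorem dense_forall_ne_zero {κ : Type*} [Finite κ] (f : κ → (ι → ℝ) →ₗ[ℝ] ℝ)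
    (hf : ∀ k, f k ≠ 0) : Dense {x | ∀ k, f k x ≠ 0} := by
  have h : {x | ∀ k, f k x ≠ 0} = ⋂ k, {x | f k x ≠ 0} := by ext; simp
  rw [h]
  refine dense_iInter_of_isOpen (fun k => ?_) fun k => ?_
  · exact isOpen_ne_fun (f k).continuous_of_finiteDimensional continuous_const
  · have : {x | f k x ≠ 0} = ((LinearMap.ker (f k) : Submodule ℝ (ι → ℝ)) : Set (ι → ℝ))ᶜ := by
      ext; simp
    rw [this]
    rw [← interior_eq_empty_iff_dense_compl]
    by_contra hne
    exact hf k (LinearMap.ker_eq_top.1 (Submodule.eq_top_of_nonempty_interior' _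
      (Set.nonempty_iff_ne_empty.2 hne)))

/-- In an exchangeable separating family of bases, every height function has a member on which it
is interpolated by a vector that stays below it everywhere. -/
theorem exists_supporting_interpolation {p : ι → V →ₗ[ℝ] ℝ} {𝓕 : Set (Finset ι)}
    (hsep : Separates p 𝓕) (hex : Exchangeable 𝓕) (hne : 𝓕.Nonempty)
    (hcard : ∀ s ∈ 𝓕, s.card = Module.finrank ℝ V) (h : ι → ℝ) :
    ∃ s ∈ 𝓕, ∃ v : V, (∀ i ∈ s, p i v = h i) ∧ ∀ i, p i v ≤ h i := by
  choose! f hf using fun s hs => hsep.exists_interpolation (s := s) hs (hcard s hs)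
  -- the gap functionals
  let φ : Finset ι → ι → (ι → ℝ) →ₗ[ℝ] ℝ := fun s i => LinearMap.proj i - p i ∘ₗ f s
  have φ_apply : ∀ s i x, φ s i x = x i - p i (f s x) := fun _ _ _ => rfl
  have φ_mem : ∀ s ∈ 𝓕, ∀ i ∈ s, ∀ x, φ s i x = 0 := fun s hs i hi x => by
    rw [φ_apply, hf s hs x i hi, sub_self]
  have uniq : ∀ s ∈ 𝓕, ∀ v : V, (∀ i ∈ s, p i v = 0) → v = 0 := fun s hs v hv =>
    hsep s hs s hs v (fun i hi => (hv i hi).le) (fun i hi => (hv i hi).ge)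
  have f_off : ∀ s ∈ 𝓕, ∀ x : ι → ℝ, (∀ i ∈ s, x i = 0) → f s x = 0 := fun s hs x hx =>
    uniq s hs _ fun i hi => by rw [hf s hs x i hi, hx i hi]
  have φ_single : ∀ s ∈ 𝓕, ∀ i ∉ s, ∀ k, φ s k (Pi.single i 1) = if k = i then 1 else 0 := by
    intro s hs i hi k
    rw [φ_apply, f_off s hs, map_zero, sub_zero, Pi.single_apply]
    intro j hj
    rw [Pi.single_apply, if_neg]
    rintro rfl
    exact hi hj
  have φcont : ∀ s i, Continuous (φ s i) := fun s i => (φ s i).continuous_of_finiteDimensional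
  -- `C` is a finite union of closed cones, one for each member, formed by the heights whose
  -- interpolant on that member stays below them. Being closed, it is everything once it contains
  -- all `x₁` off the walls, which is shown by walking towards `x₁` along a generic segment.
  let C : Set (ι → ℝ) := ⋃ s ∈ 𝓕, {x | ∀ i, 0 ≤ φ s i x}
  have hfin : 𝓕.Finite := Set.toFinite _
  have hCclosed : IsClosed C := by
    refine hfin.isClosed_biUnion fun s _ => ?_
    rw [Set.ofPred_forall]
    exact isClosed_iInter fun i => isClosed_le continuous_const (φcont s i)
  suffices hC : Dense C by
    have : h ∈ C := by
      rw [← hCclosed.closure_eq, hC.closure_eq]; trivial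
    obtain ⟨s, hs, hx⟩ := Set.mem_iUnion₂.1 this
    refine ⟨s, hs, f s h, hf s hs h, fun i => ?_⟩
    have := hx i
    rw [φ_apply] at this
    linarith
  refine (dense_forall_ne_zero (κ := {q : Finset ι × ι // q.1 ∈ 𝓕 ∧ q.2 ∉ q.1})
    (fun q => φ q.1.1 q.1.2) ?_).mono ?_
  · rintro ⟨⟨s, i⟩, hs, hi⟩ h0
    have := φ_single s hs i hi i
    simp only at h0
    simp [h0] at this
  intro x₁ hx₁
  have hx₁' : ∀ s ∈ 𝓕, ∀ i ∉ s, φ s i x₁ ≠ 0 := fun s hs i hi => hx₁ ⟨⟨s, i⟩, hs, hi⟩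
  obtain ⟨s₀, hs₀⟩ := hne
  have hO : IsOpen {x | ∀ i ∉ s₀, 0 < φ s₀ i x} := by
    simp only [Set.ofPred_forall]
    exact isOpen_iInter_of_finite fun i => isOpen_iInter_of_finite fun _ =>
      isOpen_lt continuous_const (φcont s₀ i)
  have hOne : {x | ∀ i ∉ s₀, 0 < φ s₀ i x}.Nonempty := by
    refine ⟨fun i => if i ∈ s₀ then 0 else 1, fun i hi => ?_⟩
    rw [φ_apply, f_off s₀ hs₀ _ fun j hj => if_pos hj]
    simp [hi]
  -- The start `x₀` lies inside the cone of `s₀`. Nonvanishing of these `2 × 2` determinants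
  -- prevents the segment from meeting two walls of one member at the same time before its end. The
  -- functional is nonzero because its value at `Pi.single i 1` is the gap of `x₁` at the other
  -- index.
  obtain ⟨x₀, hx₀O, hx₀⟩ := (dense_forall_ne_zero
    (κ := {q : Finset ι × ι × ι // q.1 ∈ 𝓕 ∧ q.2.1 ∉ q.1 ∧ q.2.2 ∉ q.1 ∧ q.2.1 ≠ q.2.2})
    (fun q => φ q.1.1 q.1.2.2 x₁ • φ q.1.1 q.1.2.1 - φ q.1.1 q.1.2.1 x₁ • φ q.1.1 q.1.2.2)
    (by
      rintro ⟨⟨s, i, j⟩, hs, hi, hj, hij⟩ h0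
      have h1 := congrArg (fun g => g (Pi.single i 1)) h0
      simp [φ_single s hs i hi, hij.symm] at h1
      exact hx₁' s hs j hj h1)).inter_open_nonempty _ hO hOne
  let γ : ℝ → ι → ℝ := fun t => (1 - t) • x₀ + t • x₁
  have hγ : Continuous γ := by fun_prop
  have φγ : ∀ s i t, φ s i (γ t) = (1 - t) * φ s i x₀ + t * φ s i x₁ := fun s i t => by
    simp [γ]
  -- Continuous induction: it is enough to continue a little beyond each time `t < 1` at which the
  -- segment is in `C`.
  have key : Set.Icc (0 : ℝ) 1 ⊆ γ ⁻¹' C := by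
    refine IsClosed.Icc_subset_of_forall_mem_nhdsWithin
      ((hCclosed.preimage hγ).inter isClosed_Icc) ?_ ?_
    · refine Set.mem_iUnion₂.2 ⟨s₀, hs₀, fun i => ?_⟩
      by_cases hi : i ∈ s₀
      · exact (φ_mem s₀ hs₀ i hi _).ge
      · simpa [γ] using (hx₀O i hi).le
    rintro t ⟨htC, ht0, ht1⟩
    refine mem_nhdsWithin_of_mem_nhds ?_
    obtain ⟨s, hs, hsx⟩ := Set.mem_iUnion₂.1 htC
    have hpos : ∀ u ∈ 𝓕, ∀ k, 0 < φ u k (γ t) → ∀ᶠ r in 𝓝 t, 0 < φ u k (γ r) :=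
      fun u _ k hk => ((φcont u k).comp hγ).continuousAt.eventually (lt_mem_nhds hk)
    by_cases hZ : ∃ i ∉ s, φ s i (γ t) = 0
    · obtain ⟨i, hi, hi0⟩ := hZ
      have honly : ∀ k ∉ s, k ≠ i → 0 < φ s k (γ t) := by
        intro k hk hki
        refine lt_of_le_of_ne (hsx k) fun hk0 => ?_
        have hne := hx₀ ⟨⟨s, i, k⟩, hs, hi, hk, hki.symm⟩
        simp only [LinearMap.sub_apply, LinearMap.smul_apply, smul_eq_mul] at hne
        rw [φγ] at hi0 hk0
        refine hne ?_
        have h1 : (1 - t) * (φ s k x₁ * φ s i x₀ - φ s i x₁ * φ s k x₀) = 0 := by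
          linear_combination φ s k x₁ * hi0 + φ s i x₁ * hk0
        exact (mul_eq_zero.1 h1).resolve_left (by linarith)
      obtain ⟨j, hj, hs'⟩ := hex s hs i
      set s' := insert i (s.erase j) with hs'def
      have hij : i ≠ j := fun e => hi (e ▸ hj)
      -- On the wall the interpolant of `s` also takes the prescribed value at `i`, so it is the
      -- interpolant of the exchanged member `s'`.
      have heq : f s' (γ t) = f s (γ t) := by
        refine sub_eq_zero.1 (uniq s' hs' _ fun k hk => ?_)
        rw [map_sub, hf s' hs' _ k hk, ← φ_apply]
        rcases Finset.mem_insert.1 hk with rfl | hk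
        · exact hi0
        · exact φ_mem s hs k (Finset.mem_of_mem_erase hk) _
      have hev : ∀ᶠ r in 𝓝 t, ∀ k, k ∉ s → k ≠ i →
          0 < φ s k (γ r) ∧ 0 < φ s' k (γ r) := by
        refine Filter.eventually_all.2 fun k => ?_
        by_cases hk : k ∉ s ∧ k ≠ i
        · have h1 := honly k hk.1 hk.2
          have h2 : 0 < φ s' k (γ t) := by rwa [φ_apply, heq, ← φ_apply]
          filter_upwards [hpos s hs k h1, hpos s' hs' k h2] with r a b _ _ using ⟨a, b⟩
        · exact Filter.Eventually.of_forall fun r a b => absurd ⟨a, b⟩ hk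
      filter_upwards [hev] with r hr
      by_cases hri : 0 ≤ φ s i (γ r)
      · refine Set.mem_iUnion₂.2 ⟨s, hs, fun k => ?_⟩
        by_cases hk : k ∈ s
        · exact (φ_mem s hs k hk _).ge
        · by_cases hki : k = i
          · exact hki ▸ hri
          · exact (hr k hk hki).1.le
      -- Beyond the wall `s'` takes over. The only gap of `s'` not controlled by continuity is the
      -- one at the index `j` that left. If it were negative, the difference of the two interpolants
      -- would be nonpositive on `s'` and nonnegative on `s`, hence zero by separation, although its
      -- value at `i` is negative.
      · push Not at hri
        refine Set.mem_iUnion₂.2 ⟨s', hs', fun k => ?_⟩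
        by_cases hk : k ∈ s'
        · exact (φ_mem s' hs' k hk _).ge
        have hki : k ≠ i := fun e => hk (e ▸ Finset.mem_insert_self _ _)
        by_cases hks : k ∈ s
        · have hkj : k = j := by
            by_contra hkj
            exact hk (Finset.mem_insert_of_mem (Finset.mem_erase.2 ⟨hkj, hks⟩))
          subst hkj
          by_contra hneg
          push Not at hneg
          have hu : ∀ l ∈ s, l ≠ k → p l (f s' (γ r) - f s (γ r)) = 0 := by
            intro l hl hlk
            rw [map_sub, hf s hs _ l hl, hf s' hs' _ l
              (Finset.mem_insert_of_mem (Finset.mem_erase.2 ⟨hlk, hl⟩)), sub_self]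
          have hui : p i (f s' (γ r) - f s (γ r)) = φ s i (γ r) := by
            rw [map_sub, hf s' hs' _ i (Finset.mem_insert_self _ _), φ_apply]
          have huk : p k (f s' (γ r) - f s (γ r)) = - φ s' k (γ r) := by
            rw [map_sub, hf s hs _ k hks, φ_apply, neg_sub]
          have h0 := hsep s' hs' s hs (f s' (γ r) - f s (γ r)) (fun l hl => by
            rcases Finset.mem_insert.1 hl with rfl | hl
            · rw [hui]; exact hri.le
            · rw [hu l (Finset.mem_of_mem_erase hl) (Finset.ne_of_mem_erase hl)]) (fun l hl => by
            by_cases hlk : l = k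
            · subst hlk; rw [huk]; linarith
            · rw [hu l hl hlk])
          rw [h0, map_zero] at hui
          exact hri.ne hui.symm
        · exact (hr k hks hki).2.le
    · push Not at hZ
      have hev : ∀ᶠ r in 𝓝 t, ∀ k, k ∉ s → 0 < φ s k (γ r) := by
        refine Filter.eventually_all.2 fun k => ?_
        by_cases hk : k ∈ s
        · exact Filter.Eventually.of_forall fun r a => absurd hk a
        · filter_upwards [hpos s hs k (lt_of_le_of_ne (hsx k) (hZ k hk).symm)] with r a _ using a
      filter_upwards [hev] with r hr
      refine Set.mem_iUnion₂.2 ⟨s, hs, fun k => ?_⟩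
      by_cases hk : k ∈ s
      · exact (φ_mem s hs k hk _).ge
      · exact (hr k hk).le
  have := key (Set.right_mem_Icc.2 zero_le_one)
  simpa [γ] using this

end Covering

/-! ### Proper holomorphic actions and their flow boxes -/

section HolomorphicAction

/-- A holomorphic action of the additive group `V` on `E` that leaves the open set `X` stable, such
that on `X` the infinitesimal action is injective, the stabilizers act trivially, and the action is
proper modulo the elements that act trivially. -/
structure ProperHolomorphicAction (V : Type) {E : Type} [NormedAddCommGroup V] [NormedSpace ℂ V]
    [NormedAddCommGroup E] [NormedSpace ℂ E] (X : Opens E) where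
  act : V → E → E
  contDiff : ContDiff ℂ ω fun q : V × E => act q.1 q.2
  zero_act : ∀ x, act 0 x = x
  add_act : ∀ v w x, act (v + w) x = act v (act w x)
  mem : ∀ v, ∀ x ∈ X, act v x ∈ X
  free : ∀ v, ∀ x ∈ X, act v x = x → ∀ y, act v y = y
  proper : ∀ x ∈ X, ∀ y ∈ X, ∃ K : Set V, IsCompact K ∧
    ∀ᶠ q in 𝓝 (x, y), ∀ v, act v q.1 = q.2 → ∃ w ∈ K, act w q.1 = q.2
  immersive : ∀ x ∈ X, Function.Injective (fderiv ℂ (fun v => act v x) 0)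

namespace ProperHolomorphicAction

variable {V E : Type} [NormedAddCommGroup V] [NormedSpace ℂ V]
    [NormedAddCommGroup E] [NormedSpace ℂ E] {X : Opens E} (Q : ProperHolomorphicAction V X)

theorem continuous_act : Continuous fun q : V × E => Q.act q.1 q.2 := Q.contDiff.continuous

theorem contDiff_act (v : V) : ContDiff ℂ ω (Q.act v) :=
  Q.contDiff.comp (contDiff_const.prodMk contDiff_id)

theorem neg_act_act (v : V) (x : E) : Q.act (-v) (Q.act v x) = x := by
  rw [← Q.add_act, neg_add_cancel, Q.zero_act]

/-- Properness leaves only group elements in a compact set to exclude, and each of them is excluded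
on a neighbourhood by continuity. This is the Hausdorff property of the orbit space. -/
theorem eventually_not_related {x y : E} (hx : x ∈ X) (hy : y ∈ X) (h : ∀ v, Q.act v x ≠ y) :
    ∀ᶠ q in 𝓝 (x, y), ∀ v, Q.act v q.1 ≠ q.2 := by
  obtain ⟨K, hK, hev⟩ := Q.proper x hx y hy
  have h2 : ∀ᶠ q in 𝓝 (x, y), ∀ w ∈ K, Q.act w q.1 ≠ q.2 := by
    refine hK.induction_on (p := fun S => ∀ᶠ q in 𝓝 (x, y), ∀ w ∈ S, Q.act w q.1 ≠ q.2) ?_ ?_ ?_ ?_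
    · simp
    · exact fun s t hst ht => ht.mono fun q hq w hw => hq w (hst hw)
    · intro s t hs ht
      filter_upwards [hs, ht] with q hq hq' w hw using hw.elim (hq w) (hq' w)
    · intro w _
      have hc : ContinuousAt (fun r : V × E × E => (Q.act r.1 r.2.1, r.2.2)) (w, x, y) :=
        ((Q.continuous_act.comp (continuous_fst.prodMk
          (continuous_fst.comp continuous_snd))).prodMk
          (continuous_snd.comp continuous_snd)).continuousAt
      have : ∀ᶠ r : V × E × E in 𝓝 (w, x, y), Q.act r.1 r.2.1 ≠ r.2.2 :=
        hc.eventually (isOpen_ne_fun continuous_fst continuous_snd |>.mem_nhds (h w))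
      rw [nhds_prod_eq] at this
      obtain ⟨s, hs, t, ht, hst⟩ := Filter.mem_prod_iff.1 this
      refine ⟨s, mem_nhdsWithin_of_mem_nhds hs, ?_⟩
      filter_upwards [ht] with q hq w hw using hst (Set.mk_mem_prod hw hq)
  filter_upwards [hev, h2] with q hq hq' v hv
  obtain ⟨w, hw, hwq⟩ := hq v hv
  exact hq' w hw hwq

/-- Elements of the compact set that do not fix `x` are excluded near `x`. An element `w` that does
fix `x` acts trivially, so any `u` near `w` can be replaced by `u - w`, which is near `0`. This
makes small slices meet each orbit at most once. -/
theorem eventually_related_near {x : E} (hx : x ∈ X) {W : Set V} (hW : W ∈ 𝓝 0) :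
    ∀ᶠ q in 𝓝 (x, x), ∀ v, Q.act v q.1 = q.2 → ∃ w ∈ W, Q.act w q.1 = q.2 := by
  obtain ⟨K, hK, hev⟩ := Q.proper x hx x hx
  have h2 : ∀ᶠ q in 𝓝 (x, x), ∀ w ∈ K, Q.act w q.1 = q.2 → ∃ w ∈ W, Q.act w q.1 = q.2 := by
    refine hK.induction_on (p := fun S => ∀ᶠ q in 𝓝 (x, x), ∀ w ∈ S, Q.act w q.1 = q.2 →
      ∃ w ∈ W, Q.act w q.1 = q.2) ?_ ?_ ?_ ?_
    · simp
    · exact fun s t hst ht => ht.mono fun q hq w hw => hq w (hst hw)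
    · intro s t hs ht
      filter_upwards [hs, ht] with q hq hq' w hw using hw.elim (hq w) (hq' w)
    · intro w _
      by_cases hw : Q.act w x = x
      · refine ⟨(fun u => u - w) ⁻¹' W, mem_nhdsWithin_of_mem_nhds ?_, ?_⟩
        · refine (continuous_id.sub continuous_const).continuousAt.preimage_mem_nhds ?_
          simpa using hW
        · refine Filter.Eventually.of_forall fun q u hu huq => ⟨u - w, hu, ?_⟩
          rw [← huq]
          conv_rhs => rw [← sub_add_cancel u w, Q.add_act, Q.free w x hx hw]
      · have hc : ContinuousAt (fun r : V × E × E => (Q.act r.1 r.2.1, r.2.2)) (w, x, x) :=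
          ((Q.continuous_act.comp (continuous_fst.prodMk
            (continuous_fst.comp continuous_snd))).prodMk
            (continuous_snd.comp continuous_snd)).continuousAt
        have : ∀ᶠ r : V × E × E in 𝓝 (w, x, x), Q.act r.1 r.2.1 ≠ r.2.2 :=
          hc.eventually (isOpen_ne_fun continuous_fst continuous_snd |>.mem_nhds hw)
        rw [nhds_prod_eq] at this
        obtain ⟨s, hs, t, ht, hst⟩ := Filter.mem_prod_iff.1 this
        refine ⟨s, mem_nhdsWithin_of_mem_nhds hs, ?_⟩
        filter_upwards [ht] with q hq w hw hwq using absurd hwq (hst (Set.mk_mem_prod hw hq))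
  filter_upwards [hev, h2] with q hq hq' v hv
  obtain ⟨w, hw, hwq⟩ := hq v hv
  exact hq' w hw hwq

/-- A flow box: near `base`, every point is uniquely of the form `v • (base + L h)` with small `v`
and `h`, and different points `base + L h` belong to different orbits. -/
structure FlowBox (d : ℕ) where
  base : E
  L : (Fin d → ℂ) →L[ℂ] E
  box : OpenPartialHomeomorph ((Fin d → ℂ) × V) E
  A : Set (Fin d → ℂ)
  B : Set V
  isOpen_A : IsOpen A
  isOpen_B : IsOpen B
  zero_mem_A : 0 ∈ A
  zero_mem_B : 0 ∈ B
  source_eq : box.source = A ×ˢ B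
  box_apply : ∀ q, box q = Q.act q.2 (base + L q.1)
  target_subset : box.target ⊆ X
  contDiffOn_symm : ContDiffOn ℂ ω box.symm box.target
  slice : ∀ h ∈ A, ∀ h' ∈ A, ∀ v, Q.act v (base + L h) = base + L h' → h = h'

/-- `L` parametrizes a complement of the tangent space at `x` of the orbit of `x`. -/
def IsTransverse {d : ℕ} (x : E) (L : (Fin d → ℂ) →L[ℂ] E) : Prop :=
  Function.Bijective fun q : (Fin d → ℂ) × V => L q.1 + fderiv ℂ (fun v => Q.act v x) 0 q.2

theorem exists_isTransverse [FiniteDimensional ℂ E] [FiniteDimensional ℂ V] {d : ℕ}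
    (hd : Module.finrank ℂ E = d + Module.finrank ℂ V) {x : E} (hx : x ∈ X) :
    ∃ L : (Fin d → ℂ) →L[ℂ] E, Q.IsTransverse x L := by
  let D : V →L[ℂ] E := fderiv ℂ (fun v => Q.act v x) 0
  have hD : Function.Injective D := Q.immersive x hx
  obtain ⟨S, hS⟩ := Submodule.exists_isCompl (LinearMap.range D.toLinearMap)
  have hr : Module.finrank ℂ (LinearMap.range D.toLinearMap) = Module.finrank ℂ V :=
    LinearMap.finrank_range_of_inj hD
  have hSd : Module.finrank ℂ (Fin d → ℂ) = Module.finrank ℂ S := by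
    have := Submodule.finrank_add_eq_of_isCompl hS
    simp
    omega
  let φ : (Fin d → ℂ) ≃ₗ[ℂ] S := LinearEquiv.ofFinrankEq _ _ hSd
  let L : (Fin d → ℂ) →L[ℂ] E := LinearMap.toContinuousLinearMap (S.subtype ∘ₗ φ.toLinearMap)
  refine ⟨L, ?_⟩
  have hL : ∀ h, L h = (φ h : E) := fun h => rfl
  constructor
  · rintro ⟨h, v⟩ ⟨h', v'⟩ heq
    have h1 : (φ (h - h') : E) = D (v' - v) := by
      have : L h + D v = L h' + D v' := heq
      rw [map_sub, map_sub, Submodule.coe_sub, ← hL, ← hL, sub_eq_sub_iff_add_eq_add, this, add_comm]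
    have h2 : (φ (h - h') : E) = 0 := by
      have := hS.disjoint.le_bot (x := (φ (h - h') : E)) ⟨h1 ▸ ⟨v' - v, rfl⟩, (φ (h - h')).2⟩
      simpa using this
    have h3 : h = h' := by
      have := (Submodule.coe_eq_zero.1 h2)
      exact sub_eq_zero.1 ((LinearEquiv.map_eq_zero_iff φ).1 this)
    have h4 : v' = v := sub_eq_zero.1 (hD (by rw [← h1, h2, map_zero]))
    rw [h3, h4]
  · intro y
    have hy : y ∈ LinearMap.range D.toLinearMap ⊔ S := by rw [hS.sup_eq_top]; trivial
    obtain ⟨_, ⟨v, rfl⟩, s, hs, rfl⟩ := Submodule.mem_sup.1 hy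
    refine ⟨(φ.symm ⟨s, hs⟩, v), ?_⟩
    change L (φ.symm ⟨s, hs⟩) + D v = D v + s
    rw [hL, LinearEquiv.apply_symm_apply, add_comm]

/-- The map `(h, v) ↦ v • (x + L h)` has derivative `L ⊕ D` at the origin, with `D` the
infinitesimal action; by transversality this is invertible and the inverse function theorem applies.
The box is then shrunk to obtain the slice property. -/
theorem exists_flowBox [FiniteDimensional ℂ E] [FiniteDimensional ℂ V] {d : ℕ}
    {x : E} (hx : x ∈ X) {L : (Fin d → ℂ) →L[ℂ] E} (hL : Q.IsTransverse x L) :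
    ∃ b : Q.FlowBox d, b.base = x ∧ b.L = L := by
  have : CompleteSpace E := FiniteDimensional.complete ℂ E
  have : CompleteSpace V := FiniteDimensional.complete ℂ V
  let D : V →L[ℂ] E := fderiv ℂ (fun v => Q.act v x) 0
  let Ψ : (Fin d → ℂ) × V → E := fun q => Q.act q.2 (x + L q.1)
  have hΨ : ContDiff ℂ ω Ψ :=
    Q.contDiff.comp (contDiff_snd.prodMk (contDiff_const.add (L.contDiff.comp contDiff_fst)))
  have hΨ0 : Ψ 0 = x := by simp [Ψ, Q.zero_act]
  let e₀ : ((Fin d → ℂ) × V) ≃ₗ[ℂ] E :=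
    LinearEquiv.ofBijective (L.toLinearMap.coprod D.toLinearMap) hL
  let e : ((Fin d → ℂ) × V) ≃L[ℂ] E := e₀.toContinuousLinearEquiv
  have he : (e : (Fin d → ℂ) × V →L[ℂ] E) = L.coprod D := by
    exact ContinuousLinearMap.ext fun q => rfl
  have hder : HasFDerivAt Ψ (e : (Fin d → ℂ) × V →L[ℂ] E) 0 := by
    have h1 : HasFDerivAt Ψ (fderiv ℂ Ψ 0) 0 :=
      (hΨ.differentiable (by simp)).differentiableAt.hasFDerivAt
    have h2 : fderiv ℂ Ψ 0 ∘L ContinuousLinearMap.inl ℂ (Fin d → ℂ) V = L := by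
      have ha : HasFDerivAt (Ψ ∘ fun h : Fin d → ℂ => (h, (0 : V)))
          (fderiv ℂ Ψ 0 ∘L ContinuousLinearMap.inl ℂ (Fin d → ℂ) V) 0 :=
        HasFDerivAt.comp (g := Ψ) (f := fun h : Fin d → ℂ => (h, (0 : V))) 0 h1
          (ContinuousLinearMap.inl ℂ (Fin d → ℂ) V).hasFDerivAt
      have hb : (Ψ ∘ fun h : Fin d → ℂ => (h, (0 : V))) = fun h => x + L h := by
        funext h; simp [Ψ, Q.zero_act]
      rw [hb] at ha
      exact ha.unique (L.hasFDerivAt.const_add x)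
    have h3 : fderiv ℂ Ψ 0 ∘L ContinuousLinearMap.inr ℂ (Fin d → ℂ) V = D := by
      have ha : HasFDerivAt (Ψ ∘ fun v : V => ((0 : Fin d → ℂ), v))
          (fderiv ℂ Ψ 0 ∘L ContinuousLinearMap.inr ℂ (Fin d → ℂ) V) 0 :=
        HasFDerivAt.comp (g := Ψ) (f := fun v : V => ((0 : Fin d → ℂ), v)) 0 h1
          (ContinuousLinearMap.inr ℂ (Fin d → ℂ) V).hasFDerivAt
      have hb : (Ψ ∘ fun v : V => ((0 : Fin d → ℂ), v)) = fun v => Q.act v x := by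
        funext h; simp [Ψ]
      rw [hb] at ha
      exact ha.fderiv.symm
    have h4 : fderiv ℂ Ψ 0 = e := by
      rw [he, ← h2, ← h3]
      ext q <;> simp
    rwa [h4] at h1
  let F := hΨ.contDiffAt.toOpenPartialHomeomorph Ψ hder (by simp)
  have hF : ∀ q, F q = Ψ q := fun q => rfl
  have hF0 : (0 : (Fin d → ℂ) × V) ∈ F.source :=
    hΨ.contDiffAt.mem_toOpenPartialHomeomorph_source hder (by simp)
  have hFsymm : F.symm x = 0 := by rw [← hΨ0, ← hF, F.left_inv hF0]
  have hxt : x ∈ F.target := by rw [← hΨ0, ← hF]; exact F.map_source hF0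
  have hsm : ∀ᶠ y in 𝓝 x, ContDiffAt ℂ ω F.symm y := by
    refine ContDiffAt.eventually (F.contDiffAt_symm (f₀' := e) hxt ?_ ?_) (by simp)
    · rw [hFsymm]; exact hder
    · exact hΨ.contDiffAt
  have hgood : ∀ᶠ q in 𝓝 (0 : (Fin d → ℂ) × V), Ψ q ∈ X ∧ ContDiffAt ℂ ω F.symm (Ψ q) := by
    have hc : Filter.Tendsto Ψ (𝓝 0) (𝓝 x) := by
      have := hΨ.continuous.tendsto 0
      rwa [hΨ0] at this
    exact hc.eventually (Filter.Eventually.and (X.isOpen.mem_nhds hx) hsm)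
  obtain ⟨A₁, hA₁, B₁, hB₁, hAB₁⟩ := Filter.mem_prod_iff.1
    ((nhds_prod_eq (x := (0 : Fin d → ℂ)) (y := (0 : V))) ▸ F.open_source.mem_nhds hF0)
  obtain ⟨A₃, hA₃, B₃, hB₃, hAB₃⟩ := Filter.mem_prod_iff.1
    ((nhds_prod_eq (x := (0 : Fin d → ℂ)) (y := (0 : V))) ▸ hgood)
  -- If two points of the slice close to `x` are related, they are related by an element of `B₁`,
  -- where the local inverse is injective; comparing `(h, w)` with `(h', 0)` then gives `h = h'`.
  have hnear := Q.eventually_related_near hx hB₁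
  rw [nhds_prod_eq] at hnear
  obtain ⟨O, hO, hOO⟩ := Filter.mem_prod_same_iff.1 hnear
  have hA₂ : (fun h => x + L h) ⁻¹' O ∈ 𝓝 (0 : Fin d → ℂ) := by
    refine (continuous_const.add L.continuous).continuousAt.preimage_mem_nhds ?_
    simpa using hO
  let A := interior (A₁ ∩ A₃ ∩ (fun h => x + L h) ⁻¹' O)
  let B := interior (B₁ ∩ B₃)
  have h0A : 0 ∈ A := mem_interior_iff_mem_nhds.2 (Filter.inter_mem (Filter.inter_mem hA₁ hA₃) hA₂)
  have h0B : 0 ∈ B := mem_interior_iff_mem_nhds.2 (Filter.inter_mem hB₁ hB₃)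
  have hA : ∀ h ∈ A, h ∈ A₁ ∧ h ∈ A₃ ∧ x + L h ∈ O := fun h hh =>
    ⟨(interior_subset hh).1.1, (interior_subset hh).1.2, (interior_subset hh).2⟩
  have hB : ∀ v ∈ B, v ∈ B₁ ∧ v ∈ B₃ := fun v hv =>
    interior_subset (s := B₁ ∩ B₃) hv
  have hABo : IsOpen (A ×ˢ B) := isOpen_interior.prod isOpen_interior
  have hABs : A ×ˢ B ⊆ F.source := fun q hq =>
    hAB₁ ⟨(hA _ hq.1).1, (hB _ hq.2).1⟩
  have hsrc : (F.restr (A ×ˢ B)).source = A ×ˢ B := by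
    rw [F.restr_source' _ hABo, Set.inter_eq_right]
    exact hABs
  have htgt : ∀ y ∈ (F.restr (A ×ˢ B)).target, ∃ q ∈ A ×ˢ B, Ψ q = y := by
    intro y hy
    refine ⟨(F.restr (A ×ˢ B)).symm y, ?_, ?_⟩
    · have := (F.restr (A ×ˢ B)).map_target hy
      rwa [hsrc] at this
    · exact (F.restr (A ×ˢ B)).right_inv hy
  refine ⟨{ base := x, L := L, box := F.restr (A ×ˢ B), A := A, B := B
            isOpen_A := isOpen_interior, isOpen_B := isOpen_interior
            zero_mem_A := h0A, zero_mem_B := h0B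
            source_eq := hsrc, box_apply := fun q => rfl, target_subset := ?_
            contDiffOn_symm := ?_, slice := ?_ }, rfl, rfl⟩
  · intro y hy
    obtain ⟨q, hq, rfl⟩ := htgt y hy
    exact (hAB₃ (Set.mk_mem_prod (hA _ hq.1).2.1 (hB _ hq.2).2) : _ ∧ _).1
  · intro y hy
    obtain ⟨q, hq, rfl⟩ := htgt y hy
    exact (hAB₃ (Set.mk_mem_prod (hA _ hq.1).2.1 (hB _ hq.2).2) : _ ∧ _).2.contDiffWithinAt
  · intro h hh h' hh' v hv
    obtain ⟨w, hw, hwe⟩ := hOO (Set.mk_mem_prod (hA h hh).2.2 (hA h' hh').2.2) v hv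
    have h1 : F (h, w) = F (h', 0) := by
      rw [hF, hF]
      change Q.act w (x + L h) = Q.act 0 (x + L h')
      rw [Q.zero_act]
      exact hwe
    have h2 := F.injOn (hAB₁ ⟨(hA h hh).1, hw⟩)
      (hAB₁ ⟨(hA h' hh').1, mem_of_mem_nhds hB₁⟩) h1
    exact congrArg Prod.fst h2

end ProperHolomorphicAction

end HolomorphicAction

/-! ### The orbit space of a proper holomorphic action is a complex manifold -/

section OrbitManifold

namespace ProperHolomorphicAction

variable {V E : Type} [NormedAddCommGroup V] [NormedSpace ℂ V]
    [NormedAddCommGroup E] [NormedSpace ℂ E] {X : Opens E} (Q : ProperHolomorphicAction V X)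

/-- The orbit relation on `X`. -/
def orbitRel : Setoid X where
  r x y := ∃ v, Q.act v x = y
  iseqv :=
    { refl := fun x => ⟨0, Q.zero_act x⟩
      symm := by
        rintro x y ⟨v, hv⟩
        exact ⟨-v, by rw [← hv, Q.neg_act_act]⟩
      trans := by
        rintro x y z ⟨v, hv⟩ ⟨w, hw⟩
        exact ⟨w + v, by rw [Q.add_act, hv, hw]⟩ }

/-- The orbit space `X / V`. -/
def Orbits : Type := Quotient Q.orbitRel

instance : TopologicalSpace Q.Orbits := inferInstanceAs (TopologicalSpace (Quotient Q.orbitRel))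

/-- The projection to the orbit space. -/
def orb (x : X) : Q.Orbits := Quotient.mk Q.orbitRel x

theorem orb_surjective : Function.Surjective Q.orb := Quotient.mk_surjective

theorem orb_eq_orb {x y : X} : Q.orb x = Q.orb y ↔ ∃ v, Q.act v x = y := Quotient.eq

theorem continuous_orb : Continuous Q.orb := continuous_quotient_mk'

theorem isOpenMap_orb : IsOpenMap Q.orb := by
  intro O hO
  refine isOpen_coinduced.2 ?_
  have : Q.orb ⁻¹' (Q.orb '' O) = ⋃ v, (fun x : X => (⟨Q.act v x, Q.mem v x x.2⟩ : X)) ⁻¹' O := by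
    ext x
    simp only [Set.mem_preimage, Set.mem_image, Set.mem_iUnion]
    constructor
    · rintro ⟨y, hy, hyx⟩
      obtain ⟨v, hv⟩ := Q.orb_eq_orb.1 hyx.symm
      exact ⟨v, by convert hy⟩
    · rintro ⟨v, hv⟩
      exact ⟨_, hv, (Q.orb_eq_orb.2 ⟨v, rfl⟩).symm⟩
  change IsOpen (Q.orb ⁻¹' (Q.orb '' O))
  rw [this]
  exact isOpen_iUnion fun v => hO.preimage
    (((Q.contDiff_act v).continuous.comp continuous_subtype_val).subtype_mk _)

instance [FiniteDimensional ℂ E] : SecondCountableTopology Q.Orbits := by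
  have : ProperSpace E := FiniteDimensional.proper ℂ E
  exact Quotient.secondCountableTopology Q.isOpenMap_orb

instance : T2Space Q.Orbits := by
  refine t2Space_iff_disjoint_nhds.2 fun a b hab => ?_
  obtain ⟨x, rfl⟩ := Q.orb_surjective a
  obtain ⟨y, rfl⟩ := Q.orb_surjective b
  have h := Q.eventually_not_related x.2 y.2 fun v hv => hab (Q.orb_eq_orb.2 ⟨v, hv⟩)
  rw [nhds_prod_eq] at h
  obtain ⟨s, hs, t, ht, hst⟩ := Filter.mem_prod_iff.1 h
  refine Filter.disjoint_iff.2 ⟨Q.orb '' (Subtype.val ⁻¹' s),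
    Q.isOpenMap_orb.image_mem_nhds (continuous_subtype_val.continuousAt.preimage_mem_nhds hs),
    Q.orb '' (Subtype.val ⁻¹' t),
    Q.isOpenMap_orb.image_mem_nhds (continuous_subtype_val.continuousAt.preimage_mem_nhds ht), ?_⟩
  rw [Set.disjoint_left]
  rintro _ ⟨x', hx', rfl⟩ ⟨y', hy', h'⟩
  obtain ⟨v, hv⟩ := Q.orb_eq_orb.1 h'.symm
  exact hst (Set.mk_mem_prod hx' hy') v hv

/-! ### Charts of the orbit space given by flow boxes -/

namespace FlowBox

variable {Q} {d : ℕ} (b : Q.FlowBox d)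

theorem box_zero (h : Fin d → ℂ) : b.box (h, 0) = b.base + b.L h := by
  rw [b.box_apply, Q.zero_act]

theorem mem_of_mem_A {h : Fin d → ℂ} (hh : h ∈ b.A) : b.base + b.L h ∈ X := by
  refine b.target_subset ?_
  rw [← b.box_zero]
  exact b.box.map_source (by rw [b.source_eq]; exact ⟨hh, b.zero_mem_B⟩)

theorem base_mem : b.base ∈ X := by simpa using b.mem_of_mem_A b.zero_mem_A

theorem mem_target_of_mem_A {h : Fin d → ℂ} (hh : h ∈ b.A) : b.base + b.L h ∈ b.box.target := by
  rw [← b.box_zero]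
  exact b.box.map_source (by rw [b.source_eq]; exact ⟨hh, b.zero_mem_B⟩)

theorem symm_fst_mem {x : E} (hx : x ∈ b.box.target) : (b.box.symm x).1 ∈ b.A := by
  have := b.box.map_target hx
  rw [b.source_eq] at this
  exact this.1

theorem act_symm {x : E} (hx : x ∈ b.box.target) :
    Q.act (b.box.symm x).2 (b.base + b.L (b.box.symm x).1) = x := by
  rw [← b.box_apply, b.box.right_inv hx]

open Classical in
/-- The map `h ↦ [base + L h]`. -/
noncomputable def param (h : Fin d → ℂ) : Q.Orbits :=
  -- The second value is never used: for `h ∈ A` the point lies in `X`.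
  if hx : b.base + b.L h ∈ X then Q.orb ⟨_, hx⟩ else Q.orb ⟨b.base, b.base_mem⟩

theorem param_eq {h : Fin d → ℂ} (hh : b.base + b.L h ∈ X) : b.param h = Q.orb ⟨_, hh⟩ := dif_pos hh

theorem injOn_param : Set.InjOn b.param b.A := by
  intro h hh h' hh' heq
  rw [b.param_eq (b.mem_of_mem_A hh), b.param_eq (b.mem_of_mem_A hh')] at heq
  obtain ⟨v, hv⟩ := Q.orb_eq_orb.1 heq
  exact b.slice h hh h' hh' v hv

/-- Moving along `B` does not change the orbit, so the image of `W` is the image of the open set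
`b.box '' (W ×ˢ B)` under the open orbit map. -/
theorem isOpen_param_image {W : Set (Fin d → ℂ)} (hW : IsOpen W) (hWA : W ⊆ b.A) :
    IsOpen (b.param '' W) := by
  have ho : IsOpen (b.box '' (W ×ˢ b.B)) :=
    b.box.isOpen_image_of_subset_source (hW.prod b.isOpen_B)
      (by rw [b.source_eq]; exact Set.prod_mono hWA subset_rfl)
  have h2 := Q.isOpenMap_orb _ (ho.preimage (continuous_subtype_val (p := (· ∈ X))))
  convert h2 using 1
  ext y
  constructor
  · rintro ⟨h, hh, rfl⟩
    exact ⟨⟨_, b.mem_of_mem_A (hWA hh)⟩, ⟨(h, 0), ⟨hh, b.zero_mem_B⟩, b.box_zero h⟩,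
      (b.param_eq _).symm⟩
  · rintro ⟨x, ⟨q, hq, hqx⟩, rfl⟩
    refine ⟨q.1, hq.1, ?_⟩
    rw [b.param_eq (b.mem_of_mem_A (hWA hq.1)), Q.orb_eq_orb]
    exact ⟨q.2, by rw [← hqx, b.box_apply]⟩

theorem continuousOn_param : ContinuousOn b.param b.A := by
  rw [continuousOn_iff_continuous_domRestrict]
  have : b.A.domRestrict b.param =
      fun h : b.A => Q.orb ⟨b.base + b.L h, b.mem_of_mem_A h.2⟩ := by
    funext h
    exact b.param_eq _
  rw [this]
  exact Q.continuous_orb.comp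
    ((continuous_const.add (b.L.continuous.comp continuous_subtype_val)).subtype_mk _)

/-- The chart of the orbit space given by a flow box. -/
noncomputable def chart : OpenPartialHomeomorph Q.Orbits (Fin d → ℂ) where
  toFun := Function.invFunOn b.param b.A
  invFun := b.param
  source := b.param '' b.A
  target := b.A
  map_source' := fun y hy => Function.invFunOn_mem hy
  map_target' := fun h hh => ⟨h, hh, rfl⟩
  left_inv' := fun y hy => Function.invFunOn_eq hy
  right_inv' := fun h hh => b.injOn_param.leftInvOn_invFunOn hh
  open_source := b.isOpen_param_image b.isOpen_A subset_rfl
  open_target := b.isOpen_A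
  continuousOn_toFun := by
    refine (continuousOn_open_iff (b.isOpen_param_image b.isOpen_A subset_rfl)).2 fun t ht => ?_
    convert b.isOpen_param_image (b.isOpen_A.inter ht) Set.inter_subset_left using 1
    ext y
    constructor
    · rintro ⟨⟨h, hh, rfl⟩, ht'⟩
      rw [Set.mem_preimage, b.injOn_param.leftInvOn_invFunOn hh] at ht'
      exact ⟨h, ⟨hh, ht'⟩, rfl⟩
    · rintro ⟨h, ⟨hh, ht'⟩, rfl⟩
      refine ⟨⟨h, hh, rfl⟩, ?_⟩
      rwa [Set.mem_preimage, b.injOn_param.leftInvOn_invFunOn hh]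
  continuousOn_invFun := b.continuousOn_param

theorem chart_symm_apply {h : Fin d → ℂ} (hh : h ∈ b.A) :
    b.chart.symm h = Q.orb ⟨_, b.mem_of_mem_A hh⟩ := b.param_eq _

theorem orb_eq_param {x : X} (hx : (x : E) ∈ b.box.target) :
    Q.orb x = b.param (b.box.symm x).1 := by
  rw [b.param_eq (b.mem_of_mem_A (b.symm_fst_mem hx)), eq_comm, Q.orb_eq_orb]
  exact ⟨_, b.act_symm hx⟩

theorem orb_mem_chart_source {x : X} (hx : (x : E) ∈ b.box.target) : Q.orb x ∈ b.chart.source :=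
  ⟨_, b.symm_fst_mem hx, (b.orb_eq_param hx).symm⟩

theorem chart_orb {x : X} (hx : (x : E) ∈ b.box.target) :
    b.chart (Q.orb x) = (b.box.symm x).1 := by
  rw [b.orb_eq_param hx]
  exact b.injOn_param.leftInvOn_invFunOn (b.symm_fst_mem hx)

/-- If a fixed `v` moves a point of the first slice to the second one, the transition is locally:
include in the slice, act by `v`, then read off the slice coordinate of the second box. Each of
these maps is holomorphic. -/
theorem contDiffOn_transition (b b' : Q.FlowBox d) :
    ContDiffOn ℂ ω (b'.chart ∘ b.chart.symm) (b.chart.symm.trans b'.chart).source := by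
  intro h hh
  have hh1 : h ∈ b.A := hh.1
  have hh2 : b.chart.symm h ∈ b'.chart.source := hh.2
  obtain ⟨h', hh', heq⟩ := hh2
  rw [b.chart_symm_apply hh1, b'.param_eq (b'.mem_of_mem_A hh'), eq_comm, Q.orb_eq_orb] at heq
  obtain ⟨v, hv⟩ := heq
  simp only at hv
  let g : (Fin d → ℂ) → E := fun k => Q.act v (b.base + b.L k)
  have hg : ContDiff ℂ ω g := (Q.contDiff_act v).comp (contDiff_const.add b.L.contDiff)
  have hgt : g h ∈ b'.box.target := by
    change Q.act v (b.base + b.L h) ∈ _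
    rw [hv]
    exact b'.mem_target_of_mem_A hh'
  have h1 : ContDiffAt ℂ ω (fun k => (b'.box.symm (g k)).1) h :=
    (((b'.contDiffOn_symm.contDiffAt (b'.box.open_target.mem_nhds hgt)).comp h hg.contDiffAt)).fst
  refine (h1.congr_of_eventuallyEq ?_).contDiffWithinAt
  filter_upwards [b.isOpen_A.mem_nhds hh1,
    hg.continuous.continuousAt.preimage_mem_nhds (b'.box.open_target.mem_nhds hgt)] with k hk hkt
  have hkt' : ((⟨g k, Q.mem v _ (b.mem_of_mem_A hk)⟩ : X) : E) ∈ b'.box.target := hkt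
  rw [Function.comp_apply, b.chart_symm_apply hk, ← b'.chart_orb hkt']
  exact congrArg b'.chart (Q.orb_eq_orb.2 ⟨v, rfl⟩)

end FlowBox

section Manifold

variable [FiniteDimensional ℂ E] [FiniteDimensional ℂ V] {d : ℕ}
    (hd : Module.finrank ℂ E = d + Module.finrank ℂ V)

include hd in
theorem exists_chart (y : Q.Orbits) : ∃ b : Q.FlowBox d, y ∈ b.chart.source := by
  obtain ⟨x, rfl⟩ := Q.orb_surjective y
  obtain ⟨L, hL⟩ := Q.exists_isTransverse hd x.2
  obtain ⟨b, hb, -⟩ := Q.exists_flowBox x.2 hL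
  refine ⟨b, b.orb_mem_chart_source ?_⟩
  have := b.mem_target_of_mem_A b.zero_mem_A
  rwa [map_zero, add_zero, hb] at this

/-- The charts of the orbit space: all those given by flow boxes. -/
@[reducible] noncomputable def chartedSpace : ChartedSpace (Fin d → ℂ) Q.Orbits where
  atlas := Set.range fun b : Q.FlowBox d => b.chart
  chartAt y := (Q.exists_chart hd y).choose.chart
  mem_chart_source y := (Q.exists_chart hd y).choose_spec
  chart_mem_atlas _ := ⟨_, rfl⟩

/-- The orbit space as a complex manifold. -/
noncomputable def orbitManifold : ComplexManifold d :=
  letI := Q.chartedSpace hd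
  { carrier := Q.Orbits
    isManifold := by
      refine isManifold_of_contDiffOn _ _ _ ?_
      rintro _ _ ⟨b, rfl⟩ ⟨b', rfl⟩
      simpa using b.contDiffOn_transition b' }

/-- The projection to the orbit manifold. -/
def proj (x : X) : Q.orbitManifold hd := Q.orb x

end Manifold

end ProperHolomorphicAction

end OrbitManifold

/-! ### Submersions -/

section Submersions

open Manifold

/-- Biholomorphic maps between open subsets of `E` restrict to charts of open subsets of `E`. -/
theorem subtypeRestr_mem_maximalAtlas_of_contDiffOn {E : Type*} [NormedAddCommGroup E]
    [NormedSpace ℂ E] {X : Opens E} (hX : Nonempty X) (e : OpenPartialHomeomorph E E)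
    (h : ContDiffOn ℂ ω e e.source) (h' : ContDiffOn ℂ ω e.symm e.target) :
    e.subtypeRestr hX ∈ IsManifold.maximalAtlas 𝓘(ℂ, E) ω X := by
  have he : e ∈ contDiffGroupoid ω 𝓘(ℂ, E) := by
    rw [contDiffGroupoid, mem_groupoid_of_pregroupoid]
    simp only [contDiffPregroupoid, modelWithCornersSelf_coe, modelWithCornersSelf_coe_symm,
      Function.comp_id, Function.id_comp, Set.preimage_id, Set.range_id, Set.inter_univ]
    exact ⟨h, h'⟩
  intro e' he'
  obtain ⟨x, rfl⟩ := Opens.chart_eq hX he'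
  rw [chartAt_self_eq]
  constructor
  · refine (contDiffGroupoid ω 𝓘(ℂ, E)).mem_of_eqOnSource (closedUnderRestriction' ?_
      (e.isOpen_inter_preimage_symm X.2)) (e.subtypeRestr_symm_trans_subtypeRestr hX _)
    rw [OpenPartialHomeomorph.trans_refl]
    exact (contDiffGroupoid ω 𝓘(ℂ, E)).symm he
  · refine (contDiffGroupoid ω 𝓘(ℂ, E)).mem_of_eqOnSource (closedUnderRestriction' ?_
      ((OpenPartialHomeomorph.refl E).isOpen_inter_preimage_symm X.2))
      ((OpenPartialHomeomorph.refl E).subtypeRestr_symm_trans_subtypeRestr hX _)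
    rw [OpenPartialHomeomorph.refl_symm, OpenPartialHomeomorph.refl_trans]
    exact he

variable {E H Z G : Type*} [NormedAddCommGroup E] [NormedSpace ℂ E] [NormedAddCommGroup H]
  [NormedSpace ℂ H] [NormedAddCommGroup G] [NormedSpace ℂ G]
  {M N N' : Type*} [TopologicalSpace M] [ChartedSpace E M] [TopologicalSpace N] [ChartedSpace H N]
  [TopologicalSpace N'] [ChartedSpace G N']

/-- A map on the target of a surjective submersion is holomorphic if its composition with the
submersion is. -/
theorem contMDiff_of_comp_isSubmersion [IsManifold 𝓘(ℂ, E) ω M] [IsManifold 𝓘(ℂ, H) ω N]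
    {p : M → N} (hp : IsSubmersion 𝓘(ℂ, E) 𝓘(ℂ, H) ω p) (hs : Function.Surjective p)
    {f : N → N'} (hf : ContMDiff 𝓘(ℂ, E) 𝓘(ℂ, G) ω (f ∘ p)) : ContMDiff 𝓘(ℂ, H) 𝓘(ℂ, G) ω f := by
  intro y
  obtain ⟨x, rfl⟩ := hs y
  have h := hp.isSubmersionAt x
  let φ := h.domChart
  let ψ := h.codChart
  let ε := h.equiv
  have hφψ : ∀ u ∈ φ.target, ψ (p (φ.symm u)) = (ε u).1 := by
    intro u hu
    have hu' : u ∈ (h.domChart.extend 𝓘(ℂ, E)).target := by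
      simpa [OpenPartialHomeomorph.extend] using hu
    have := h.writtenInCharts hu'
    simpa [OpenPartialHomeomorph.extend] using this
  -- In the charts, a local section of `p` through `x`: the complementary coordinate is frozen at
  -- its value at `x`. Near `p x`, `f` is `f ∘ p` composed with this section.
  let η : N → E := fun y => ε.symm (ψ y, (ε (φ x)).2)
  have hx : x ∈ φ.source := h.mem_domChart_source
  have hy : p x ∈ ψ.source := h.mem_codChart_source
  have hη : η (p x) = φ x := by
    have h1 := hφψ (φ x) (φ.map_source hx)
    rw [φ.left_inv hx] at h1
    simp only [η, h1]
    exact ε.symm_apply_apply _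
  have hηs : ContMDiffAt 𝓘(ℂ, H) 𝓘(ℂ, E) ω η (p x) := by
    have h1 : ContMDiffAt 𝓘(ℂ, H) 𝓘(ℂ, H) ω ψ (p x) :=
      contMDiffAt_of_mem_maximalAtlas h.codChart_mem_maximalAtlas hy
    have h2 : ContMDiff 𝓘(ℂ, H) 𝓘(ℂ, E) ω fun z : H => ε.symm (z, (ε (φ x)).2) :=
      (ε.symm.contDiff.comp (contDiff_id.prodMk contDiff_const)).contMDiff
    exact h2.contMDiffAt.comp _ h1
  have hθ : ContMDiffAt 𝓘(ℂ, H) 𝓘(ℂ, E) ω (φ.symm ∘ η) (p x) := by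
    refine ContMDiffAt.comp _ ?_ hηs
    rw [hη]
    exact contMDiffAt_symm_of_mem_maximalAtlas h.domChart_mem_maximalAtlas (φ.map_source hx)
  have hev : ∀ᶠ z in 𝓝 (p x), p (φ.symm (η z)) = z := by
    have h1 : ∀ᶠ z in 𝓝 (p x), η z ∈ φ.target := by
      refine hηs.continuousAt.eventually (φ.open_target.mem_nhds ?_)
      rw [hη]
      exact φ.map_source hx
    filter_upwards [h1, ψ.open_source.mem_nhds hy] with z hz hzψ
    have h2 := hφψ _ hz
    have h3 : (ε (η z)).1 = ψ z := by simp [η]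
    exact ψ.injOn (h.source_subset_preimage_source (φ.map_target hz)) hzψ (h2.trans h3)
  have h4 : ContMDiffAt 𝓘(ℂ, H) 𝓘(ℂ, G) ω ((f ∘ p) ∘ (φ.symm ∘ η)) (p x) :=
    hf.contMDiffAt.comp _ hθ
  refine h4.congr_of_eventuallyEq ?_
  filter_upwards [hev] with z hz
  simp [Function.comp_apply, hz]

/-- Two surjective submersions with the same fibres have biholomorphic targets. -/
theorem exists_diffeomorph_of_isSubmersion [IsManifold 𝓘(ℂ, E) ω M] [IsManifold 𝓘(ℂ, H) ω N]
    [IsManifold 𝓘(ℂ, G) ω N']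
    {p : M → N} (hp : IsSubmersion 𝓘(ℂ, E) 𝓘(ℂ, H) ω p) (hs : Function.Surjective p)
    {p' : M → N'} (hp' : IsSubmersion 𝓘(ℂ, E) 𝓘(ℂ, G) ω p') (hs' : Function.Surjective p')
    (hpp' : ∀ x y, p x = p y ↔ p' x = p' y) :
    ∃ Φ : Diffeomorph 𝓘(ℂ, H) 𝓘(ℂ, G) N N' ω, ∀ x, Φ (p x) = p' x := by
  let f : N → N' := fun y => p' (Function.surjInv hs y)
  let g : N' → N := fun y => p (Function.surjInv hs' y)
  have hf : ∀ x, f (p x) = p' x := fun x => (hpp' _ _).1 (Function.surjInv_eq hs _)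
  have hg : ∀ x, g (p' x) = p x := fun x => (hpp' _ _).2 (Function.surjInv_eq hs' _)
  have hfp : f ∘ p = p' := funext hf
  have hgp : g ∘ p' = p := funext hg
  refine ⟨{ toFun := f, invFun := g, left_inv := ?_, right_inv := ?_
            contMDiff_toFun := ?_, contMDiff_invFun := ?_ }, hf⟩
  · intro y
    obtain ⟨x, rfl⟩ := hs y
    rw [hf, hg]
  · intro y
    obtain ⟨x, rfl⟩ := hs' y
    rw [hg, hf]
  · exact contMDiff_of_comp_isSubmersion hp hs (by
      change ContMDiff _ _ _ (f ∘ p); rw [hfp]; exact hp'.contMDiff)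
  · exact contMDiff_of_comp_isSubmersion hp' hs' (by
      change ContMDiff _ _ _ (g ∘ p'); rw [hgp]; exact hp.contMDiff)

/-- Immersions can be precomposed with biholomorphic maps. -/
theorem isImmersion_comp_diffeomorph {N₁ : Type*} [TopologicalSpace N₁] [ChartedSpace H N₁]
    [IsManifold 𝓘(ℂ, H) ω N₁] [IsManifold 𝓘(ℂ, H) ω N]
    {f : N → N'} (hf : IsImmersion 𝓘(ℂ, H) 𝓘(ℂ, G) ω f)
    (Φ : Diffeomorph 𝓘(ℂ, H) 𝓘(ℂ, H) N₁ N ω) : IsImmersion 𝓘(ℂ, H) 𝓘(ℂ, G) ω (f ∘ Φ) := by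
  refine IsImmersionOfComplement.isImmersion (F := hf.complement) fun x => ?_
  have h := hf.isImmersionOfComplement_complement (Φ x)
  let e : OpenPartialHomeomorph N₁ H :=
    Φ.toHomeomorph.toOpenPartialHomeomorph.trans h.domChart
  have hes : ∀ y, y ∈ e.source ↔ Φ y ∈ h.domChart.source := fun y => by simp [e]
  have het : e.target = h.domChart.target := by simp [e]
  have he : ∀ u, Φ (e.symm u) = h.domChart.symm u := fun u => by
    simp [e]
  refine IsImmersionAtOfComplement.mk_of_charts h.equiv e h.codChart ((hes x).2
    h.mem_domChart_source) h.mem_codChart_source ?_ h.codChart_mem_maximalAtlas ?_ ?_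
  · refine e.mem_maximalAtlas_of_contMDiffOn ?_ ?_
    · exact (contMDiffOn_of_mem_maximalAtlas h.domChart_mem_maximalAtlas).comp
        Φ.contMDiff.contMDiffOn fun y hy => (hes y).1 hy
    · rw [het]
      exact Φ.symm.contMDiff.comp_contMDiffOn
        (contMDiffOn_symm_of_mem_maximalAtlas h.domChart_mem_maximalAtlas)
  · intro y hy
    exact h.source_subset_preimage_source ((hes y).1 hy)
  · intro u hu
    have hu' : u ∈ (h.domChart.extend 𝓘(ℂ, H)).target := by
      simpa [OpenPartialHomeomorph.extend, het] using hu
    have h1 := h.writtenInCharts hu'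
    simp only [OpenPartialHomeomorph.extend, Function.comp_apply] at h1 ⊢
    simpa [he] using h1

end Submersions

/-! ### The projection to the orbit manifold -/

namespace ProperHolomorphicAction

open Manifold

variable {V E : Type} [NormedAddCommGroup V] [NormedSpace ℂ V]
    [NormedAddCommGroup E] [NormedSpace ℂ E] {X : Opens E} (Q : ProperHolomorphicAction V X)
    [FiniteDimensional ℂ E] [FiniteDimensional ℂ V] {d : ℕ}
    (hd : Module.finrank ℂ E = d + Module.finrank ℂ V)

theorem proj_surjective : Function.Surjective (Q.proj hd) := Q.orb_surjective

theorem proj_eq_proj {x y : X} : Q.proj hd x = Q.proj hd y ↔ ∃ v, Q.act v x = y := Q.orb_eq_orb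

theorem continuous_proj : Continuous (Q.proj hd) := Q.continuous_orb

theorem isOpenQuotientMap_proj : IsOpenQuotientMap (Q.proj hd) :=
  ⟨Q.orb_surjective, Q.continuous_orb, Q.isOpenMap_orb⟩

/-- The chart of the orbit manifold given by a flow box. -/
noncomputable def FlowBox.manifoldChart (b : Q.FlowBox d) :
    OpenPartialHomeomorph (Q.orbitManifold hd) (Fin d → ℂ) := b.chart

theorem FlowBox.manifoldChart_mem (b : Q.FlowBox d) :
    b.manifoldChart Q hd ∈ IsManifold.maximalAtlas 𝓘(ℂ, Fin d → ℂ) ω (Q.orbitManifold hd) :=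
  IsManifold.subset_maximalAtlas ⟨b, rfl⟩

/-- In the coordinates `(h, v)` of a flow box and the chart given by the same box, the projection is
`(h, v) ↦ h`. -/
theorem isSubmersion_proj : IsSubmersion 𝓘(ℂ, E) 𝓘(ℂ, Fin d → ℂ) ω (Q.proj hd) := by
  have hΛ : Module.finrank ℂ ((Fin d → ℂ) × V) = Module.finrank ℂ E := by simp [hd]
  have Λ : ((Fin d → ℂ) × V) ≃L[ℂ] E := ContinuousLinearEquiv.ofFinrankEq hΛ
  let S := (LinearMap.ker (ContinuousLinearMap.fst ℂ (Fin d → ℂ) V ∘L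
    (Λ.symm : E →L[ℂ] (Fin d → ℂ) × V)).toLinearMap)
  have hS : Module.finrank ℂ S = Module.finrank ℂ V := by
    have h1 := LinearMap.finrank_range_add_finrank_ker (ContinuousLinearMap.fst ℂ (Fin d → ℂ) V ∘L
      (Λ.symm : E →L[ℂ] (Fin d → ℂ) × V)).toLinearMap
    rw [LinearMap.range_eq_top.2, finrank_top] at h1
    · simp only [Module.finrank_fintype_fun_eq_card, Fintype.card_fin] at h1
      change _ + Module.finrank ℂ S = _ at h1
      omega
    · intro h
      exact ⟨Λ (h, 0), by simp⟩
  let VS : V ≃L[ℂ] S := ContinuousLinearEquiv.ofFinrankEq hS.symm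
  refine ⟨S, inferInstance, inferInstance, fun x => ?_⟩
  obtain ⟨L, hL⟩ := Q.exists_isTransverse hd x.2
  obtain ⟨b, hb, -⟩ := Q.exists_flowBox x.2 hL
  have hxt : (x : E) ∈ b.box.target := by
    have := b.mem_target_of_mem_A b.zero_mem_A
    rwa [map_zero, add_zero, hb] at this
  have hX : Nonempty X := ⟨x⟩
  -- Charts of `X` must take values in `E`, so the inverse of the box is followed by a linear
  -- identification `Λ` of `(Fin d → ℂ) × V` with `E`.
  let e : OpenPartialHomeomorph E E := b.box.symm.trans Λ.toHomeomorph.toOpenPartialHomeomorph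
  have he : ∀ y, e y = Λ (b.box.symm y) := fun y => rfl
  have hes : e.source = b.box.target := by simp [e]
  have hes' : ∀ u, e.symm u = b.box (Λ.symm u) := fun u => rfl
  refine IsSubmersionAtOfComplement.mk_of_charts
    (Λ.symm.trans ((ContinuousLinearEquiv.refl ℂ (Fin d → ℂ)).prodCongr VS))
    (e.subtypeRestr hX) (b.manifoldChart Q hd) ?_ (b.orb_mem_chart_source hxt) ?_
    (b.manifoldChart_mem Q hd) ?_ ?_
  · rw [e.subtypeRestr_source, Set.mem_preimage, hes]
    exact hxt
  · refine subtypeRestr_mem_maximalAtlas_of_contDiffOn hX e ?_ ?_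
    · rw [hes]
      exact Λ.contDiff.comp_contDiffOn b.contDiffOn_symm
    · have h1 : ContDiff ℂ ω b.box := by
        have : (b.box : (Fin d → ℂ) × V → E) = fun q => Q.act q.2 (b.base + b.L q.1) :=
          funext b.box_apply
        rw [this]
        exact Q.contDiff.comp (contDiff_snd.prodMk
          (contDiff_const.add (b.L.contDiff.comp contDiff_fst)))
      exact (h1.comp Λ.symm.contDiff).contDiffOn
  · intro y hy
    rw [e.subtypeRestr_source, Set.mem_preimage, hes] at hy
    exact b.orb_mem_chart_source hy
  · intro u hu
    have hu' : u ∈ (e.subtypeRestr hX).target := by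
      simpa [OpenPartialHomeomorph.extend] using hu
    have h1 : ((e.subtypeRestr hX).symm u : E) = e.symm u := e.subtypeRestr_symm_apply hX hu'
    have h2 : ((e.subtypeRestr hX).symm u : E) ∈ b.box.target := by
      have := (e.subtypeRestr hX).map_target hu'
      rwa [e.subtypeRestr_source, Set.mem_preimage, hes] at this
    have h3 : (e.subtypeRestr hX) ((e.subtypeRestr hX).symm u) = u :=
      (e.subtypeRestr hX).right_inv hu'
    have h4 : b.box.symm ((e.subtypeRestr hX).symm u : E) = Λ.symm u := by
      rw [Λ.eq_symm_apply]
      exact h3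
    change b.chart (Q.orb ((e.subtypeRestr hX).symm u)) = (Λ.symm u).1
    rw [b.chart_orb h2, h4]

end ProperHolomorphicAction

/-! ### Families of proper holomorphic actions -/

section Families

open Manifold

/-- The product of two open sets. -/
def prodOpens {E P : Type} [TopologicalSpace E] [TopologicalSpace P] (X : Opens E) (B : Opens P) :
    Opens (E × P) := ⟨(X : Set E) ×ˢ (B : Set P), X.isOpen.prod B.isOpen⟩

/-- The splitting `ℂᵈ⁺ᵏ ≃ ℂᵈ × ℂᵏ`. -/
noncomputable def splitCLE (d k : ℕ) : (Fin (d + k) → ℂ) ≃L[ℂ] (Fin d → ℂ) × (Fin k → ℂ) :=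
  ((LinearEquiv.funCongrLeft ℂ ℂ finSumFinEquiv).trans
    (LinearEquiv.sumArrowLequivProdArrow (Fin d) (Fin k) ℂ ℂ)).toContinuousLinearEquiv

namespace ProperHolomorphicAction

variable {V E : Type} [NormedAddCommGroup V] [NormedSpace ℂ V]
    [NormedAddCommGroup E] [NormedSpace ℂ E] {X : Opens E} {k : ℕ} {B : Opens (Fin k → ℂ)}
    (Q : ProperHolomorphicAction V (prodOpens X B)) (hQ : ∀ v q, (Q.act v q).2 = q.2)

include hQ in
theorem act_prod (v : V) (x : E) (b : Fin k → ℂ) : Q.act v (x, b) = ((Q.act v (x, b)).1, b) :=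
  Prod.ext rfl (hQ v (x, b))

include hQ in
theorem fderiv_act_prod (x : E) (b : Fin k → ℂ) (v : V) :
    fderiv ℂ (fun v => Q.act v (x, b)) 0 v = (fderiv ℂ (fun v => (Q.act v (x, b)).1) 0 v, 0) := by
  have h1 : DifferentiableAt ℂ (fun v => (Q.act v (x, b)).1) 0 :=
    (((Q.contDiff.comp (contDiff_id.prodMk contDiff_const)).fst).differentiable
      (by simp)).differentiableAt
  have h2 := h1.hasFDerivAt.prodMk (hasFDerivAt_const b (0 : V))
  have h3 : (fun v => Q.act v (x, b)) = fun v => ((Q.act v (x, b)).1, b) :=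
    funext fun v => Q.act_prod hQ v x b
  rw [h3, h2.fderiv]
  rfl

/-- The action on the fibre over `b`. -/
def fibre {b : Fin k → ℂ} (hb : b ∈ B) : ProperHolomorphicAction V X where
  act v x := (Q.act v (x, b)).1
  contDiff := (Q.contDiff.comp
    (contDiff_fst.prodMk (contDiff_snd.prodMk contDiff_const))).fst
  zero_act x := by rw [Q.zero_act]
  add_act v w x := by rw [Q.add_act, Q.act_prod hQ w x b]
  mem v x hx := (Q.mem v (x, b) ⟨hx, hb⟩).1
  free v x hx hv y := by
    rw [Q.free v (x, b) ⟨hx, hb⟩ (by rw [Q.act_prod hQ, hv]) (y, b)]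
  proper x hx y hy := by
    obtain ⟨K, hK, hev⟩ := Q.proper (x, b) ⟨hx, hb⟩ (y, b) ⟨hy, hb⟩
    refine ⟨K, hK, ?_⟩
    have hc : Continuous fun q : E × E => ((q.1, b), (q.2, b)) := by fun_prop
    filter_upwards [hc.continuousAt.eventually hev] with q hq v hv
    obtain ⟨w, hw, hwq⟩ := hq v (by rw [Q.act_prod hQ, hv])
    exact ⟨w, hw, congrArg Prod.fst hwq⟩
  immersive x hx v w hvw := by
    refine Q.immersive (x, b) ⟨hx, hb⟩ ?_
    rw [Q.fderiv_act_prod hQ, Q.fderiv_act_prod hQ, hvw]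

theorem fibre_act {b : Fin k → ℂ} (hb : b ∈ B) (v : V) (x : E) :
    (Q.fibre hQ hb).act v x = (Q.act v (x, b)).1 := rfl

/-- A transversal of the fibre over `b`, extended in the direction of the base. -/
noncomputable def extendTransversal {d : ℕ} (k : ℕ) (L : (Fin d → ℂ) →L[ℂ] E) :
    (Fin (d + k) → ℂ) →L[ℂ] E × (Fin k → ℂ) :=
  (L.prodMap (ContinuousLinearMap.id ℂ (Fin k → ℂ))) ∘L
    (splitCLE d k : (Fin (d + k) → ℂ) →L[ℂ] (Fin d → ℂ) × (Fin k → ℂ))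

theorem extendTransversal_apply {d k : ℕ} (L : (Fin d → ℂ) →L[ℂ] E) (h : Fin (d + k) → ℂ) :
    extendTransversal k L h = (L (splitCLE d k h).1, (splitCLE d k h).2) := rfl

variable [FiniteDimensional ℂ E] [FiniteDimensional ℂ V] {d : ℕ}

omit [FiniteDimensional ℂ E] [FiniteDimensional ℂ V] in
theorem isTransverse_extendTransversal {b : Fin k → ℂ} (hb : b ∈ B) {x : E}
    {L : (Fin d → ℂ) →L[ℂ] E} (hL : (Q.fibre hQ hb).IsTransverse x L) :
    Q.IsTransverse (x, b) (extendTransversal k L) := by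
  constructor
  · rintro ⟨h, v⟩ ⟨h', v'⟩ heq
    simp only [extendTransversal_apply, Q.fderiv_act_prod hQ, Prod.mk_add_mk, add_zero,
      Prod.mk.injEq] at heq
    have h1 := hL.1 (a₁ := ((splitCLE d k h).1, v)) (a₂ := ((splitCLE d k h').1, v')) heq.1
    have h2 := Prod.mk.inj h1
    refine Prod.ext ((splitCLE d k).injective (Prod.ext h2.1 heq.2)) h2.2
  · rintro ⟨y, c⟩
    obtain ⟨⟨h, v⟩, hv⟩ := hL.2 y
    refine ⟨((splitCLE d k).symm (h, c), v), ?_⟩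
    simp only [extendTransversal_apply, Q.fderiv_act_prod hQ, Prod.mk_add_mk, add_zero,
      ContinuousLinearEquiv.apply_symm_apply]
    exact Prod.ext hv rfl

variable (hd : Module.finrank ℂ E = d + Module.finrank ℂ V)

include hd in
omit [FiniteDimensional ℂ V] in
theorem finrank_prod_eq (k : ℕ) :
    Module.finrank ℂ (E × (Fin k → ℂ)) = (d + k) + Module.finrank ℂ V := by
  rw [Module.finrank_prod, hd, Module.finrank_fintype_fun_eq_card, Fintype.card_fin]
  omega

/-- The total space of the family of orbit manifolds. -/
noncomputable abbrev familyTotal : ComplexManifold (d + k) :=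
  Q.orbitManifold (finrank_prod_eq hd k)

/-- The projection of the family of orbit manifolds to its base. -/
noncomputable def familyProj : Q.familyTotal hd → B :=
  Quotient.lift (s := Q.orbitRel) (fun x => ⟨x.1.2, x.2.2⟩) (by
    rintro x y ⟨v, hv⟩
    refine Subtype.ext ?_
    change (x : E × (Fin k → ℂ)).2 = (y : E × (Fin k → ℂ)).2
    rw [← hQ v x, hv])

theorem continuous_familyProj : Continuous (Q.familyProj hQ hd) := by
  refine (Q.isOpenQuotientMap_proj (finrank_prod_eq hd k)).continuous_comp_iff.1 ?_
  exact (continuous_snd.comp continuous_subtype_val).subtype_mk _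

theorem isSubmersion_familyProj :
    IsSubmersion 𝓘(ℂ, Fin (d + k) → ℂ) 𝓘(ℂ, Fin k → ℂ) ω (Q.familyProj hQ hd) := by
  refine ⟨Fin d → ℂ, inferInstance, inferInstance, fun y => ?_⟩
  obtain ⟨⟨⟨x, c⟩, hx⟩, rfl⟩ := Q.proj_surjective (finrank_prod_eq hd k) y
  obtain ⟨L, hL⟩ := (Q.fibre hQ hx.2).exists_isTransverse hd hx.1
  obtain ⟨b, hb, hbL⟩ := Q.exists_flowBox hx (Q.isTransverse_extendTransversal hQ hx.2 hL)
  have hxt : (x, c) ∈ b.box.target := by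
    have := b.mem_target_of_mem_A b.zero_mem_A
    rwa [map_zero, add_zero, hb] at this
  have hB : Nonempty B := ⟨⟨c, hx.2⟩⟩
  -- The box is centred at `(x, c)`, so its base coordinates measure the displacement from `c`;
  -- translating the base by `-c` makes the projection linear in these charts.
  let e : OpenPartialHomeomorph (Fin k → ℂ) (Fin k → ℂ) :=
    (Homeomorph.addRight (-c)).toOpenPartialHomeomorph
  refine IsSubmersionAtOfComplement.mk_of_charts
    ((splitCLE d k).trans (ContinuousLinearEquiv.prodComm ℂ (Fin d → ℂ) (Fin k → ℂ)))
    (b.manifoldChart Q _) (e.subtypeRestr hB) (b.orb_mem_chart_source hxt) (by simp [e])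
    (b.manifoldChart_mem Q _) ?_ (fun _ _ => by simp [e]) ?_
  · refine subtypeRestr_mem_maximalAtlas_of_contDiffOn hB e ?_ ?_
    · exact (contDiff_id.add contDiff_const).contDiffOn
    · refine ContDiff.contDiffOn ?_
      change ContDiff ℂ ω fun z => z + - -c
      exact contDiff_id.add contDiff_const
  · intro h hh
    have hh' : h ∈ b.A := by
      have : h ∈ (b.manifoldChart Q (finrank_prod_eq hd k)).target := by
        simpa [OpenPartialHomeomorph.extend] using hh
      exact this
    change (Q.familyProj hQ hd (b.chart.symm h)).1 + -c = (splitCLE d k h).2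
    rw [b.chart_symm_apply hh']
    change (b.base + b.L h).2 + -c = _
    rw [hb, hbL, extendTransversal_apply]
    simp

/-- The inclusion of the fibre over `b`. -/
noncomputable def fibreIncl {b : Fin k → ℂ} (hb : b ∈ B) :
    (Q.fibre hQ hb).orbitManifold hd → Q.familyTotal hd :=
  Quotient.lift (s := (Q.fibre hQ hb).orbitRel)
    (fun x => Q.proj (finrank_prod_eq hd k) ⟨(x, b), x.2, hb⟩) (by
      rintro x y ⟨v, hv⟩
      refine (Q.proj_eq_proj _).2 ⟨v, ?_⟩
      rw [fibre_act] at hv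
      rw [Q.act_prod hQ, hv])

theorem fibreIncl_proj {b : Fin k → ℂ} (hb : b ∈ B) (x : X) :
    Q.fibreIncl hQ hd hb ((Q.fibre hQ hb).proj hd x) =
      Q.proj (finrank_prod_eq hd k) ⟨(x, b), x.2, hb⟩ := rfl

theorem continuous_fibreIncl {b : Fin k → ℂ} (hb : b ∈ B) :
    Continuous (Q.fibreIncl hQ hd hb) := by
  refine ((Q.fibre hQ hb).isOpenQuotientMap_proj hd).continuous_comp_iff.1 ?_
  exact (Q.continuous_proj _).comp
    ((continuous_subtype_val.prodMk continuous_const).subtype_mk _)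

theorem injective_fibreIncl {b : Fin k → ℂ} (hb : b ∈ B) :
    Function.Injective (Q.fibreIncl hQ hd hb) := by
  intro y y' h
  obtain ⟨x, rfl⟩ := (Q.fibre hQ hb).proj_surjective hd y
  obtain ⟨x', rfl⟩ := (Q.fibre hQ hb).proj_surjective hd y'
  rw [fibreIncl_proj, fibreIncl_proj] at h
  obtain ⟨v, hv⟩ := (Q.proj_eq_proj _).1 h
  exact ((Q.fibre hQ hb).proj_eq_proj hd).2 ⟨v, congrArg Prod.fst hv⟩

theorem range_fibreIncl {b : Fin k → ℂ} (hb : b ∈ B) :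
    Set.range (Q.fibreIncl hQ hd hb) = Q.familyProj hQ hd ⁻¹' {⟨b, hb⟩} := by
  ext y
  constructor
  · rintro ⟨z, rfl⟩
    obtain ⟨x, rfl⟩ := (Q.fibre hQ hb).proj_surjective hd z
    rfl
  · intro hy
    obtain ⟨⟨⟨x, c⟩, hx⟩, rfl⟩ := Q.proj_surjective (finrank_prod_eq hd k) y
    have hc : c = b := congrArg Subtype.val (show (⟨c, hx.2⟩ : B) = ⟨b, hb⟩ from hy)
    subst hc
    exact ⟨(Q.fibre hQ hb).proj hd ⟨x, hx.1⟩, rfl⟩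

/-- A box of the fibre and a box of the total space are built from the same transversal `L`, the
second one extended in the direction of the base. In the two charts the inclusion reads `h ↦ (h,
0)`. -/
theorem isImmersion_fibreIncl {b : Fin k → ℂ} (hb : b ∈ B) :
    IsImmersion 𝓘(ℂ, Fin d → ℂ) 𝓘(ℂ, Fin (d + k) → ℂ) ω (Q.fibreIncl hQ hd hb) := by
  refine ⟨Fin k → ℂ, inferInstance, inferInstance, fun y => ?_⟩
  obtain ⟨x, rfl⟩ := (Q.fibre hQ hb).proj_surjective hd y
  obtain ⟨L, hL⟩ := (Q.fibre hQ hb).exists_isTransverse hd x.2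
  obtain ⟨β, hβ, hβL⟩ := (Q.fibre hQ hb).exists_flowBox x.2 hL
  obtain ⟨γ, hγ, hγL⟩ := Q.exists_flowBox (x := ((x : E), b)) ⟨x.2, hb⟩
    (Q.isTransverse_extendTransversal hQ hb hL)
  have hxβ : (x : E) ∈ β.box.target := by
    have := β.mem_target_of_mem_A β.zero_mem_A
    rwa [map_zero, add_zero, hβ] at this
  have hxγ : ((x : E), b) ∈ γ.box.target := by
    have := γ.mem_target_of_mem_A γ.zero_mem_A
    rwa [map_zero, add_zero, hγ] at this
  let χ := β.manifoldChart (Q.fibre hQ hb) hd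
  let ι : (Fin d → ℂ) → (Fin (d + k) → ℂ) := fun h => (splitCLE d k).symm (h, 0)
  have hι : Continuous ι :=
    (splitCLE d k).symm.continuous.comp (continuous_id.prodMk continuous_const)
  -- The two boxes come from separate applications of the inverse function theorem; the chart of the
  -- fibre is restricted so that its points land in the other box.
  let O : Set ((Q.fibre hQ hb).orbitManifold hd) := χ.source ∩ χ ⁻¹' (ι ⁻¹' γ.A)
  have hO : IsOpen O := χ.isOpen_inter_preimage (γ.isOpen_A.preimage hι)
  have hχ0 : χ ((Q.fibre hQ hb).proj hd x) = 0 := by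
    have h1 : (Q.fibre hQ hb).proj hd x = β.param 0 := by
      rw [β.param_eq (by rw [map_zero, add_zero, hβ]; exact x.2)]
      refine ((Q.fibre hQ hb).proj_eq_proj hd).2 ⟨0, ?_⟩
      rw [(Q.fibre hQ hb).zero_act]
      change (x : E) = β.base + β.L 0
      rw [map_zero, add_zero, hβ]
    rw [h1]
    exact β.injOn_param.leftInvOn_invFunOn β.zero_mem_A
  have hval : ∀ h ∈ β.A, ι h ∈ γ.A → Q.fibreIncl hQ hd hb (β.chart.symm h) = γ.param (ι h) := by
    intro h hh hh'
    rw [β.chart_symm_apply hh, γ.param_eq (γ.mem_of_mem_A hh')]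
    refine (Q.proj_eq_proj (finrank_prod_eq hd k)).2 ⟨0, ?_⟩
    rw [Q.zero_act]
    refine Prod.ext ?_ ?_
    · change β.base + β.L h = (γ.base + γ.L (ι h)).1
      rw [hγ, hγL, hβ, hβL, extendTransversal_apply]
      simp [ι]
    · change b = (γ.base + γ.L (ι h)).2
      rw [hγ, hγL, extendTransversal_apply]
      simp [ι]
  have hinv : ∀ y ∈ χ.source, β.chart.symm (χ y) = y := fun y hy => χ.left_inv hy
  refine IsImmersionAtOfComplement.mk_of_charts (splitCLE d k).symm (χ.restr O)
    (γ.manifoldChart Q (finrank_prod_eq hd k)) ?_ (γ.orb_mem_chart_source hxγ)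
    (restr_mem_maximalAtlas _ (β.manifoldChart_mem _ hd) hO) (γ.manifoldChart_mem Q _) ?_ ?_
  · rw [χ.restr_source' _ hO]
    refine ⟨β.orb_mem_chart_source hxβ, β.orb_mem_chart_source hxβ, ?_⟩
    rw [Set.mem_preimage, hχ0]
    have h0 : ι 0 = 0 := (splitCLE d k).symm.map_zero
    rw [Set.mem_preimage, h0]
    exact γ.zero_mem_A
  · intro y hy
    rw [χ.restr_source' _ hO] at hy
    rw [Set.mem_preimage, ← hinv y hy.1, hval _ (χ.map_source hy.1) hy.2.2]
    exact ⟨_, hy.2.2, rfl⟩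
  · intro h hh
    have hh' : h ∈ (χ.restr O).target := by
      simpa [OpenPartialHomeomorph.extend] using hh
    have h1 : h ∈ β.A := hh'.1
    have h2 : χ.symm h ∈ O := by
      have := (χ.restr O).map_target hh'
      rw [χ.restr_source' _ hO] at this
      exact this.2
    have h3 : ι h ∈ γ.A := by
      have := h2.2
      rwa [Set.mem_preimage, χ.right_inv h1] at this
    change γ.chart (Q.fibreIncl hQ hd hb (β.chart.symm h)) = ι h
    rw [hval h h1 h3]
    exact γ.injOn_param.leftInvOn_invFunOn h3

end ProperHolomorphicAction

end Families

/-! ### Exponential actions -/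

section ExponentialActions

variable {m n : ℕ}

/-- The linear forms `(z, w) ↦ ℓᵢ(z) + w`. -/
noncomputable def complexForm (ℓ : Fin (n + 1) → Fin m → ℂ) (i : Fin (n + 1)) :
    (Fin m → ℂ) × ℂ →L[ℂ] ℂ :=
  (∑ j, ℓ i j • ContinuousLinearMap.proj (R := ℂ) (φ := fun _ : Fin m => ℂ) j) ∘L
    ContinuousLinearMap.fst ℂ (Fin m → ℂ) ℂ + ContinuousLinearMap.snd ℂ (Fin m → ℂ) ℂ

theorem complexForm_apply (ℓ : Fin (n + 1) → Fin m → ℂ) (i : Fin (n + 1)) (v : (Fin m → ℂ) × ℂ) :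
    complexForm ℓ i v = ∑ j, ℓ i j * v.1 j + v.2 := by
  simp [complexForm]

/-- The real linear forms `(z, w) ↦ Re ℓᵢ(z) + w`. -/
noncomputable def realForm (ℓ : Fin (n + 1) → Fin m → ℂ) (i : Fin (n + 1)) :
    (Fin m → ℂ) × ℝ →ₗ[ℝ] ℝ where
  toFun v := (∑ j, ℓ i j * v.1 j).re + v.2
  map_add' v w := by
    simp only [Prod.fst_add, Prod.snd_add, Pi.add_apply, mul_add, Finset.sum_add_distrib,
      Complex.add_re]
    ring
  map_smul' c v := by
    simp only [Prod.smul_fst, Prod.smul_snd, Pi.smul_apply, RingHom.id_apply, smul_eq_mul,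
      Complex.real_smul]
    rw [mul_add, ← Complex.re_ofReal_mul, Finset.mul_sum]
    congr 3
    funext j
    ring

theorem realForm_apply (ℓ : Fin (n + 1) → Fin m → ℂ) (i : Fin (n + 1)) (v : (Fin m → ℂ) × ℝ) :
    realForm ℓ i v = (∑ j, ℓ i j * v.1 j).re + v.2 := rfl

theorem re_complexForm (ℓ : Fin (n + 1) → Fin m → ℂ) (i : Fin (n + 1)) (v : (Fin m → ℂ) × ℂ) :
    (complexForm ℓ i v).re = realForm ℓ i (v.1, v.2.re) := by
  rw [complexForm_apply, realForm_apply, Complex.add_re]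

theorem abs_re_sum_mul_le (a z : Fin m → ℂ) : |(∑ j, a j * z j).re| ≤ (∑ j, ‖a j‖) * ‖z‖ := by
  refine (Complex.abs_re_le_norm _).trans ((norm_sum_le _ _).trans ?_)
  rw [Finset.sum_mul]
  refine Finset.sum_le_sum fun j _ => ?_
  rw [norm_mul]
  exact mul_le_mul_of_nonneg_left (norm_le_pi_norm z j) (norm_nonneg _)

theorem abs_realForm_le (ℓ : Fin (n + 1) → Fin m → ℂ) (i : Fin (n + 1)) (v : (Fin m → ℂ) × ℝ) :
    |realForm ℓ i v| ≤ (∑ j, ‖ℓ i j‖ + 1) * ‖v‖ := by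
  rw [realForm_apply]
  refine (abs_add_le _ _).trans ?_
  rw [add_mul, one_mul]
  refine add_le_add ((abs_re_sum_mul_le _ _).trans ?_) (norm_snd_le v)
  exact mul_le_mul_of_nonneg_left (norm_fst_le v) (Finset.sum_nonneg fun _ _ => norm_nonneg _)

theorem abs_realForm_sub_le (ℓ ℓ' : Fin (n + 1) → Fin m → ℂ) {ε : ℝ}
    (h : ∀ i j, ‖ℓ i j - ℓ' i j‖ ≤ ε) (i : Fin (n + 1)) (v : (Fin m → ℂ) × ℝ) :
    |realForm ℓ i v - realForm ℓ' i v| ≤ m * ε * ‖v‖ := by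
  have h1 : realForm ℓ i v - realForm ℓ' i v = (∑ j, (ℓ i j - ℓ' i j) * v.1 j).re := by
    simp only [realForm_apply, sub_mul, Finset.sum_sub_distrib, Complex.sub_re]
    ring
  rw [h1]
  refine (abs_re_sum_mul_le _ _).trans ?_
  refine mul_le_mul ?_ (norm_fst_le v) (norm_nonneg _) ?_
  · refine (Finset.sum_le_sum fun j _ => h i j).trans ?_
    simp
  · have : 0 ≤ ∑ j, ‖ℓ i j - ℓ' i j‖ := Finset.sum_nonneg fun _ _ => norm_nonneg _
    refine this.trans ((Finset.sum_le_sum fun j _ => h i j).trans ?_)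
    simp

/-- A quantitative form of the separation property. -/
def SepBound (ℓ : Fin (n + 1) → Fin m → ℂ) (𝓕 : Set (Finset (Fin (n + 1)))) (M : ℝ) : Prop :=
  ∀ s ∈ 𝓕, ∀ t ∈ 𝓕, ∀ (v : (Fin m → ℂ) × ℝ) (C : ℝ), (∀ i ∈ s, realForm ℓ i v ≤ C) →
    (∀ i ∈ t, -C ≤ realForm ℓ i v) → ‖v‖ ≤ M * C

variable {ℓ : Fin (n + 1) → Fin m → ℂ} {𝓕 : Set (Finset (Fin (n + 1)))} {M : ℝ}

theorem SepBound.separates (h : SepBound ℓ 𝓕 M) : Separates (realForm ℓ) 𝓕 := by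
  intro s hs t ht v h1 h2
  have := h s hs t ht v 0 h1 (by simpa using h2)
  rw [mul_zero] at this
  exact norm_le_zero_iff.1 this

theorem SepBound.eq_zero (h : SepBound ℓ 𝓕 M) {s : Finset (Fin (n + 1))} (hs : s ∈ 𝓕)
    {v : (Fin m → ℂ) × ℝ} (hv : ∀ i ∈ s, realForm ℓ i v = 0) : v = 0 :=
  h.separates s hs s hs v (fun i hi => (hv i hi).le) fun i hi => (hv i hi).ge

/-- The separation property is stable under small perturbations of the forms. -/
theorem SepBound.perturb (h : SepBound ℓ 𝓕 M) {ℓ' : Fin (n + 1) → Fin m → ℂ} {ε : ℝ}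
    (hε : M * (m * ε) ≤ 1 / 2) (hℓ : ∀ i j, ‖ℓ i j - ℓ' i j‖ ≤ ε) : SepBound ℓ' 𝓕 (2 * M) := by
  intro s hs t ht v C h1 h2
  have hd := fun i => abs_le.1 (abs_realForm_sub_le ℓ ℓ' hℓ i v)
  -- This gives `‖v‖ ≤ M * C + M * m * ε * ‖v‖`, whose last term is at most `‖v‖ / 2` and is
  -- absorbed on the left.
  have := h s hs t ht v (C + m * ε * ‖v‖) (fun i hi => by linarith [h1 i hi, (hd i).2])
    (fun i hi => by linarith [h2 i hi, (hd i).1])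
  nlinarith [norm_nonneg v]

/-- An affine function bounded above by `C` on the vertices of one polytope and below by `-C` on
those of the other is between `-C` and `C` on the common ball. Its oscillation there controls the
linear part `z`, and its value at the centre then controls the constant part. -/
theorem exists_bound_of_ball_subset {s t : Finset (Fin (n + 1))}
    {c : Fin m → ℂ} {r : ℝ} (hr : 0 < r) (hs : Metric.ball c r ⊆ convexHull ℝ (ℓ '' s))
    (ht : Metric.ball c r ⊆ convexHull ℝ (ℓ '' t)) :
    ∃ M, 0 ≤ M ∧ ∀ (v : (Fin m → ℂ) × ℝ) (C : ℝ), (∀ i ∈ s, realForm ℓ i v ≤ C) →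
      (∀ i ∈ t, -C ≤ realForm ℓ i v) → ‖v‖ ≤ M * C := by
  have hsum : 0 ≤ ∑ j, ‖c j‖ := Finset.sum_nonneg fun _ _ => norm_nonneg _
  refine ⟨max (4 / r) (1 + (∑ j, ‖c j‖) * (4 / r)), by positivity, fun v C h1 h2 => ?_⟩
  let f : (Fin m → ℂ) →ₗ[ℝ] ℝ :=
    { toFun := fun ξ => (∑ j, ξ j * v.1 j).re
      map_add' := fun a b => by
        simp only [Pi.add_apply, add_mul, Finset.sum_add_distrib, Complex.add_re]
      map_smul' := fun a b => by
        simp only [Pi.smul_apply, RingHom.id_apply, smul_eq_mul, Complex.real_smul, mul_assoc]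
        rw [← Finset.mul_sum, Complex.re_ofReal_mul] }
  have f_apply : ∀ ξ, f ξ = (∑ j, ξ j * v.1 j).re := fun _ => rfl
  have hup : ∀ ξ ∈ Metric.ball c r, f ξ + v.2 ≤ C := by
    intro ξ hξ
    have : convexHull ℝ (ℓ '' s) ⊆ {ξ | f ξ ≤ C - v.2} := by
      refine convexHull_min ?_ (convex_halfSpace_le f.isLinear _)
      rintro _ ⟨i, hi, rfl⟩
      have := h1 i hi
      rw [realForm_apply, ← f_apply] at this
      simp only [Set.mem_ofPred_eq]
      linarith
    have := this (hs hξ)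
    simp only [Set.mem_ofPred_eq] at this
    linarith
  have hlow : ∀ ξ ∈ Metric.ball c r, -C ≤ f ξ + v.2 := by
    intro ξ hξ
    have : convexHull ℝ (ℓ '' t) ⊆ {ξ | -C - v.2 ≤ f ξ} := by
      refine convexHull_min ?_ (convex_halfSpace_ge f.isLinear _)
      rintro _ ⟨i, hi, rfl⟩
      have := h2 i hi
      rw [realForm_apply, ← f_apply] at this
      simp only [Set.mem_ofPred_eq]
      linarith
    have := this (ht hξ)
    simp only [Set.mem_ofPred_eq] at this
    linarith
  have hc := hup c (Metric.mem_ball_self hr)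
  have hc' := hlow c (Metric.mem_ball_self hr)
  have hC : 0 ≤ C := by linarith
  have hz : ‖v.1‖ ≤ 4 / r * C := by
    rw [pi_norm_le_iff_of_nonneg (by positivity)]
    intro j
    -- The conjugate phase turns `f η` into `r / 2 * ‖v.1 j‖`, which is at most `2 * C`; this is the
    -- origin of the constant `4 / r`. If `v.1 j = 0`, then division by zero gives `η = 0`, which is
    -- harmless.
    let η : Fin m → ℂ := Pi.single j ((r / 2 : ℝ) * (starRingEnd ℂ (v.1 j) / ‖v.1 j‖))
    have hη : c + η ∈ Metric.ball c r := by
      rw [Metric.mem_ball, dist_eq_norm, add_sub_cancel_left, Pi.norm_single, norm_mul, norm_div,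
        RCLike.norm_conj, Complex.norm_real, Complex.norm_real, norm_norm, Real.norm_eq_abs,
        abs_of_pos (by positivity)]
      have : ‖v.1 j‖ / ‖v.1 j‖ ≤ 1 := div_self_le_one _
      nlinarith
    have hfη : f η = r / 2 * ‖v.1 j‖ := by
      rw [f_apply, Finset.sum_eq_single j]
      · simp only [η, Pi.single_eq_same]
        rw [mul_assoc, Complex.re_ofReal_mul]
        congr 1
        rw [div_mul_eq_mul_div, mul_comm, Complex.mul_conj, Complex.normSq_eq_norm_sq]
        by_cases h0 : ‖v.1 j‖ = 0
        · simp [h0]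
        · rw [← Complex.ofReal_div, Complex.ofReal_re, sq, mul_div_assoc, div_self h0, mul_one]
      · intro k _ hk
        simp [η, hk]
      · simp
    have h3 := hup _ hη
    rw [map_add, hfη] at h3
    have h4 : r / 2 * ‖v.1 j‖ ≤ 2 * C := by linarith
    rw [div_mul_eq_mul_div, le_div_iff₀ hr]
    linarith
  have hw : |v.2| ≤ (1 + (∑ j, ‖c j‖) * (4 / r)) * C := by
    have h3 : |f c| ≤ (∑ j, ‖c j‖) * (4 / r * C) :=
      (abs_re_sum_mul_le c v.1).trans (mul_le_mul_of_nonneg_left hz hsum)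
    have h4 := abs_le.1 h3
    rw [abs_le]
    constructor <;> linarith
  rw [Prod.norm_def]
  refine max_le (hz.trans ?_) (le_trans (le_of_eq (Real.norm_eq_abs _)) (hw.trans ?_))
  · exact mul_le_mul_of_nonneg_right (le_max_left _ _) hC
  · exact mul_le_mul_of_nonneg_right (le_max_right _ _) hC

theorem LVMData.IsLVMB.exists_sepBound {D : LVMData m n} (hD : D.IsLVMB) :
    ∃ M, 0 ≤ M ∧ SepBound D.form D.family M := by
  have h : ∀ q : D.family × D.family, ∃ M, 0 ≤ M ∧ ∀ (v : (Fin m → ℂ) × ℝ) (C : ℝ),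
      (∀ i ∈ q.1.1, realForm D.form i v ≤ C) → (∀ i ∈ q.2.1, -C ≤ realForm D.form i v) →
      ‖v‖ ≤ M * C := by
    rintro ⟨⟨s, hs⟩, ⟨t, ht⟩⟩
    obtain ⟨c, hc⟩ := hD.sep s hs t ht
    obtain ⟨r, hr, hball⟩ := Metric.isOpen_iff.1 (isOpen_interior.inter isOpen_interior) c hc
    exact exists_bound_of_ball_subset hr
      ((hball.trans Set.inter_subset_left).trans interior_subset)
      ((hball.trans Set.inter_subset_right).trans interior_subset)
  choose M hM hb using h
  have : Fintype D.family := Fintype.ofFinite _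
  refine ⟨∑ q, M q, Finset.sum_nonneg fun q _ => hM q, fun s hs t ht v C h1 h2 => ?_⟩
  have h3 := hb (⟨s, hs⟩, ⟨t, ht⟩) v C h1 h2
  have h4 : M (⟨s, hs⟩, ⟨t, ht⟩) ≤ ∑ q, M q :=
    Finset.single_le_sum (f := M) (fun q _ => hM q) (Finset.mem_univ _)
  -- Enlarging the constant is harmless because `C < 0` cannot occur: the bound would force `v = 0`,
  -- whereas a form indexed by the nonempty set `s` would have a negative value at `v`.
  by_cases hC : 0 ≤ C
  · exact h3.trans (mul_le_mul_of_nonneg_right h4 hC)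
  · have h5 : ‖v‖ ≤ 0 := h3.trans (mul_nonpos_of_nonneg_of_nonpos (hM _) (le_of_not_ge hC))
    have h6 : v = 0 := norm_le_zero_iff.1 h5
    obtain ⟨i, hi⟩ : s.Nonempty := by
      rw [← Finset.card_pos, D.card_eq s hs]
      omega
    have := h1 i hi
    rw [h6, map_zero] at this
    exact absurd this hC

/-- Points with a given pattern of nonzero coordinates are only related by bounded elements,
locally uniformly. -/
theorem eventually_norm_le {s t : Finset (Fin (n + 1))} (hs : s ∈ 𝓕) (ht : t ∈ 𝓕)
    {x y : Fin (n + 1) → ℂ} (hx : ∀ i ∈ s, x i ≠ 0) (hy : ∀ i ∈ t, y i ≠ 0) :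
    ∃ R, ∀ᶠ q in 𝓝 (x, y), ∀ ℓ : Fin (n + 1) → Fin m → ℂ, SepBound ℓ 𝓕 M →
      ∀ v, (∀ i, ‖q.2 i‖ = Real.exp (realForm ℓ i v) * ‖q.1 i‖) → ‖v‖ ≤ R := by
  have hpos : ∀ (s : Finset (Fin (n + 1))) (x : Fin (n + 1) → ℂ), (∀ i ∈ s, x i ≠ 0) →
      ∃ c > 0, ∀ i ∈ s, c < ‖x i‖ := by
    intro s x hx
    rcases s.eq_empty_or_nonempty with rfl | hne
    · exact ⟨1, one_pos, by simp⟩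
    · obtain ⟨i, hi, hmin⟩ := s.exists_min_image (fun i => ‖x i‖) hne
      have hi' := norm_pos_iff.2 (hx i hi)
      exact ⟨‖x i‖ / 2, by positivity, fun k hk => by linarith [hmin k hk]⟩
  obtain ⟨c₁, hc₁, hxc⟩ := hpos s x hx
  obtain ⟨c₂, hc₂, hyc⟩ := hpos t y hy
  let c := min c₁ c₂
  have hc : 0 < c := lt_min hc₁ hc₂
  let R := ‖x‖ + ‖y‖ + 1
  have hR : 0 < R := by positivity
  -- With coordinates at least `c` on the relevant members and all coordinates at most `R`, the
  -- forms are at most `log (R / c)` on `s` and at least `-log (R / c)` on `t`. The bound depends on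
  -- the forms only through `M`, as the properness of a family requires.
  refine ⟨M * Real.log (R / c), ?_⟩
  have e1 : ∀ᶠ q in 𝓝 (x, y), ∀ i, i ∈ s → c < ‖q.1 i‖ := by
    refine Filter.eventually_all.2 fun i => ?_
    by_cases hi : i ∈ s
    · have : Continuous fun q : (Fin (n + 1) → ℂ) × (Fin (n + 1) → ℂ) => ‖q.1 i‖ := by fun_prop
      filter_upwards [this.continuousAt.eventually
        (lt_mem_nhds ((min_le_left _ _).trans_lt (hxc i hi)))] with q hq _ using hq
    · exact Filter.Eventually.of_forall fun q h => absurd h hi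
  have e2 : ∀ᶠ q in 𝓝 (x, y), ∀ i, i ∈ t → c < ‖q.2 i‖ := by
    refine Filter.eventually_all.2 fun i => ?_
    by_cases hi : i ∈ t
    · have : Continuous fun q : (Fin (n + 1) → ℂ) × (Fin (n + 1) → ℂ) => ‖q.2 i‖ := by fun_prop
      filter_upwards [this.continuousAt.eventually
        (lt_mem_nhds ((min_le_right _ _).trans_lt (hyc i hi)))] with q hq _ using hq
    · exact Filter.Eventually.of_forall fun q h => absurd h hi
  have e3 : ∀ᶠ q in 𝓝 (x, y), ‖q.1‖ < R := by
    have : Continuous fun q : (Fin (n + 1) → ℂ) × (Fin (n + 1) → ℂ) => ‖q.1‖ := by fun_prop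
    refine this.continuousAt.eventually (gt_mem_nhds ?_)
    change ‖x‖ < ‖x‖ + ‖y‖ + 1
    linarith [norm_nonneg y]
  have e4 : ∀ᶠ q in 𝓝 (x, y), ‖q.2‖ < R := by
    have : Continuous fun q : (Fin (n + 1) → ℂ) × (Fin (n + 1) → ℂ) => ‖q.2‖ := by fun_prop
    refine this.continuousAt.eventually (gt_mem_nhds ?_)
    change ‖y‖ < ‖x‖ + ‖y‖ + 1
    linarith [norm_nonneg x]
  filter_upwards [e1, e2, e3, e4] with q h1 h2 h3 h4 ℓ hℓ v hv
  refine hℓ s hs t ht v _ (fun i hi => ?_) fun i hi => ?_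
  · rw [Real.le_log_iff_exp_le (by positivity), le_div_iff₀ hc]
    calc Real.exp (realForm ℓ i v) * c ≤ Real.exp (realForm ℓ i v) * ‖q.1 i‖ :=
          mul_le_mul_of_nonneg_left (h1 i hi).le (Real.exp_pos _).le
      _ = ‖q.2 i‖ := (hv i).symm
      _ ≤ R := (norm_le_pi_norm q.2 i).trans h4.le
  · rw [neg_le, Real.le_log_iff_exp_le (by positivity), le_div_iff₀ hc, Real.exp_neg,
      inv_mul_le_iff₀ (Real.exp_pos _)]
    calc c ≤ ‖q.2 i‖ := (h2 i hi).le
      _ = _ := hv i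
      _ ≤ Real.exp (realForm ℓ i v) * R :=
          mul_le_mul_of_nonneg_left ((norm_le_pi_norm q.1 i).trans h3.le) (Real.exp_pos _).le

/-- The action `(z, w) • x = (exp (ℓᵢ(z) + w) xᵢ)ᵢ`. -/
noncomputable def expAct (ℓ : Fin (n + 1) → Fin m → ℂ) (v : (Fin m → ℂ) × ℂ)
    (x : Fin (n + 1) → ℂ) : Fin (n + 1) → ℂ :=
  fun i => Complex.exp (complexForm ℓ i v) * x i

theorem norm_expAct (ℓ : Fin (n + 1) → Fin m → ℂ) (v : (Fin m → ℂ) × ℂ) (x : Fin (n + 1) → ℂ)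
    (i : Fin (n + 1)) :
    ‖expAct ℓ v x i‖ = Real.exp (realForm ℓ i (v.1, v.2.re)) * ‖x i‖ := by
  rw [expAct, norm_mul, Complex.norm_exp, re_complexForm]

theorem expAct_ne_zero (ℓ : Fin (n + 1) → Fin m → ℂ) (v : (Fin m → ℂ) × ℂ) (x : Fin (n + 1) → ℂ)
    (i : Fin (n + 1)) : expAct ℓ v x i ≠ 0 ↔ x i ≠ 0 := by
  rw [expAct, mul_ne_zero_iff, and_iff_right (Complex.exp_ne_zero _)]

/-- The compact set of normalized points. -/
def normalizedSet (𝓕 : Set (Finset (Fin (n + 1)))) : Set (Fin (n + 1) → ℂ) :=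
  ⋃ s ∈ 𝓕, {x | (∀ i ∈ s, ‖x i‖ = 1) ∧ ∀ i, ‖x i‖ ≤ 1}

theorem isCompact_normalizedSet (𝓕 : Set (Finset (Fin (n + 1)))) :
    IsCompact (normalizedSet 𝓕) := by
  refine (Set.toFinite 𝓕).isCompact_biUnion fun s _ => ?_
  refine Metric.isCompact_of_isClosed_isBounded ?_ ?_
  · simp only [Set.ofPred_and, Set.ofPred_forall]
    refine IsClosed.inter (isClosed_iInter fun i => isClosed_iInter fun _ => ?_)
      (isClosed_iInter fun i => ?_)
    · exact isClosed_eq (by fun_prop) continuous_const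
    · exact isClosed_le (by fun_prop) continuous_const
  · refine (Metric.isBounded_closedBall (x := (0 : Fin (n + 1) → ℂ)) (r := 1)).subset ?_
    rintro x ⟨-, hx⟩
    rw [mem_closedBall_zero_iff, pi_norm_le_iff_of_nonneg zero_le_one]
    exact hx

/-- Every point with an admissible pattern of nonzero coordinates can be normalized. -/
theorem exists_expAct_mem_normalizedSet (hsep : SepBound ℓ 𝓕 M) (hM : 0 ≤ M)
    (hex : Exchangeable 𝓕) (hcard : ∀ s ∈ 𝓕, s.card = 2 * m + 1)
    {x : Fin (n + 1) → ℂ} {t : Finset (Fin (n + 1))} (ht : t ∈ 𝓕) (hx : ∀ i ∈ t, x i ≠ 0) :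
    ∃ v, expAct ℓ v x ∈ normalizedSet 𝓕 := by
  have hfin : Module.finrank ℝ ((Fin m → ℂ) × ℝ) = 2 * m + 1 := by
    rw [Module.finrank_prod, Module.finrank_pi_fintype]
    simp [Complex.finrank_real_complex, mul_comm]
  let C : ℝ := ∑ i, |Real.log ‖x i‖|
  have hC : ∀ i, |Real.log ‖x i‖| ≤ C := fun i =>
    Finset.single_le_sum (f := fun i => |Real.log ‖x i‖|) (fun _ _ => abs_nonneg _)
      (Finset.mem_univ i)
  have hC0 : 0 ≤ C := Finset.sum_nonneg fun _ _ => abs_nonneg _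
  let A : ℝ := ∑ i, (∑ j, ‖ℓ i j‖ + 1)
  have hA1 : ∀ i, 0 ≤ ∑ j, ‖ℓ i j‖ + 1 := fun i =>
    add_nonneg (Finset.sum_nonneg fun _ _ => norm_nonneg _) zero_le_one
  have hA : ∀ i, ∑ j, ‖ℓ i j‖ + 1 ≤ A := fun i =>
    Finset.single_le_sum (f := fun i => ∑ j, ‖ℓ i j‖ + 1) (fun i _ => hA1 i) (Finset.mem_univ i)
  have hA0 : 0 ≤ A := (hA1 0).trans (hA 0)
  -- A vector below the heights `-log ‖x i‖` gives coordinates of modulus at most `1`, with equality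
  -- where it interpolates. Zero coordinates get a height which no form can reach on vectors of norm
  -- at most `M * C`, so that the chosen member avoids them.
  let h : Fin (n + 1) → ℝ := fun i => if x i = 0 then A * (M * C) + 1 else -Real.log ‖x i‖
  obtain ⟨s, hs, v, hvs, hv⟩ := exists_supporting_interpolation hsep.separates hex ⟨t, ht⟩
    (fun s hs => (hcard s hs).trans hfin.symm) h
  -- The vector lies below the heights on the given member `t` and equals them on the new member
  -- `s`, so separation of these two members bounds it before it is known that `s` avoids the zero
  -- coordinates.
  have hvC : ‖v‖ ≤ M * C := by
    refine hsep t ht s hs v C (fun i hi => ?_) fun i hi => ?_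
    · refine (hv i).trans ?_
      simp only [h, if_neg (hx i hi)]
      exact (neg_le_abs _).trans (hC i)
    · rw [hvs i hi]
      simp only [h]
      split_ifs
      · have : 0 ≤ A * (M * C) := by positivity
        linarith
      · exact neg_le_neg ((le_abs_self _).trans (hC i))
  have hs0 : ∀ i ∈ s, x i ≠ 0 := by
    intro i hi h0
    have h1 := hvs i hi
    simp only [h, if_pos h0] at h1
    have h2 := (le_abs_self _).trans (abs_realForm_le ℓ i v)
    have h3 : (∑ j, ‖ℓ i j‖ + 1) * ‖v‖ ≤ A * (M * C) :=
      mul_le_mul (hA i) hvC (norm_nonneg _) hA0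
    linarith
  have hexp : ∀ i, x i ≠ 0 → Real.exp (h i) * ‖x i‖ = 1 := by
    intro i hi
    simp only [h, if_neg hi]
    rw [Real.exp_neg, Real.exp_log (norm_pos_iff.2 hi), inv_mul_cancel₀ (norm_ne_zero_iff.2 hi)]
  refine ⟨(v.1, (v.2 : ℂ)), Set.mem_iUnion₂.2 ⟨s, hs, fun i hi => ?_, fun i => ?_⟩⟩
  · rw [norm_expAct, Complex.ofReal_re, Prod.mk.eta, hvs i hi, hexp i (hs0 i hi)]
  · rw [norm_expAct, Complex.ofReal_re, Prod.mk.eta]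
    by_cases hi : x i = 0
    · simp [hi]
    · rw [← hexp i hi]
      exact mul_le_mul_of_nonneg_right (Real.exp_le_exp.2 (hv i)) (norm_nonneg _)

end ExponentialActions

/-! ### The quotient manifolds of an LVMB datum and of its perturbations -/

section LVMBFamily

open Manifold

variable {m n : ℕ}

theorem LVMData.nonempty_of_mem (D : LVMData m n) {s : Finset (Fin (n + 1))} (hs : s ∈ D.family) :
    s.Nonempty := by
  rw [← Finset.card_pos, D.card_eq s hs]
  omega

theorem LVMData.mk_mem_U (D : LVMData m n) {x : Fin (n + 1) → ℂ} (hx : x ≠ 0) :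
    Projectivization.mk ℂ x hx ∈ D.U ↔ ∃ s ∈ D.family, ∀ i ∈ s, x i ≠ 0 := by
  obtain ⟨a, ha⟩ := Projectivization.exists_smul_eq_mk_rep ℂ x hx
  change (∃ s ∈ D.family, ∀ i ∈ s, (Projectivization.mk ℂ x hx).rep i ≠ 0) ↔ _
  rw [← ha]
  simp only [Pi.smul_apply, ne_eq, smul_eq_zero_iff_eq]

theorem LVMData.mem_coneOver_U (D : LVMData m n) {x : Fin (n + 1) → ℂ} :
    x ∈ coneOver D.U ↔ ∃ s ∈ D.family, ∀ i ∈ s, x i ≠ 0 := by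
  constructor
  · rintro ⟨hx, h⟩
    exact (D.mk_mem_U hx).1 h
  · rintro ⟨s, hs, h⟩
    obtain ⟨i, hi⟩ := D.nonempty_of_mem hs
    have hx : x ≠ 0 := fun h0 => h i hi (by rw [h0]; rfl)
    exact ⟨hx, (D.mk_mem_U hx).2 ⟨s, hs, h⟩⟩

theorem normalizedSet_subset (D : LVMData m n) : normalizedSet D.family ⊆ coneOver D.U := by
  intro x hx
  obtain ⟨s, hs, h, -⟩ := Set.mem_iUnion₂.1 hx
  refine D.mem_coneOver_U.2 ⟨s, hs, fun i hi h0 => ?_⟩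
  have := h i hi
  simp [h0] at this

/-- The forms perturbed by the parameter `b`. -/
def perturbedForm (ℓ : Fin (n + 1) → Fin m → ℂ) (b : Fin ((n + 1) * m) → ℂ) :
    Fin (n + 1) → Fin m → ℂ := fun i j => ℓ i j + b (finProdFinEquiv (i, j))

theorem perturbedForm_zero (ℓ : Fin (n + 1) → Fin m → ℂ) : perturbedForm ℓ 0 = ℓ := by
  funext i j
  simp [perturbedForm]

/-- The action of `ℂᵐ × ℂ` on the product of the cone and the parameter space. -/
noncomputable def familyAct (ℓ : Fin (n + 1) → Fin m → ℂ) (v : (Fin m → ℂ) × ℂ)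
    (q : (Fin (n + 1) → ℂ) × (Fin ((n + 1) * m) → ℂ)) :
    (Fin (n + 1) → ℂ) × (Fin ((n + 1) * m) → ℂ) :=
  (expAct (perturbedForm ℓ q.2) v q.1, q.2)

theorem complexForm_eq_zero_of_mem {ℓ : Fin (n + 1) → Fin m → ℂ}
    {𝓕 : Set (Finset (Fin (n + 1)))} {M : ℝ} (h : SepBound ℓ 𝓕 M) {s : Finset (Fin (n + 1))}
    (hs : s ∈ 𝓕) {v : (Fin m → ℂ) × ℂ} (hv : ∀ i ∈ s, (complexForm ℓ i v).re = 0) :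
    v.1 = 0 ∧ v.2.re = 0 := by
  have := h.eq_zero hs (v := (v.1, v.2.re)) fun i hi => by rw [← re_complexForm, hv i hi]
  exact Prod.mk.inj this

/-- The proper holomorphic action on the family of cones. -/
noncomputable def LVMData.familyAction (D : LVMData m n) {B : Opens (Fin ((n + 1) * m) → ℂ)}
    {M : ℝ} (hB : ∀ b ∈ B, SepBound (perturbedForm D.form b) D.family M) :
    ProperHolomorphicAction ((Fin m → ℂ) × ℂ) (prodOpens (coneOver D.U) B) where
  act := familyAct D.form
  contDiff := by
    refine ContDiff.prodMk (contDiff_pi.2 fun i => ?_) (contDiff_snd.comp contDiff_snd)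
    simp only [expAct, complexForm_apply, perturbedForm]
    fun_prop
  zero_act q := by
    refine Prod.ext ?_ rfl
    funext i
    simp [familyAct, expAct]
  add_act v w q := by
    refine Prod.ext ?_ rfl
    funext i
    simp only [familyAct, expAct, map_add, Complex.exp_add, mul_assoc]
  mem v q hq := by
    obtain ⟨s, hs, h⟩ := D.mem_coneOver_U.1 hq.1
    exact ⟨D.mem_coneOver_U.2 ⟨s, hs, fun i hi => (expAct_ne_zero _ _ _ _).2 (h i hi)⟩, hq.2⟩
  free v q hq hv := by
    obtain ⟨s, hs, h⟩ := D.mem_coneOver_U.1 hq.1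
    have h1 : ∀ i ∈ s, Complex.exp (complexForm (perturbedForm D.form q.2) i v) = 1 := by
      intro i hi
      have h2 : expAct (perturbedForm D.form q.2) v q.1 i = q.1 i :=
        congrFun (congrArg Prod.fst hv) i
      exact mul_right_cancel₀ (h i hi) (h2.trans (one_mul _).symm)
    -- The real parts vanish on `s`, hence `z = 0`. What is left is `exp w = 1`, and such elements
    -- act trivially everywhere.
    obtain ⟨hz, -⟩ := complexForm_eq_zero_of_mem (hB q.2 hq.2) hs (v := v) fun i hi => by
      have := congrArg norm (h1 i hi)
      rwa [Complex.norm_exp, norm_one, Real.exp_eq_one_iff] at this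
    obtain ⟨i, hi⟩ := D.nonempty_of_mem hs
    have h3 := h1 i hi
    rw [complexForm_apply, hz] at h3
    simp only [Pi.zero_apply, mul_zero, Finset.sum_const_zero, zero_add] at h3
    intro y
    refine Prod.ext ?_ rfl
    funext k
    simp [familyAct, expAct, complexForm_apply, hz, h3]
  proper := by
    rintro ⟨x, b⟩ ⟨hx, hb⟩ ⟨y, c⟩ ⟨hy, hc⟩
    obtain ⟨s, hs, hxs⟩ := D.mem_coneOver_U.1 hx
    obtain ⟨t, ht, hyt⟩ := D.mem_coneOver_U.1 hy
    obtain ⟨R, hR⟩ := eventually_norm_le (M := M) (m := m) hs ht hxs hyt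
    refine ⟨Metric.closedBall 0 (R + Real.pi), isCompact_closedBall _ _, ?_⟩
    have hcont : Continuous fun q : ((Fin (n + 1) → ℂ) × (Fin ((n + 1) * m) → ℂ)) ×
        ((Fin (n + 1) → ℂ) × (Fin ((n + 1) * m) → ℂ)) => (q.1.1, q.2.1) := by fun_prop
    have hcont' : Continuous fun q : ((Fin (n + 1) → ℂ) × (Fin ((n + 1) * m) → ℂ)) ×
        ((Fin (n + 1) → ℂ) × (Fin ((n + 1) * m) → ℂ)) => q.1.2 := by fun_prop
    filter_upwards [hcont.continuousAt.eventually hR,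
      hcont'.continuousAt.eventually (B.isOpen.mem_nhds hb)] with q hq hqB v hv
    have h1 : expAct (perturbedForm D.form q.1.2) v q.1.1 = q.2.1 := congrArg Prod.fst hv
    have h2 := hq _ (hB _ hqB) (v.1, v.2.re) fun i => by
      rw [← norm_expAct]
      exact congrArg norm (congrFun h1 i).symm
    -- Only `z` and `Re w` are bounded by separation. Replacing `w` by `log (exp w)` keeps the
    -- action and brings the imaginary part into `[-π, π]`, which explains the radius `R + π`.
    refine ⟨(v.1, Complex.log (Complex.exp v.2)), ?_, ?_⟩
    · rw [mem_closedBall_zero_iff, Prod.norm_def]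
      have hpi := Real.pi_pos
      refine max_le ((norm_fst_le (v.1, v.2.re)).trans (h2.trans (by linarith))) ?_
      refine (Complex.norm_le_abs_re_add_abs_im _).trans (add_le_add ?_ ?_)
      · rw [Complex.log_re, Complex.norm_exp, Real.log_exp]
        exact (norm_snd_le (v.1, v.2.re)).trans h2
      · rw [Complex.log_im]
        exact Complex.abs_arg_le_pi _
    · rw [← hv]
      refine Prod.ext ?_ rfl
      funext i
      simp only [familyAct, expAct, complexForm_apply, Complex.exp_add,
        Complex.exp_log (Complex.exp_ne_zero _)]
  immersive := by
    rintro ⟨x, b⟩ ⟨hx, hb⟩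
    obtain ⟨s, hs, hxs⟩ := D.mem_coneOver_U.1 hx
    have h1 : HasFDerivAt (fun v => expAct (perturbedForm D.form b) v x)
        (ContinuousLinearMap.pi fun i => x i • complexForm (perturbedForm D.form b) i) 0 := by
      refine hasFDerivAt_pi.2 fun i => ?_
      have := ((complexForm (perturbedForm D.form b) i).hasFDerivAt (x := 0)).cexp.mul_const (x i)
      rw [map_zero, Complex.exp_zero, one_smul] at this
      exact this
    have h2 := (h1.prodMk (hasFDerivAt_const b (0 : (Fin m → ℂ) × ℂ))).fderiv
    change Function.Injective (fderiv ℂ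
      (fun v => (expAct (perturbedForm D.form b) v x, b)) 0)
    rw [h2, injective_iff_map_eq_zero]
    intro v hv
    have h3 : ∀ i ∈ s, complexForm (perturbedForm D.form b) i v = 0 := fun i hi => by
      have : x i * complexForm (perturbedForm D.form b) i v = 0 :=
        congrFun (congrArg Prod.fst hv) i
      exact (mul_eq_zero.1 this).resolve_left (hxs i hi)
    obtain ⟨hz, -⟩ := complexForm_eq_zero_of_mem (hB b hb) hs (v := v) fun i hi => by
      rw [h3 i hi, Complex.zero_re]
    obtain ⟨i, hi⟩ := D.nonempty_of_mem hs
    have h4 := h3 i hi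
    rw [complexForm_apply, hz] at h4
    simp only [Pi.zero_apply, mul_zero, Finset.sum_const_zero, zero_add] at h4
    exact Prod.ext hz h4

variable (D : LVMData m n) {B : Opens (Fin ((n + 1) * m) → ℂ)}
    {M : ℝ} (hB : ∀ b ∈ B, SepBound (perturbedForm D.form b) D.family M)

theorem LVMData.familyAction_snd (v : (Fin m → ℂ) × ℂ)
    (q : (Fin (n + 1) → ℂ) × (Fin ((n + 1) * m) → ℂ)) :
    ((D.familyAction hB).act v q).2 = q.2 := rfl

/-- The action on the fibre over `b`. -/
noncomputable def LVMData.fibreAction {b : Fin ((n + 1) * m) → ℂ} (hb : b ∈ B) :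
    ProperHolomorphicAction ((Fin m → ℂ) × ℂ) (coneOver D.U) :=
  (D.familyAction hB).fibre (D.familyAction_snd hB) hb

theorem finrank_eq_sub_add (hmn : m ≤ n) : Module.finrank ℂ (Fin (n + 1) → ℂ) =
    (n - m) + Module.finrank ℂ ((Fin m → ℂ) × ℂ) := by
  simp only [Module.finrank_prod, Module.finrank_fintype_fun_eq_card, Fintype.card_fin,
    Module.finrank_self]
  omega

/-- Points of the cone have related images in projective space if and only if they are related by
the extended action on the cone. -/
theorem exists_holAction_smul_iff (ℓ : Fin (n + 1) → Fin m → ℂ) {x y : Fin (n + 1) → ℂ}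
    (hx : x ≠ 0) (hy : y ≠ 0) :
    (∃ g, holAction ℓ g • Projectivization.mk ℂ x hx = Projectivization.mk ℂ y hy) ↔
      ∃ v, expAct ℓ v x = y := by
  have hsm : ∀ g : Multiplicative (Fin m → ℂ),
      (fun i => (holAction ℓ g i : ℂ) * x i) = expAct ℓ (g.toAdd, 0) x := by
    intro g
    funext i
    simp [holAction, expAct, complexForm_apply]
  have hne : ∀ v, expAct ℓ v x ≠ 0 := by
    intro v h0
    obtain ⟨i, hi⟩ := Function.ne_iff.1 hx
    exact (expAct_ne_zero ℓ v x i).2 hi (congrFun h0 i)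
  have hw : ∀ z w, expAct ℓ (z, w) x = Complex.exp w • expAct ℓ (z, 0) x := by
    intro z w
    funext i
    simp only [expAct, complexForm_apply, Pi.smul_apply, smul_eq_mul, add_zero, Complex.exp_add]
    ring
  constructor
  · rintro ⟨g, hg⟩
    rw [CPn.torus_smul_mk _ _ _ (by rw [hsm]; exact hne _), Projectivization.mk_eq_mk_iff] at hg
    obtain ⟨a, ha⟩ := hg
    refine ⟨(g.toAdd, Complex.log ((a⁻¹ : ℂˣ) : ℂ)), ?_⟩
    rw [hw, Complex.exp_log (Units.ne_zero _), ← hsm, ← ha]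
    change ((a⁻¹ : ℂˣ) : ℂ) • ((a : ℂˣ) : ℂ) • y = y
    rw [smul_smul, Units.inv_mul, one_smul]
  · rintro ⟨v, rfl⟩
    refine ⟨Multiplicative.ofAdd v.1, ?_⟩
    rw [CPn.torus_smul_mk _ _ _ (by rw [hsm]; exact hne _), Projectivization.mk_eq_mk_iff]
    refine ⟨Units.mk0 (Complex.exp (-v.2)) (Complex.exp_ne_zero _), ?_⟩
    rw [hsm, ← Prod.mk.eta (p := v), hw]
    change Complex.exp (-v.2) • Complex.exp v.2 • expAct ℓ (v.1, 0) x = expAct ℓ (v.1, 0) x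
    rw [smul_smul, ← Complex.exp_add, neg_add_cancel, Complex.exp_zero, one_smul]

theorem coneProj_surjective (U : Opens (CPn n)) : Function.Surjective (coneProj U) := by
  rintro ⟨u, hu⟩
  have h : Projectivization.mk ℂ u.rep u.rep_nonzero = u := u.mk_rep
  refine ⟨⟨u.rep, u.rep_nonzero, by rw [h]; exact hu⟩, Subtype.ext h⟩

/-- The data with perturbed forms. -/
def LVMData.perturb (b : Fin ((n + 1) * m) → ℂ) : LVMData m n where
  form := perturbedForm D.form b
  family := D.family
  card_eq := D.card_eq

theorem LVMData.perturb_zero : D.perturb 0 = D := by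
  cases D
  simp [LVMData.perturb, perturbedForm_zero]

/-- The orbit manifold of the fibre over `b` is the quotient given by the perturbed data. -/
theorem LVMData.isQuotientManifold_fibre (hmn : m ≤ n) {b : Fin ((n + 1) * m) → ℂ} (hb : b ∈ B) :
    (D.perturb b).IsQuotientManifold
      ((D.fibreAction hB hb).orbitManifold (finrank_eq_sub_add hmn)) := by
  let Q := D.fibreAction hB hb
  have hd := finrank_eq_sub_add hmn
  -- The section `σ` is merely set-theoretic. The composition of the resulting map with `coneProj`
  -- is nevertheless `Q.proj`, because proportional points of the cone are in the same orbit.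
  have hlift : ∀ u : D.U, ∃ x, coneProj D.U x = u := coneProj_surjective D.U
  choose σ hσ using hlift
  have hrel : ∀ x y : coneOver D.U, (∃ v, Q.act v x = y) ↔
      ∃ g, holAction (perturbedForm D.form b) g • (coneProj D.U x : CPn n) = coneProj D.U y :=
    fun x y => (exists_holAction_smul_iff _ x.2.1 y.2.1).symm
  have hσ' : ∀ x, Q.proj hd (σ (coneProj D.U x)) = Q.proj hd x := by
    intro x
    rw [Q.proj_eq_proj, hrel, hσ]
    exact ⟨1, by simp⟩
  refine ⟨fun u => Q.proj hd (σ u), ?_, ?_, ?_⟩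
  · intro y
    obtain ⟨x, rfl⟩ := Q.proj_surjective hd y
    exact ⟨coneProj D.U x, hσ' x⟩
  · have key : ∀ u w : D.U, Q.proj hd (σ u) = Q.proj hd (σ w) ↔
        ∃ g, holAction (perturbedForm D.form b) g • (u : CPn n) = w := fun u w => by
      rw [Q.proj_eq_proj, hrel, hσ, hσ]
    exact key
  · change IsSubmersion _ _ _ fun x : coneOver D.U => Q.proj hd (σ (coneProj D.U x))
    simp only [hσ']
    exact Q.isSubmersion_proj hd

/-- All quotient manifolds of the perturbed data are biholomorphic. -/
theorem LVMData.exists_diffeomorph_fibre (hmn : m ≤ n) {b : Fin ((n + 1) * m) → ℂ} (hb : b ∈ B)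
    {N : ComplexManifold (n - m)} (hN : (D.perturb b).IsQuotientManifold N) :
    Nonempty (Diffeomorph 𝓘(ℂ, Fin (n - m) → ℂ) 𝓘(ℂ, Fin (n - m) → ℂ) N
      ((D.fibreAction hB hb).orbitManifold (finrank_eq_sub_add hmn)) ω) := by
  obtain ⟨p, hp⟩ := hN
  let Q := D.fibreAction hB hb
  have hd := finrank_eq_sub_add hmn
  obtain ⟨Φ, -⟩ := exists_diffeomorph_of_isSubmersion hp.submersion
    (hp.surjective.comp (coneProj_surjective D.U)) (Q.isSubmersion_proj hd)
    (Q.proj_surjective hd) (fun x y => (hp.fibres _ _).trans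
      ((exists_holAction_smul_iff _ x.2.1 y.2.1).trans (Q.proj_eq_proj hd).symm))
  exact ⟨Φ⟩

end LVMBFamily

/-! ### Compactness and the deformation family -/

section Deformation

open Manifold

variable {m n : ℕ} (D : LVMData m n)

theorem LVMData.exists_mem_normalizedSet {ℓ : Fin (n + 1) → Fin m → ℂ} {M : ℝ}
    (hsep : SepBound ℓ D.family M) (hM : 0 ≤ M) (hex : Exchangeable D.family)
    {x : Fin (n + 1) → ℂ} (hx : x ∈ coneOver D.U) :
    ∃ v, expAct ℓ v x ∈ normalizedSet D.family := by
  obtain ⟨t, ht, hxt⟩ := D.mem_coneOver_U.1 hx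
  exact exists_expAct_mem_normalizedSet hsep hM hex D.card_eq ht hxt

/-- The normalized points of the cone. -/
def LVMData.normalizedPoints : Set (coneOver D.U) := Subtype.val ⁻¹' normalizedSet D.family

theorem LVMData.isCompact_normalizedPoints : IsCompact D.normalizedPoints := by
  rw [Subtype.isCompact_iff]
  have : Subtype.val '' D.normalizedPoints = normalizedSet D.family := by
    ext x
    constructor
    · rintro ⟨y, hy, rfl⟩
      exact hy
    · exact fun hx => ⟨⟨x, normalizedSet_subset D hx⟩, hx, rfl⟩
  rw [this]
  exact isCompact_normalizedSet _

theorem continuous_coneProj (U : Opens (CPn n)) : Continuous (coneProj U) := by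
  refine Continuous.subtype_mk ?_ _
  have h1 : Continuous fun v : {v : Fin (n + 1) → ℂ // v ≠ 0} => Projectivization.mk ℂ v.1 v.2 :=
    continuous_coinduced_rng
  exact h1.comp (continuous_subtype_val.subtype_mk fun x : coneOver U => x.2.1)

/-- A continuous surjection from `U` that identifies the points of the orbits has compact image. -/
theorem LVMData.compactSpace_of_continuous {M : ℝ} (hsep : SepBound D.form D.family M) (hM : 0 ≤ M)
    (hex : Exchangeable D.family) {Y : Type*} [TopologicalSpace Y] {p : D.U → Y}
    (hp : Continuous fun x => p (coneProj D.U x)) (hs : Function.Surjective p)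
    (hfib : ∀ x y : D.U, (∃ g, holAction D.form g • (x : CPn n) = y) → p x = p y) :
    CompactSpace Y := by
  refine ⟨?_⟩
  convert D.isCompact_normalizedPoints.image hp
  refine (Set.eq_univ_of_forall fun y => ?_).symm
  obtain ⟨u, rfl⟩ := hs y
  obtain ⟨x, rfl⟩ := coneProj_surjective D.U u
  obtain ⟨v, hv⟩ := D.exists_mem_normalizedSet hsep hM hex x.2
  refine ⟨⟨_, normalizedSet_subset D hv⟩, hv, ?_⟩
  exact (hfib _ _ ((exists_holAction_smul_iff _ x.2.1 _).2 ⟨v, rfl⟩)).symm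

theorem LVMData.compactSpace_quotient {M : ℝ} (hsep : SepBound D.form D.family M) (hM : 0 ≤ M)
    (hex : Exchangeable D.family) {d : ℕ} {N : ComplexManifold d} (hN : D.IsQuotientManifold N) :
    CompactSpace N := by
  obtain ⟨p, hp⟩ := hN
  exact D.compactSpace_of_continuous hsep hM hex hp.submersion.contMDiff.continuous hp.surjective
    fun x y h => (hp.fibres x y).2 h

variable {B : Opens (Fin ((n + 1) * m) → ℂ)}
    {M : ℝ} (hB : ∀ b ∈ B, SepBound (perturbedForm D.form b) D.family M)

/-- The total space is a continuous image of `B` times the compact set of normalized points, which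
is the same for all parameters; on this product the projection becomes the first projection, which
is proper. -/
theorem LVMData.isProperMap_familyProj (hmn : m ≤ n) (hM : 0 ≤ M) (hex : Exchangeable D.family) :
    IsProperMap ((D.familyAction hB).familyProj (D.familyAction_snd hB)
      (finrank_eq_sub_add hmn)) := by
  let Q := D.familyAction hB
  have hd := finrank_eq_sub_add hmn
  have : CompactSpace D.normalizedPoints := isCompact_iff_compactSpace.1 D.isCompact_normalizedPoints
  let F : B × D.normalizedPoints → Q.familyTotal hd := fun q =>
    Q.proj _ ⟨((q.2 : coneOver D.U), q.1), (q.2 : coneOver D.U).2, q.1.2⟩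
  have hF : Continuous F := (Q.continuous_proj _).comp
    (((continuous_subtype_val.comp (continuous_subtype_val.comp continuous_snd)).prodMk
      (continuous_subtype_val.comp continuous_fst)).subtype_mk _)
  refine isProperMap_of_comp_of_surj hF (Q.continuous_familyProj _ hd) ?_ ?_
  · have : Q.familyProj (D.familyAction_snd hB) hd ∘ F = Prod.fst := rfl
    rw [this]
    exact isProperMap_fst_of_compactSpace
  · intro y
    obtain ⟨⟨⟨x, b⟩, hx⟩, rfl⟩ := Q.proj_surjective _ y
    obtain ⟨v, hv⟩ := D.exists_mem_normalizedSet (hB b hx.2) hM hex hx.1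
    refine ⟨(⟨b, hx.2⟩, ⟨⟨_, normalizedSet_subset D hv⟩, hv⟩), ?_⟩
    exact ((Q.proj_eq_proj _).2 ⟨v, rfl⟩).symm

/-- The holomorphic family of the quotient manifolds of the perturbed data. -/
noncomputable def LVMData.holomorphicFamily (hmn : m ≤ n) (hM : 0 ≤ M)
    (hex : Exchangeable D.family) (hconn : IsConnected (B : Set (Fin ((n + 1) * m) → ℂ))) :
    HolomorphicFamily (n - m) ((n + 1) * m) where
  base := B
  connected := hconn
  total := (D.familyAction hB).familyTotal (finrank_eq_sub_add hmn)
  proj := (D.familyAction hB).familyProj (D.familyAction_snd hB) (finrank_eq_sub_add hmn)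
  proper := D.isProperMap_familyProj hB hmn hM hex
  submersion := (D.familyAction hB).isSubmersion_familyProj _ _

theorem LVMData.hasFibre_holomorphicFamily (hmn : m ≤ n) (hM : 0 ≤ M)
    (hex : Exchangeable D.family) (hconn : IsConnected (B : Set (Fin ((n + 1) * m) → ℂ)))
    (b : B) {N : ComplexManifold (n - m)} (hN : (D.perturb b).IsQuotientManifold N) :
    (D.holomorphicFamily hB hmn hM hex hconn).HasFibre b N := by
  have : CompactSpace N := (D.perturb b).compactSpace_quotient (hB b b.2) hM hex hN
  obtain ⟨Φ⟩ := D.exists_diffeomorph_fibre hB hmn b.2 hN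
  let Q := D.familyAction hB
  let hQ := D.familyAction_snd hB
  have hd := finrank_eq_sub_add hmn
  refine ⟨Q.fibreIncl hQ hd b.2 ∘ Φ, ⟨?_, ?_⟩, ?_⟩
  · exact isImmersion_comp_diffeomorph (Q.isImmersion_fibreIncl hQ hd b.2) Φ
  -- A continuous injection of the compact `N` in the Hausdorff total space is closed.
  · refine (Topology.IsClosedEmbedding.of_continuous_injective_isClosedMap ?_ ?_ ?_).isEmbedding
    · exact (Q.continuous_fibreIncl hQ hd b.2).comp Φ.continuous
    · exact (Q.injective_fibreIncl hQ hd b.2).comp Φ.injective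
    · exact ((Q.continuous_fibreIncl hQ hd b.2).comp Φ.continuous).isClosedMap
  · exact (Φ.surjective.range_comp _).trans (Q.range_fibreIncl hQ hd b.2)

/-- Arbitrarily small perturbations satisfy condition (K). -/
theorem LVMData.exists_perturb_conditionK {δ : ℝ} (hδ : 0 < δ) :
    ∃ b : Fin ((n + 1) * m) → ℂ, ‖b‖ < δ ∧ (D.perturb b).ConditionK := by
  obtain ⟨q, hq⟩ := exists_nat_one_div_lt hδ
  have hq0 : (0 : ℝ) < q + 1 := by positivity
  -- Rounding to multiples of `1 / (q + 1)` moves the real and the imaginary part by at most half of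
  -- this step each, so every coefficient moves by less than `δ`. Multiplication by `q + 1` is then
  -- the affine automorphism required by (K).
  let r : ℝ → ℝ := fun x => round ((q + 1 : ℝ) * x) / (q + 1)
  have hr : ∀ x, |r x - x| ≤ 1 / 2 * (1 / (q + 1)) := by
    intro x
    have h1 : r x - x = -(((q + 1 : ℝ) * x - round ((q + 1 : ℝ) * x)) * (1 / (q + 1))) := by
      simp only [r]
      field_simp
      ring
    rw [h1, abs_neg, abs_mul, abs_of_pos (show (0 : ℝ) < 1 / (q + 1) by positivity)]
    exact mul_le_mul_of_nonneg_right (abs_sub_round _) (by positivity)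
  let b : Fin ((n + 1) * m) → ℂ := fun k =>
    ⟨r (D.form (finProdFinEquiv.symm k).1 (finProdFinEquiv.symm k).2).re -
      (D.form (finProdFinEquiv.symm k).1 (finProdFinEquiv.symm k).2).re,
     r (D.form (finProdFinEquiv.symm k).1 (finProdFinEquiv.symm k).2).im -
      (D.form (finProdFinEquiv.symm k).1 (finProdFinEquiv.symm k).2).im⟩
  have hform : ∀ i j, (D.perturb b).form i j = ⟨r (D.form i j).re, r (D.form i j).im⟩ := by
    intro i j
    simp only [LVMData.perturb, perturbedForm, b, Equiv.symm_apply_apply]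
    apply Complex.ext <;> simp only [Complex.add_re, Complex.add_im] <;> ring
  refine ⟨b, ?_, (LinearEquiv.smulOfNeZero ℝ (Fin m → ℂ) (q + 1 : ℝ) hq0.ne').toAffineEquiv, ?_⟩
  · refine lt_of_le_of_lt ((pi_norm_le_iff_of_nonneg (by positivity)).2 fun k => ?_) hq
    refine (Complex.norm_le_abs_re_add_abs_im _).trans ?_
    have h1 := hr (D.form (finProdFinEquiv.symm k).1 (finProdFinEquiv.symm k).2).re
    have h2 := hr (D.form (finProdFinEquiv.symm k).1 (finProdFinEquiv.symm k).2).im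
    simp only [b]
    linarith
  · intro i j
    have h1 : ∀ x, (q + 1 : ℝ) * r x = round ((q + 1 : ℝ) * x) := fun x => by
      simp only [r]
      field_simp
    have h2 : (LinearEquiv.smulOfNeZero ℝ (Fin m → ℂ) (q + 1 : ℝ) hq0.ne').toAffineEquiv
        ((D.perturb b).form i) j = ((q + 1 : ℝ) : ℂ) * (D.perturb b).form i j := by
      change ((q + 1 : ℝ) • (D.perturb b).form i) j = _
      rw [Pi.smul_apply, Complex.real_smul]
    rw [h2, Complex.re_ofReal_mul, Complex.im_ofReal_mul, hform]
    exact ⟨⟨_, h1 _⟩, ⟨_, h1 _⟩⟩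

end Deformation

/-! ### Integral bases of the forms -/

section IntegralBasis

variable {m n : ℕ}

/-- The real linear map `z ↦ (Re αₖ(z))ₖ`. -/
noncomputable def realPairing {ι : Type*} (α : ι → Fin m → ℂ) : (Fin m → ℂ) →ₗ[ℝ] (ι → ℝ) where
  toFun z k := (∑ j, α k j * z j).re
  map_add' z w := by
    funext k
    simp only [Pi.add_apply, mul_add, Finset.sum_add_distrib, Complex.add_re]
  map_smul' c z := by
    funext k
    simp only [Pi.smul_apply, RingHom.id_apply, smul_eq_mul, Complex.real_smul]
    rw [← Complex.re_ofReal_mul, Finset.mul_sum]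
    congr 2
    funext j
    ring

theorem realPairing_apply {ι : Type*} (α : ι → Fin m → ℂ) (z : Fin m → ℂ) (k : ι) :
    realPairing α z k = (∑ j, α k j * z j).re := rfl

theorem form_apply_eq_add_sum {ι : Type*} [Fintype ι] {ℓ : Fin (n + 1) → Fin m → ℂ}
    {α : ι → Fin m → ℂ} {ν : Fin (n + 1) → ι → ℤ}
    (h : ∀ i, ℓ i = ℓ 0 + ∑ k, ν i k • α k) (i : Fin (n + 1)) (z : Fin m → ℂ) :
    ∑ j, ℓ i j * z j = ∑ j, ℓ 0 j * z j + ∑ k, ν i k * ∑ j, α k j * z j := by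
  rw [h i]
  simp only [Pi.add_apply, Finset.sum_apply, Pi.smul_apply, add_mul, Finset.sum_add_distrib,
    Finset.sum_mul, Finset.mul_sum]
  rw [Finset.sum_comm (γ := ι)]
  simp only [zsmul_eq_mul, mul_assoc]

theorem realForm_eq_add_sum {ι : Type*} [Fintype ι] {ℓ : Fin (n + 1) → Fin m → ℂ}
    {α : ι → Fin m → ℂ} {ν : Fin (n + 1) → ι → ℤ}
    (h : ∀ i, ℓ i = ℓ 0 + ∑ k, ν i k • α k) (i : Fin (n + 1)) (v : (Fin m → ℂ) × ℝ) :
    realForm ℓ i v = realForm ℓ 0 v + ∑ k, ν i k * realPairing α v.1 k := by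
  have h1 : (∑ k, (ν i k : ℂ) * ∑ j, α k j * v.1 j).re =
      ∑ k, ν i k * realPairing α v.1 k := by
    rw [Complex.re_sum]
    refine Finset.sum_congr rfl fun k _ => ?_
    rw [← Complex.ofReal_intCast, Complex.re_ofReal_mul, realPairing_apply]
  rw [realForm_apply, form_apply_eq_add_sum h, realForm_apply, Complex.add_re, h1]
  ring

/-- If all `Re αₖ(z)` vanish, then all `Re ℓᵢ(z)` are equal, so all forms vanish at `(z, -Re
ℓ₀(z))`. -/
theorem injective_realPairing {ι : Type*} [Fintype ι] {ℓ : Fin (n + 1) → Fin m → ℂ}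
    (hℓ : ∀ v, (∀ i, realForm ℓ i v = 0) → v = 0)
    {α : ι → Fin m → ℂ} {ν : Fin (n + 1) → ι → ℤ}
    (h : ∀ i, ℓ i = ℓ 0 + ∑ k, ν i k • α k) : Function.Injective (realPairing α) := by
  rw [injective_iff_map_eq_zero]
  intro z hz
  have := hℓ (z, -(∑ j, ℓ 0 j * z j).re) fun i => by
    rw [realForm_eq_add_sum h, realForm_apply]
    simp [hz]
  exact congrArg Prod.fst this

theorem finrank_complex_pi : Module.finrank ℝ (Fin m → ℂ) = 2 * m := by
  rw [Module.finrank_pi_fintype]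
  simp [Complex.finrank_real_complex, mul_comm]

/-- The lattice spanned by the differences of the forms. -/
def formLattice (ℓ : Fin (n + 1) → Fin m → ℂ) : Submodule ℤ (Fin m → ℂ) :=
  Submodule.span ℤ (Set.range fun i => ℓ i - ℓ 0)

theorem sub_mem_formLattice (ℓ : Fin (n + 1) → Fin m → ℂ) (i : Fin (n + 1)) :
    ℓ i - ℓ 0 ∈ formLattice ℓ := Submodule.subset_span ⟨i, rfl⟩

theorem eq_add_sum_repr {ι : Type*} [Fintype ι] (ℓ : Fin (n + 1) → Fin m → ℂ)
    (b : Module.Basis ι ℤ (formLattice ℓ)) (i : Fin (n + 1)) :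
    ℓ i = ℓ 0 + ∑ k, b.repr ⟨ℓ i - ℓ 0, sub_mem_formLattice ℓ i⟩ k • (b k : Fin m → ℂ) := by
  have := congrArg Subtype.val (b.sum_repr ⟨ℓ i - ℓ 0, sub_mem_formLattice ℓ i⟩)
  simp only [AddSubmonoidClass.coe_finsetSum, Submodule.coe_smul] at this
  rw [this, add_sub_cancel]

instance (ℓ : Fin (n + 1) → Fin m → ℂ) : Module.Finite ℤ (formLattice ℓ) :=
  Module.Finite.span_of_finite ℤ (Set.finite_range _)

/-- The inclusion of the Gaussian integral vectors. -/
def gaussianInclusion (m : ℕ) : (Fin m → ℤ × ℤ) →ₗ[ℤ] (Fin m → ℂ) where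
  toFun a j := ⟨(a j).1, (a j).2⟩
  map_add' a b := by
    funext j
    apply Complex.ext <;> simp
  map_smul' c a := by
    funext j
    apply Complex.ext <;> simp

/-- The linear part of the automorphism in (K) is injective and sends the differences of the forms
to Gaussian integral vectors, which form a group of rank `2m`. -/
theorem finrank_formLattice_le {ℓ : Fin (n + 1) → Fin m → ℂ}
    (hK : ∃ φ : (Fin m → ℂ) ≃ᵃ[ℝ] (Fin m → ℂ), ∀ (i : Fin (n + 1)) (j : Fin m),
      (∃ a : ℤ, (φ (ℓ i) j).re = a) ∧ (∃ b : ℤ, (φ (ℓ i) j).im = b)) :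
    Module.finrank ℤ (formLattice ℓ) ≤ 2 * m := by
  obtain ⟨φ, hφ⟩ := hK
  have hmem : ∀ i, φ (ℓ i) ∈ LinearMap.range (gaussianInclusion m) := by
    intro i
    choose a ha using fun j => (hφ i j).1
    choose b hb using fun j => (hφ i j).2
    refine ⟨fun j => (a j, b j), ?_⟩
    funext j
    exact Complex.ext (ha j).symm (hb j).symm
  let f : (Fin m → ℂ) →ₗ[ℤ] (Fin m → ℂ) := φ.linear.toLinearMap.restrictScalars ℤ
  have hf : ∀ x ∈ formLattice ℓ, f x ∈ LinearMap.range (gaussianInclusion m) := by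
    change formLattice ℓ ≤ (LinearMap.range (gaussianInclusion m)).comap f
    refine Submodule.span_le.2 ?_
    rintro _ ⟨i, rfl⟩
    have h1 : φ.linear (ℓ i -ᵥ ℓ 0) = φ (ℓ i) -ᵥ φ (ℓ 0) :=
      φ.toAffineMap.linearMap_vsub (ℓ i) (ℓ 0)
    have h2 : f (ℓ i - ℓ 0) = φ (ℓ i) - φ (ℓ 0) := h1
    rw [SetLike.mem_coe, Submodule.mem_comap, h2]
    exact Submodule.sub_mem _ (hmem i) (hmem 0)
  have hinj : Function.Injective (f.restrict hf) := by
    intro x y hxy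
    exact Subtype.ext (φ.linear.injective (congrArg Subtype.val hxy))
  refine (LinearMap.finrank_le_finrank_of_injective hinj).trans
    ((LinearMap.finrank_range_le _).trans ?_)
  rw [Module.finrank_pi_fintype]
  simp [mul_comm]

/-- For the lower bound, the real parts of a lattice basis inject a real space of dimension `2m` in
a real space whose dimension is the rank. -/
theorem finrank_formLattice {ℓ : Fin (n + 1) → Fin m → ℂ}
    (hℓ : ∀ v, (∀ i, realForm ℓ i v = 0) → v = 0)
    (hK : ∃ φ : (Fin m → ℂ) ≃ᵃ[ℝ] (Fin m → ℂ), ∀ (i : Fin (n + 1)) (j : Fin m),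
      (∃ a : ℤ, (φ (ℓ i) j).re = a) ∧ (∃ b : ℤ, (φ (ℓ i) j).im = b)) :
    Module.finrank ℤ (formLattice ℓ) = 2 * m := by
  refine le_antisymm (finrank_formLattice_le hK) ?_
  have := LinearMap.finrank_le_finrank_of_injective (injective_realPairing hℓ
    (eq_add_sum_repr ℓ (Module.finBasis ℤ (formLattice ℓ))))
  rwa [finrank_complex_pi, Module.finrank_fintype_fun_eq_card, Fintype.card_fin] at this

/-- If the forms are affinely spanning and satisfy condition (K), then their differences have
integral coordinates in some real basis, and these coordinates span the integral vectors. -/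
theorem exists_integral_weights {ℓ : Fin (n + 1) → Fin m → ℂ}
    (hℓ : ∀ v, (∀ i, realForm ℓ i v = 0) → v = 0)
    (hK : ∃ φ : (Fin m → ℂ) ≃ᵃ[ℝ] (Fin m → ℂ), ∀ (i : Fin (n + 1)) (j : Fin m),
      (∃ a : ℤ, (φ (ℓ i) j).re = a) ∧ (∃ b : ℤ, (φ (ℓ i) j).im = b)) :
    ∃ (α : Fin (2 * m) → Fin m → ℂ) (ν : Fin (n + 1) → Fin (2 * m) → ℤ),
      (∀ i, ℓ i = ℓ 0 + ∑ k, ν i k • α k) ∧ ν 0 = 0 ∧ Function.Injective (realPairing α) ∧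
      ∀ t : CTorus (2 * m), (∀ i, algAction ν t i = 1) → t = 1 := by
  let b := Module.finBasisOfFinrankEq ℤ (formLattice ℓ) (finrank_formLattice hℓ hK)
  have hb := eq_add_sum_repr ℓ b
  refine ⟨fun k => b k, fun i k => b.repr ⟨ℓ i - ℓ 0, sub_mem_formLattice ℓ i⟩ k, hb, ?_,
    injective_realPairing hℓ hb, fun t ht => ?_⟩
  · have : (⟨ℓ 0 - ℓ 0, sub_mem_formLattice ℓ 0⟩ : formLattice ℓ) = 0 := Subtype.ext (sub_self _)
    funext k
    simp only [this, map_zero, Finsupp.coe_zero]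
  -- An element `t` defines a character of the whole lattice. It is trivial on the generators, hence
  -- on the basis vectors, where its values are the coordinates of `t`. Taking a basis of the
  -- lattice generated by the differences, and not of a larger one, is what makes the action
  -- effective.
  · have key : ∀ x (hx : x ∈ formLattice ℓ), ∏ k, t k ^ b.repr ⟨x, hx⟩ k = 1 := by
      intro x hx
      induction hx using Submodule.span_induction with
      | mem x h =>
        obtain ⟨i, rfl⟩ := h
        exact ht i
      | zero =>
        have : (⟨0, Submodule.zero_mem _⟩ : formLattice ℓ) = 0 := rfl
        simp only [this, map_zero, Finsupp.coe_zero, Pi.zero_apply, zpow_zero,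
          Finset.prod_const_one]
      | add x y hx hy h1 h2 =>
        have : (⟨x + y, Submodule.add_mem _ hx hy⟩ : formLattice ℓ) = ⟨x, hx⟩ + ⟨y, hy⟩ := rfl
        simp only [this, map_add, Finsupp.coe_add, Pi.add_apply, zpow_add, Finset.prod_mul_distrib]
        rw [h1, h2, one_mul]
      | smul a x hx h =>
        have : (⟨a • x, Submodule.smul_mem _ a hx⟩ : formLattice ℓ) = a • ⟨x, hx⟩ := rfl
        simp only [this, map_smul, Finsupp.coe_smul, Pi.smul_apply, smul_eq_mul, mul_comm a,
          zpow_mul, Finset.prod_zpow]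
        rw [h, one_zpow]
    funext k
    have h := key _ (b k).2
    have h1 : (⟨((b k : formLattice ℓ) : Fin m → ℂ), (b k).2⟩ : formLattice ℓ) = b k := rfl
    rw [h1, b.repr_self, Finset.prod_eq_single k] at h
    · simpa using h
    · intro k' _ hk'
      rw [Finsupp.single_eq_of_ne (by simpa using hk'), zpow_zero]
    · simp

end IntegralBasis

/-! ### One-parameter subgroups of the torus -/

section Torus

variable {m k : ℕ}

/-- The homomorphism `z ↦ (exp αₖ(z))ₖ` to the torus. -/
noncomputable def torusExp (α : Fin k → Fin m → ℂ) :
    Multiplicative (Fin m → ℂ) →* CTorus k where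
  toFun z := fun i => Units.mk0 (Complex.exp (∑ j, α i j * z.toAdd j)) (Complex.exp_ne_zero _)
  map_one' := by
    funext i
    ext
    simp
  map_mul' z w := by
    funext i
    ext
    simp [mul_add, Finset.sum_add_distrib, Complex.exp_add]

theorem torusExp_apply (α : Fin k → Fin m → ℂ) (z : Multiplicative (Fin m → ℂ)) (i : Fin k) :
    ((torusExp α z i : ℂˣ) : ℂ) = Complex.exp (∑ j, α i j * z.toAdd j) := rfl

theorem continuous_torusExp (α : Fin k → Fin m → ℂ) : Continuous (torusExp α) := by
  refine continuous_pi fun i => ?_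
  rw [Units.isEmbedding_val₀.continuous_iff]
  have : Continuous fun z : Fin m → ℂ => Complex.exp (∑ j, α i j * z j) := by fun_prop
  exact this.comp continuous_toAdd

/-- The logarithms of the absolute values of the coordinates. -/
noncomputable def logNorm (t : CTorus k) : Fin k → ℝ := fun i => Real.log ‖(t i : ℂ)‖

theorem continuous_logNorm : Continuous (logNorm (k := k)) := by
  refine continuous_pi fun i => Continuous.log ?_ fun t => norm_ne_zero_iff.2 (t i).ne_zero
  exact (Units.continuous_val.comp (continuous_apply i)).norm

theorem exp_logNorm (t : CTorus k) (i : Fin k) : Real.exp (logNorm t i) = ‖(t i : ℂ)‖ :=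
  Real.exp_log (norm_pos_iff.2 (t i).ne_zero)

theorem logNorm_mul (s t : CTorus k) : logNorm (s * t) = logNorm s + logNorm t := by
  funext i
  simp only [logNorm, Pi.mul_apply, Pi.add_apply, Units.val_mul, norm_mul]
  exact Real.log_mul (norm_ne_zero_iff.2 (s i).ne_zero) (norm_ne_zero_iff.2 (t i).ne_zero)

theorem logNorm_torusExp (α : Fin k → Fin m → ℂ) (z : Multiplicative (Fin m → ℂ)) :
    logNorm (torusExp α z) = realPairing α z.toAdd := by
  funext i
  rw [logNorm, torusExp_apply, Complex.norm_exp, Real.log_exp, realPairing_apply]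

/-- The elements of the torus whose coordinates have bounded logarithms are in a compact set. -/
theorem exists_isCompact_of_norm_logNorm_le (R : ℝ) :
    ∃ K : Set (CTorus k), IsCompact K ∧ ∀ t, ‖logNorm t‖ ≤ R → t ∈ K := by
  let f : (Fin k → ℂ) → CTorus k := fun w i =>
    Units.mk0 (Complex.exp (w i)) (Complex.exp_ne_zero _)
  have hf : Continuous f := by
    refine continuous_pi fun i => ?_
    rw [Units.isEmbedding_val₀.continuous_iff]
    exact Complex.continuous_exp.comp (continuous_apply i)
  refine ⟨f '' Metric.closedBall 0 (R + Real.pi), (isCompact_closedBall _ _).image hf,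
    fun t ht => ⟨fun i => Complex.log (t i), ?_, ?_⟩⟩
  · have hR : 0 ≤ R := (norm_nonneg _).trans ht
    rw [mem_closedBall_zero_iff, pi_norm_le_iff_of_nonneg (by positivity)]
    intro i
    refine (Complex.norm_le_abs_re_add_abs_im _).trans (add_le_add ?_ ?_)
    · rw [Complex.log_re]
      exact (norm_le_pi_norm (logNorm t) i).trans ht
    · rw [Complex.log_im]
      exact Complex.abs_arg_le_pi _
  · funext i
    exact Units.ext (Complex.exp_log (t i).ne_zero)

variable {α : Fin (2 * m) → Fin m → ℂ} (hα : Function.Injective (realPairing α))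

/-- The real linear isomorphism `z ↦ (Re αₖ(z))ₖ`. -/
noncomputable def realPairingEquiv : (Fin m → ℂ) ≃L[ℝ] (Fin (2 * m) → ℝ) :=
  (LinearEquiv.ofInjectiveOfFinrankEq (realPairing α) hα (by
    rw [finrank_complex_pi, Module.finrank_fintype_fun_eq_card,
      Fintype.card_fin])).toContinuousLinearEquiv

theorem realPairingEquiv_apply (z : Fin m → ℂ) : realPairingEquiv hα z = realPairing α z := rfl

/-- The continuous retraction of the torus on `ℂᵐ`. -/
noncomputable def torusRetraction (t : CTorus (2 * m)) : Multiplicative (Fin m → ℂ) :=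
  Multiplicative.ofAdd ((realPairingEquiv hα).symm (logNorm t))

theorem continuous_torusRetraction : Continuous (torusRetraction hα) :=
  continuous_ofAdd.comp ((realPairingEquiv hα).symm.continuous.comp continuous_logNorm)

theorem realPairing_torusRetraction (t : CTorus (2 * m)) :
    realPairing α (torusRetraction hα t).toAdd = logNorm t :=
  (realPairingEquiv hα).apply_symm_apply _

theorem torusRetraction_torusExp (z : Multiplicative (Fin m → ℂ)) :
    torusRetraction hα (torusExp α z) = z := by
  rw [torusRetraction, logNorm_torusExp, ← realPairingEquiv_apply hα,
    ContinuousLinearEquiv.symm_apply_apply, ofAdd_toAdd]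

-- Since `|exp αₖ(z)| = exp (Re αₖ(z))`, the logarithms of the moduli recover `z`. The homomorphism
-- thus has a continuous left inverse and is a closed embedding.
include hα in
theorem isClosed_range_torusExp : IsClosed ((torusExp α).range : Set (CTorus (2 * m))) := by
  rw [MonoidHom.coe_range]
  exact (Function.LeftInverse.isClosedEmbedding (torusRetraction_torusExp hα)
    (continuous_torusRetraction hα) (continuous_torusExp α)).isClosed_range

-- Dividing `t` by the element of the subgroup with the same moduli leaves coordinates of modulus
-- `1`, so a compact set represents all cosets.
include hα in
theorem compactSpace_quotient_range_torusExp :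
    CompactSpace (CTorus (2 * m) ⧸ (torusExp α).range) := by
  obtain ⟨K, hK, hmem⟩ := exists_isCompact_of_norm_logNorm_le (k := 2 * m) 0
  refine ⟨?_⟩
  convert hK.image (QuotientGroup.continuous_mk (N := (torusExp α).range))
  refine (Set.eq_univ_of_forall fun y => ?_).symm
  obtain ⟨t, rfl⟩ := QuotientGroup.mk_surjective y
  let g := torusExp α (torusRetraction hα t)
  refine ⟨g⁻¹ * t, hmem _ ?_, QuotientGroup.eq.2 ⟨torusRetraction hα t, ?_⟩⟩
  · have h1 : logNorm (g * (g⁻¹ * t)) = logNorm t := by rw [mul_inv_cancel_left]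
    rw [logNorm_mul, logNorm_torusExp, realPairing_torusRetraction] at h1
    rw [add_eq_left.1 h1, norm_zero]
  · change g = (g⁻¹ * t)⁻¹ * t
    rw [mul_inv_rev, inv_inv, mul_comm t⁻¹, inv_mul_cancel_right]

/-- The parametrization of the subgroup of the torus. -/
noncomputable def torusExpEquiv : Multiplicative (Fin m → ℂ) ≃ₜ* (torusExp α).range where
  toMulEquiv := (torusExp α).ofInjective
    (Function.LeftInverse.injective (torusRetraction_torusExp hα))
  continuous_toFun := (continuous_torusExp α).subtype_mk _
  continuous_invFun := by
    have : ∀ t : (torusExp α).range, ((torusExp α).ofInjective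
        (Function.LeftInverse.injective (torusRetraction_torusExp hα))).symm t =
        torusRetraction hα t := by
      intro t
      rw [MulEquiv.symm_apply_eq]
      obtain ⟨_, z, rfl⟩ := t
      rw [torusRetraction_torusExp]
      rfl
    exact ((continuous_torusRetraction hα).comp continuous_subtype_val).congr
      fun t => (this t).symm

end Torus

/-! ### The topology of projective space -/

section ProjectiveSpace

variable {n : ℕ}

theorem isOpenQuotientMap_mk : IsOpenQuotientMap
    fun v : {v : Fin (n + 1) → ℂ // v ≠ 0} => Projectivization.mk ℂ v.1 v.2 := by
  refine ⟨fun u => ⟨⟨u.rep, u.rep_nonzero⟩, u.mk_rep⟩, continuous_coinduced_rng, fun O hO => ?_⟩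
  refine isOpen_coinduced.2 ?_
  have : (fun v : {v : Fin (n + 1) → ℂ // v ≠ 0} => Projectivization.mk ℂ v.1 v.2) ⁻¹'
      ((fun v : {v : Fin (n + 1) → ℂ // v ≠ 0} => Projectivization.mk ℂ v.1 v.2) '' O) =
      ⋃ a : ℂˣ, (fun v : {v : Fin (n + 1) → ℂ // v ≠ 0} =>
        (⟨a • v.1, (smul_ne_zero_iff_ne a).2 v.2⟩ : {v : Fin (n + 1) → ℂ // v ≠ 0})) ⁻¹' O := by
    ext v
    simp only [Set.mem_preimage, Set.mem_image, Set.mem_iUnion, Projectivization.mk_eq_mk_iff]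
    constructor
    · rintro ⟨w, hw, a, ha⟩
      refine ⟨a, ?_⟩
      simp only [ha]
      exact hw
    · rintro ⟨a, ha⟩
      exact ⟨_, ha, a, rfl⟩
  rw [this]
  refine isOpen_iUnion fun a => hO.preimage ?_
  exact (continuous_subtype_val.const_smul a).subtype_mk _

/-- Proportionality of nonzero vectors is a closed relation, being the vanishing of all `2 × 2`
minors. -/
instance : T2Space (CPn n) := by
  refine (t2Space_iff_of_isOpenQuotientMap isOpenQuotientMap_mk).2 ?_
  have : {q : {v : Fin (n + 1) → ℂ // v ≠ 0} × {v : Fin (n + 1) → ℂ // v ≠ 0} |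
      Projectivization.mk ℂ q.1.1 q.1.2 = Projectivization.mk ℂ q.2.1 q.2.2} =
      ⋂ i, ⋂ j, {q | q.1.1 i * q.2.1 j = q.1.1 j * q.2.1 i} := by
    ext ⟨⟨x, hx⟩, ⟨y, hy⟩⟩
    simp only [Set.mem_ofPred_eq, Set.mem_iInter, Projectivization.mk_eq_mk_iff']
    constructor
    · rintro ⟨a, rfl⟩ i j
      simp only [Pi.smul_apply, smul_eq_mul]
      ring
    · intro h
      obtain ⟨j, hj⟩ := Function.ne_iff.1 hy
      refine ⟨x j / y j, ?_⟩
      funext i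
      have := h i j
      simp only [Pi.zero_apply] at hj
      simp only [Pi.smul_apply, smul_eq_mul]
      rw [div_mul_eq_mul_div, div_eq_iff hj, this]
  rw [this]
  refine isClosed_iInter fun i => isClosed_iInter fun j => isClosed_eq ?_ ?_
  · exact ((continuous_apply i).comp (continuous_subtype_val.comp continuous_fst)).mul
      ((continuous_apply j).comp (continuous_subtype_val.comp continuous_snd))
  · exact ((continuous_apply j).comp (continuous_subtype_val.comp continuous_fst)).mul
      ((continuous_apply i).comp (continuous_subtype_val.comp continuous_snd))

theorem torus_mul_ne_zero (c : CTorus (n + 1)) {x : Fin (n + 1) → ℂ} (hx : x ≠ 0) :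
    (fun i => (c i : ℂ) * x i) ≠ 0 := by
  obtain ⟨i, hi⟩ := Function.ne_iff.1 hx
  exact Function.ne_iff.2 ⟨i, mul_ne_zero (c i).ne_zero hi⟩

theorem continuous_torus_smul : Continuous fun q : CTorus (n + 1) × CPn n => q.1 • q.2 := by
  rw [((IsOpenQuotientMap.id (X := CTorus (n + 1))).prodMap
    (isOpenQuotientMap_mk (n := n))).isQuotientMap.continuous_iff]
  refine isOpenQuotientMap_mk.continuous.comp
    (Continuous.subtype_mk (f := fun q : CTorus (n + 1) × {v : Fin (n + 1) → ℂ // v ≠ 0} =>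
      fun i => (q.1 i : ℂ) * q.2.1 i) ?_ fun q => torus_mul_ne_zero q.1 q.2.2)
  refine continuous_pi fun i => Continuous.mul ?_ ?_
  · exact Units.continuous_val.comp ((continuous_apply i).comp continuous_fst)
  · exact (continuous_apply i).comp (continuous_subtype_val.comp continuous_snd)

theorem torus_smul_eq_of_eq_mul {c d : CTorus (n + 1)} {a : ℂ} (h : ∀ i, (c i : ℂ) = a * d i)
    (x : CPn n) : c • x = d • x := by
  induction x using Projectivization.ind with
  | h x hx =>
    rw [CPn.torus_smul_mk _ _ _ (torus_mul_ne_zero c hx),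
      CPn.torus_smul_mk _ _ _ (torus_mul_ne_zero d hx), Projectivization.mk_eq_mk_iff']
    refine ⟨a, ?_⟩
    funext i
    rw [Pi.smul_apply, smul_eq_mul, h, mul_assoc]

set_option synthInstance.maxHeartbeats 200000 in
theorem apply_eq_of_forall_torus_smul_eq {c : CTorus (n + 1)} (h : ∀ x : CPn n, c • x = x)
    (i j : Fin (n + 1)) : c i = c j := by
  -- The single point `[1 : … : 1]` suffices: it is fixed only if all coordinates of `c` agree.
  have h1 : (fun _ : Fin (n + 1) => (1 : ℂ)) ≠ 0 := Function.ne_iff.2 ⟨0, one_ne_zero⟩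
  have h2 := h (Projectivization.mk ℂ _ h1)
  rw [CPn.torus_smul_mk _ _ _ (torus_mul_ne_zero c h1), Projectivization.mk_eq_mk_iff'] at h2
  obtain ⟨a, ha⟩ := h2
  have h3 : ∀ i, (c i : ℂ) = a := fun i => by
    have := congrFun ha i
    simpa using this.symm
  exact Units.ext ((h3 i).trans (h3 j).symm)

theorem continuous_algAction {k : ℕ} (lam : Fin (n + 1) → Fin k → ℤ) :
    Continuous (algAction lam) :=
  continuous_pi fun i =>
    (continuous_finsetProd _ fun j _ => (continuous_apply j).zpow (lam i j) :
      Continuous fun t : CTorus k => ∏ j, t j ^ lam i j)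

end ProjectiveSpace

/-! ### Intermediate GIT-quotients from condition (K) -/

section Intermediate

variable {m n : ℕ} {ℓ : Fin (n + 1) → Fin m → ℂ} {α : Fin (2 * m) → Fin m → ℂ}
  {ν : Fin (n + 1) → Fin (2 * m) → ℤ}

theorem norm_algAction_apply {k : ℕ} (lam : Fin (n + 1) → Fin k → ℤ) (t : CTorus k)
    (i : Fin (n + 1)) :
    ‖(algAction lam t i : ℂ)‖ = Real.exp (∑ j, lam i j * logNorm t j) := by
  rw [Real.exp_sum]
  simp only [algAction, MonoidHom.coe_mk, OneHom.coe_mk, Units.coe_prod, Units.val_zpow_eq_zpow_val,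
    norm_prod, norm_zpow]
  refine Finset.prod_congr rfl fun j _ => ?_
  rw [mul_comm, Real.exp_mul, exp_logNorm, Real.rpow_intCast]

/-- Here `exp ℓᵢ(z)` is `exp ℓ₀(z)` times the monomial of weight `νᵢ` in the `exp αₖ(z)`, and the
factor common to all `i` disappears in projective space. -/
theorem holAction_smul_eq (h : ∀ i, ℓ i = ℓ 0 + ∑ k, ν i k • α k)
    (z : Multiplicative (Fin m → ℂ)) (x : CPn n) :
    holAction ℓ z • x = algAction ν (torusExp α z) • x := by
  refine torus_smul_eq_of_eq_mul (a := Complex.exp (∑ j, ℓ 0 j * z.toAdd j)) (fun i => ?_) x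
  have h1 : (holAction ℓ z i : ℂ) = Complex.exp (∑ j, ℓ i j * z.toAdd j) := rfl
  rw [h1, form_apply_eq_add_sum h, Complex.exp_add]
  refine congrArg _ ?_
  rw [Complex.exp_sum]
  simp only [algAction, MonoidHom.coe_mk, OneHom.coe_mk, Units.coe_prod, Units.val_zpow_eq_zpow_val,
    torusExp_apply, Complex.exp_int_mul]

theorem LVMData.torus_smul_mem_U (D : LVMData m n) (c : CTorus (n + 1)) {x : CPn n}
    (hx : x ∈ D.U) : c • x ∈ D.U := by
  induction x using Projectivization.ind with
  | h x hx0 =>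
    rw [CPn.torus_smul_mk _ _ _ (torus_mul_ne_zero c hx0), D.mk_mem_U]
    obtain ⟨s, hs, h⟩ := (D.mk_mem_U hx0).1 hx
    exact ⟨s, hs, fun i hi => mul_ne_zero (c i).ne_zero (h i hi)⟩

/-- Elements of the torus that move points near `x` to points near `y` are bounded. -/
theorem exists_eventually_norm_logNorm_le (D : LVMData m n) (hα : Function.Injective (realPairing α))
    (h : ∀ i, D.form i = D.form 0 + ∑ k, ν i k • α k) {M : ℝ} (hsep : SepBound D.form D.family M)
    {x y : CPn n} (hx : x ∈ D.U) (hy : y ∈ D.U) :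
    ∃ R, ∀ᶠ q in 𝓝 (x, y), ∀ t, algAction ν t • q.1 = q.2 → ‖logNorm t‖ ≤ R := by
  induction x using Projectivization.ind with
  | h x hx0 =>
  induction y using Projectivization.ind with
  | h y hy0 =>
  obtain ⟨s, hs, hxs⟩ := (D.mk_mem_U hx0).1 hx
  obtain ⟨t, ht, hyt⟩ := (D.mk_mem_U hy0).1 hy
  obtain ⟨R, hR⟩ := eventually_norm_le (M := M) (m := m) hs ht hxs hyt
  let L := (realPairingEquiv hα : (Fin m → ℂ) →L[ℝ] (Fin (2 * m) → ℝ))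
  refine ⟨‖L‖ * R, ?_⟩
  have hval : Continuous fun q : {v : Fin (n + 1) → ℂ // v ≠ 0} × {v : Fin (n + 1) → ℂ // v ≠ 0} =>
      (q.1.1, q.2.1) := by fun_prop
  have hR' := (hval.tendsto (⟨x, hx0⟩, ⟨y, hy0⟩)).eventually hR
  have hopen := (isOpenQuotientMap_mk (n := n)).prodMap (isOpenQuotientMap_mk (n := n))
  have himage := hopen.isOpenMap.image_mem_nhds hR'
  filter_upwards [himage]
  rintro _ ⟨⟨⟨x', hx'⟩, ⟨y', hy'⟩⟩, hq, rfl⟩ t ht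
  simp only [Prod.map_apply] at ht
  rw [CPn.torus_smul_mk _ _ _ (torus_mul_ne_zero _ hx'), Projectivization.mk_eq_mk_iff] at ht
  obtain ⟨a, ha⟩ := ht
  let z := (torusRetraction hα t).toAdd
  have hz : realPairing α z = logNorm t := realPairing_torusRetraction hα t
  -- The second component cancels the contribution of `ℓ₀` and accounts for the scalar `a` between
  -- the homogeneous coordinates. The `i`-th form then equals `log ‖algAction ν t i‖ - log ‖a‖`, so
  -- the bound for the cone applies to `t`.
  have hv := hq D.form hsep (z, -(∑ j, D.form 0 j * z j).re - Real.log ‖(a : ℂ)‖) fun i => by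
    have h1 : (algAction ν t i : ℂ) * x' i = a * y' i := (congrFun ha i).symm
    have h2 : ‖y' i‖ = ‖(a : ℂ)‖⁻¹ * (‖(algAction ν t i : ℂ)‖ * ‖x' i‖) := by
      rw [← norm_mul, h1, norm_mul, inv_mul_cancel_left₀ (norm_ne_zero_iff.2 a.ne_zero)]
    rw [realForm_eq_add_sum h, realForm_apply, hz]
    simp only
    rw [h2, norm_algAction_apply, ← mul_assoc, ← Real.exp_log (norm_pos_iff.2 a.ne_zero),
      ← Real.exp_neg, ← Real.exp_add, Real.exp_log (norm_pos_iff.2 a.ne_zero)]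
    congr 2
    ring
  rw [← hz]
  exact (L.le_opNorm z).trans
    (mul_le_mul_of_nonneg_left ((norm_fst_le (E := Fin m → ℂ) (z, _)).trans hv) (norm_nonneg _))

theorem LVMData.isGood_algAction (D : LVMData m n) (hα : Function.Injective (realPairing α))
    (h : ∀ i, D.form i = D.form 0 + ∑ k, ν i k • α k) (hν : ν 0 = 0)
    (heff : ∀ t : CTorus (2 * m), (∀ i, algAction ν t i = 1) → t = 1)
    {M : ℝ} (hsep : SepBound D.form D.family M) (hM : 0 ≤ M) (hex : Exchangeable D.family) :
    IsGood (algAction ν) D.U where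
  -- Acting trivially on `ℙⁿ` only makes the characters equal to each other; the normalization `ν 0
  -- = 0` makes their common value `1`.
  effective t ht := by
    refine heff t fun i => (apply_eq_of_forall_torus_smul_eq ht i 0).trans ?_
    simp [algAction, hν]
  stable t x hx := D.torus_smul_mem_U _ hx
  proper := by
    have hcont : Continuous fun q : CTorus (2 * m) × D.U => algAction ν q.1 • (q.2 : CPn n) :=
      continuous_torus_smul.comp (((continuous_algAction ν).comp continuous_fst).prodMk
        (continuous_subtype_val.comp continuous_snd))
    refine isProperMap_iff_ultrafilter_of_t2.2
      ⟨(hcont.subtype_mk _).prodMk continuous_snd, fun 𝒰 y hy => ?_⟩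
    -- When the second point and its translate converge in `U`, the torus elements eventually stay
    -- in a compact set, so the ultrafilter also converges in the torus factor.
    obtain ⟨R, hR⟩ := exists_eventually_norm_logNorm_le D hα h hsep y.2.2 y.1.2
    obtain ⟨K, hK, hKmem⟩ := exists_isCompact_of_norm_logNorm_le (k := 2 * m) R
    have h2 : Filter.Tendsto Prod.snd (𝒰 : Filter (CTorus (2 * m) × D.U)) (𝓝 y.2) :=
      (continuous_snd.tendsto y).comp hy
    have h1 : Filter.Tendsto (fun q : CTorus (2 * m) × D.U =>
        ((q.2 : CPn n), algAction ν q.1 • (q.2 : CPn n))) 𝒰 (𝓝 ((y.2 : CPn n), (y.1 : CPn n))) :=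
      (((continuous_subtype_val.comp continuous_snd).prodMk
        (continuous_subtype_val.comp continuous_fst)).tendsto y).comp hy
    have h3 : ∀ᶠ q in (𝒰 : Filter (CTorus (2 * m) × D.U)), q.1 ∈ K := by
      filter_upwards [h1.eventually hR] with q hq
      exact hKmem _ (hq _ rfl)
    obtain ⟨t, -, ht⟩ := hK.ultrafilter_le_nhds (𝒰.map Prod.fst)
      (Filter.le_principal_iff.2 h3)
    refine ⟨(t, y.2), ?_⟩
    rw [nhds_prod_eq]
    exact Filter.le_prod.2 ⟨ht, h2⟩
  compact := by
    refine D.compactSpace_of_continuous hsep hM hex (p := Quotient.mk (orbitSetoid _ D.U)) ?_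
      Quotient.mk_surjective ?_
    · exact continuous_quotient_mk'.comp (continuous_coneProj D.U)
    · rintro x y ⟨g, hg⟩
      exact Quotient.sound ⟨torusExp α g, (holAction_smul_eq h g x).symm.trans hg⟩

theorem LVMData.isIntermediateGITQuotient_of_affineSpan (D : LVMData m n)
    (hℓ : ∀ v, (∀ i, realForm D.form i v = 0) → v = 0) (hK : D.ConditionK)
    {M : ℝ} (hsep : SepBound D.form D.family M) (hM : 0 ≤ M) (hex : Exchangeable D.family)
    {d : ℕ} {N : ComplexManifold d} (hN : D.IsQuotientManifold N) :
    IsIntermediateGITQuotient m n N := by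
  obtain ⟨α, ν, h, hν, hα, heff⟩ := exists_integral_weights hℓ hK
  obtain ⟨p, hp⟩ := hN
  let Q : IntermediateGITDatum m n :=
    { weight := ν
      U := D.U
      good := D.isGood_algAction hα h hν heff hsep hM hex
      G := (torusExp α).range
      isClosed := isClosed_range_torusExp hα
      cocompact := compactSpace_quotient_range_torusExp hα
      iso := ⟨torusExpEquiv hα, fun i => by
        change Differentiable ℂ fun z : Fin m → ℂ => Complex.exp (∑ j, α i j * z j)
        fun_prop⟩ }
  refine ⟨Q, p, hp.surjective, fun x y => (hp.fibres x y).trans ?_, hp.submersion⟩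
  constructor
  · rintro ⟨g, hg⟩
    exact ⟨⟨torusExp α g, g, rfl⟩, (holAction_smul_eq h g x).symm.trans hg⟩
  · rintro ⟨⟨_, g, rfl⟩, hg⟩
    exact ⟨g, (holAction_smul_eq h g x).trans hg⟩

/-- The forms `0`, `zⱼ` and `i zⱼ`. -/
noncomputable def standardForm (m n : ℕ) (i : Fin (n + 1)) (j : Fin m) : ℂ :=
  if (i : ℕ) = 2 * j + 1 then 1 else if (i : ℕ) = 2 * j + 2 then Complex.I else 0

theorem eq_zero_of_realForm_standardForm (hmn : 2 * m ≤ n) {v : (Fin m → ℂ) × ℝ}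
    (hv : ∀ i, realForm (standardForm m n) i v = 0) : v = 0 := by
  have h0 : v.2 = 0 := by
    have := hv 0
    simpa [realForm_apply, standardForm] using this
  have hsum : ∀ (i : Fin (n + 1)), (∑ j, standardForm m n i j * v.1 j).re = 0 := fun i => by
    have := hv i
    rwa [realForm_apply, h0, add_zero] at this
  refine Prod.ext (funext fun j => Complex.ext ?_ ?_) h0
  · have := hsum ⟨2 * j + 1, by omega⟩
    rw [Finset.sum_eq_single j] at this
    · simpa [standardForm] using this
    · intro k _ hk
      have h1 : (2 * (j : ℕ) + 1) ≠ 2 * k + 1 := fun h => hk (Fin.ext (by omega))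
      have h2 : (2 * (j : ℕ) + 1) ≠ 2 * k + 2 := by omega
      simp only [standardForm, if_neg h1, if_neg h2, zero_mul]
    · simp
  · have := hsum ⟨2 * j + 2, by omega⟩
    rw [Finset.sum_eq_single j] at this
    · have h1 : (2 * (j : ℕ) + 2) ≠ 2 * j + 1 := by omega
      simpa [standardForm] using this
    · intro k _ hk
      have h1 : (2 * (j : ℕ) + 2) ≠ 2 * k + 1 := by omega
      have h2 : (2 * (j : ℕ) + 2) ≠ 2 * k + 2 := fun h => hk (Fin.ext (by omega))
      simp only [standardForm, if_neg h1, if_neg h2, zero_mul]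
    · simp

/-- A member of the family forces the forms to span affinely. An empty family gives no such
information, but then `U` is empty and the forms can be replaced by the standard integral ones,
which span because `2 * m ≤ n`. -/
theorem LVMData.isIntermediateGITQuotient (D : LVMData m n) (hmn : 2 * m ≤ n)
    (hK : D.ConditionK) {M : ℝ} (hsep : SepBound D.form D.family M) (hM : 0 ≤ M)
    (hex : Exchangeable D.family) {d : ℕ} {N : ComplexManifold d} (hN : D.IsQuotientManifold N) :
    IsIntermediateGITQuotient m n N := by
  rcases D.family.eq_empty_or_nonempty with hF | ⟨s, hs⟩
  · have hU : ∀ x : D.U, False := by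
      rintro ⟨x, s, hs, -⟩
      rw [hF] at hs
      exact hs
    obtain ⟨p, hp⟩ := hN
    let D' : LVMData m n := ⟨standardForm m n, D.family, D.card_eq⟩
    refine D'.isIntermediateGITQuotient_of_affineSpan
      (fun v => eq_zero_of_realForm_standardForm hmn)
      ⟨AffineEquiv.refl ℝ _, fun i j => ?_⟩ (M := M) ?_ hM hex
      ⟨p, hp.surjective, fun x => (hU x).elim, hp.submersion⟩
    · change (∃ a : ℤ, (standardForm m n i j).re = a) ∧ ∃ b : ℤ, (standardForm m n i j).im = b
      unfold standardForm
      split_ifs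
      · exact ⟨⟨1, by simp⟩, ⟨0, by simp⟩⟩
      · exact ⟨⟨0, by simp⟩, ⟨1, by simp⟩⟩
      · exact ⟨⟨0, by simp⟩, ⟨0, by simp⟩⟩
    · intro s hs
      exact absurd (hF ▸ hs : s ∈ (∅ : Set (Finset (Fin (n + 1))))) (Set.notMem_empty s)
  · exact D.isIntermediateGITQuotient_of_affineSpan
      (fun v hv => hsep.eq_zero hs fun i _ => hv i) hK hsep hM hex hN

end Intermediate

theorem SepBound.perturbedForm {m n : ℕ} {ℓ : Fin (n + 1) → Fin m → ℂ}
    {𝓕 : Set (Finset (Fin (n + 1)))} {M ε : ℝ} (h : SepBound ℓ 𝓕 M) (hε : M * (m * ε) ≤ 1 / 2)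
    {b : Fin ((n + 1) * m) → ℂ} (hb : ‖b‖ ≤ ε) : SepBound (perturbedForm ℓ b) 𝓕 (2 * M) := by
  refine h.perturb hε fun i j => ?_
  rw [_root_.perturbedForm, sub_add_cancel_left, norm_neg]
  exact (norm_le_pi_norm b _).trans hb

theorem mainTheorem5 (m n : ℕ) (hm : 0 < m) (hn : 2 * m ≤ n)
    (D : LVMData m n) (hD : D.IsLVMB) :
    (∃ N : ComplexManifold (n - m), D.IsQuotientManifold N) ∧
    ∀ N : ComplexManifold (n - m), D.IsQuotientManifold N →
      CompactSpace N ∧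
      (D.ConditionK → IsIntermediateGITQuotient m n N) ∧
      IsSmallDeformationOf (fun M => IsIntermediateGITQuotient m n M) N := by
  have hex : Exchangeable D.family := hD.comp
  obtain ⟨M, hM, hsep⟩ := hD.exists_sepBound
  have hmn : m ≤ n := by omega
  have hm' : (0 : ℝ) < m := Nat.cast_pos.2 hm
  -- This radius makes `M * (m * ε) ≤ 1 / 2`, so that the constant `2 * M` serves the whole ball; `M
  -- + 1` in place of `M` allows for `M = 0`.
  let ε : ℝ := 1 / (2 * (M + 1) * m)
  have hε : 0 < ε := by positivity
  have hMε : M * (m * ε) ≤ 1 / 2 := by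
    have : M * (m * ε) = M / (M + 1) * (1 / 2) := by
      simp only [ε]
      field_simp
    rw [this]
    exact mul_le_of_le_one_left (by norm_num) ((div_le_one (by positivity)).2 (by linarith))
  let B : Opens (Fin ((n + 1) * m) → ℂ) := ⟨Metric.ball 0 ε, Metric.isOpen_ball⟩
  have hball : ∀ {b}, b ∈ B ↔ ‖b‖ < ε := mem_ball_zero_iff
  have hB : ∀ b ∈ B, SepBound (perturbedForm D.form b) D.family (2 * M) := fun b hb =>
    hsep.perturbedForm hMε (hball.1 hb).le
  have h0 : (0 : Fin ((n + 1) * m) → ℂ) ∈ B := hball.2 (by rwa [norm_zero])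
  have hconn : IsConnected (B : Set (Fin ((n + 1) * m) → ℂ)) :=
    (convex_ball _ _).isConnected ⟨0, h0⟩
  have hM2 : 0 ≤ 2 * M := by positivity
  refine ⟨⟨_, D.perturb_zero ▸ D.isQuotientManifold_fibre hB hmn h0⟩, fun N hN =>
    ⟨D.compactSpace_quotient hsep hM hex hN,
      fun hK => D.isIntermediateGITQuotient hn hK hsep hM hex hN, ?_⟩⟩
  refine ⟨(n + 1) * m, D.holomorphicFamily hB hmn hM2 hex hconn, ⟨0, h0⟩,
    D.hasFibre_holomorphicFamily hB hmn hM2 hex hconn ⟨0, h0⟩ (D.perturb_zero.symm ▸ hN), ?_⟩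
  refine Metric.mem_closure_iff.2 fun δ hδ => ?_
  -- The parameter must be within `δ` of the origin and also stay in the ball where the family is
  -- defined.
  obtain ⟨b, hb, hK⟩ := D.exists_perturb_conditionK (lt_min hδ hε)
  have hbB : b ∈ B := hball.2 (hb.trans_le (min_le_right _ _))
  have hN' := D.isQuotientManifold_fibre hB hmn hbB
  refine ⟨⟨b, hbB⟩, ⟨_, (D.perturb b).isIntermediateGITQuotient hn hK (hB b hbB) hM2 hex hN',
    D.hasFibre_holomorphicFamily hB hmn hM2 hex hconn ⟨b, hbB⟩ hN'⟩, ?_⟩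
  rw [Subtype.dist_eq, dist_zero_left]
  exact hb.trans_le (min_le_left _ _)
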